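/- **Proposition 2.7 (exceptional divisor).** Let $X$ be a scheme and let $Z\subset D\subset X$ be closed subschemes with ideal sheaves $\mathcal I\supset\mathcal J$. Assume that $D\subset X$ is an effective Cartier divisor and that $Z\hookrightarrow D$ is a regular immersion (its ideal is generated by a regular sequence locally around each point of $Z$). Let $\mathrm{Bl}_Z^DX\to X$ be the affine blowup (dilatation) of $X$ in $Z$ along $D$: it is the relative spectrum of the quasi-coherent $\mathcal O_X$-algebra whose sections over an affine open $U$ on which $\mathcal J=(b)$ form the subring $\{x/b^n : n\ge 0,\ x\in\mathcal I(U)^n\}$ of $\mathcal O_X(U)[1/b]$. Put $\mathcal C_{Z/D}=\mathcal I/(\mathcal I^2+\mathcal J)$, $\mathcal N_{Z/D}=\mathcal C_{Z/D}^\vee$, $\mathcal J_Z=\mathcal J|_Z=\mathcal J/\mathcal I\mathcal J$ (an invertible $\mathcal O_Z$-module, with inverse $\mathcal J_Z^{-1}=\mathcal J_Z^\vee$), and $\mathbb V(\mathcal M)=\mathrm{Spec}_Z(\mathrm{Sym}\,\mathcal M)$ for a quasi-coherent $\mathcal O_Z$-module $\mathcal M$. 1. The exceptional divisor $\mathrm{Bl}_Z^DX\times_XZ\to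 Z$ is an affine space fibration and is Zariski locally over $Z$ isomorphic to $\mathbb V(\mathcal C_{Z/D}\otimes\mathcal J_Z^{-1})\to Z$: every point of $Z$ has an open neighbourhood $V$ in $Z$ over which it is isomorphic, as a $V$-scheme, to $\mathbb V(\mathcal C_{Z/D}\otimes\mathcal J_Z^{-1})$ and to $\mathbb A^n_V$ for some $n\ge 0$. 2. If $H^1(Z,\mathcal N_{Z/D}\otimes\mathcal J_Z)=0$, then $\mathrm{Bl}_Z^DX\times_XZ$ and $\mathbb V(\mathcal C_{Z/D}\otimes\mathcal J_Z^{-1})$ are isomorphic as $Z$-schemes. In particular they are isomorphic as $Z$-schemes if $Z$ is affine. 3. Suppose that $Z$ is a transversal intersection: $Z=W\times_XD$ for a closed subscheme $W\subset X$, with ideal sheaf $\mathcal K$, such that $Z$ is an effective Cartier divisor in $W$ (that is, local equations of $D$ remain nonzerodivisors in $\mathcal O_W$). Then there is a canonical isomorphism of $Z$-schemes $\mathbb V(\mathcal C_{Z/D}\otimes\mathcal J_Z^{-1})\cong\mathrm{Bl}_Z^DX\times_XZ$: the unique one for which, over every affine open $U\subset X$ with $\mathcal J(U)=(b)$, the function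 $k/b$ on $\mathrm{Bl}_Z^DX$, for $k\in\mathcal K(U)$, corresponds to $[k]\otimes b^\vee\in\mathcal C_{Z/D}\otimes\mathcal J_Z^{-1}$, where $b^\vee$ is the linear form on $\mathcal J_Z$ over $Z\cap U$ with $b^\vee([b])=1$. -/

import Mathlib

universe u
set_option linter.style.haveILetI false
open TensorProduct

/-! ### Localization away from one element, for ring homomorphisms and semilinear maps -/

section SemilinearLocalization

variable {R R' : Type u} [CommRing R] [CommRing R'] (σ : R →+* R') (r : R)
variable {M M' N N' : Type u} [AddCommGroup M] [AddCommGroup M'] [AddCommGroup N] [AddCommGroup N']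
variable [Module R M] [Module R' M'] [Module R N] [Module R' N']

/-- The ring homomorphism `σ : R → R'` is a localization of `R` away from `r`. -/
def IsAwayRingHom : Prop := letI := σ.toAlgebra; IsLocalization.Away r R'

variable {σ} in
/-- The semilinear map `g : M → M'` is a localization of `M` away from `r`: every `y` of `M'` is
of the form `g x / r ^ n`, and the kernel of `g` consists of the `r`-power torsion. It is used over
ring homomorphisms `σ` that are localizations away from `r`. -/
def IsAwayMap (g : M →ₛₗ[σ] M') : Prop :=
  (∀ y : M', ∃ (n : ℕ) (x : M), g x = σ r ^ n • y) ∧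
    ∀ x : M, g x = 0 → ∃ n : ℕ, r ^ n • x = 0

variable {σ r}

theorem IsAwayRingHom.isUnit (hσ : IsAwayRingHom σ r) : IsUnit (σ r) := by
  letI := σ.toAlgebra
  haveI : IsLocalization.Away r R' := hσ
  exact IsLocalization.Away.algebraMap_isUnit (S := R') r

theorem IsAwayMap.isLocalizedModule (hσ : IsAwayRingHom σ r) {g : M →ₛₗ[σ] M'}
    (hg : IsAwayMap r g) :
    letI := Module.compHom M' σ
    IsLocalizedModule (Submonoid.powers r)
      ({ toFun := g, map_add' := g.map_add, map_smul' := g.map_smul' } : M →ₗ[R] M') := by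
  letI := Module.compHom M' σ
  rw [isLocalizedModule_iff]
  refine ⟨?_, ?_, ?_⟩
  · rintro ⟨_, n, rfl⟩
    have hu : IsUnit (σ (r ^ n)) := by rw [map_pow]; exact hσ.isUnit.pow n
    rw [Module.End.isUnit_iff]
    exact hu.smul_bijective
  · intro y
    obtain ⟨n, x, h⟩ := hg.1 y
    refine ⟨⟨x, ⟨r ^ n, n, rfl⟩⟩, ?_⟩
    change σ (r ^ n) • y = g x
    rw [h, map_pow]
  · intro x₁ x₂ h
    obtain ⟨n, hn⟩ := hg.2 (x₁ - x₂) (by rw [map_sub, sub_eq_zero]; exact h)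
    refine ⟨⟨r ^ n, n, rfl⟩, ?_⟩
    change r ^ n • x₁ = r ^ n • x₂
    rwa [smul_sub, sub_eq_zero] at hn

theorem IsAwayMap.of_isLocalizedModule [Algebra R R'] [Module R M'] [IsScalarTower R R' M']
    (g : M →ₗ[R] M') [IsLocalizedModule (Submonoid.powers r) g]
    (g' : M →ₛₗ[algebraMap R R'] M') (h : ∀ x, g' x = g x) : IsAwayMap r g' := by
  refine ⟨fun y => ?_, fun x hx => ?_⟩
  · obtain ⟨⟨x, ⟨_, n, rfl⟩⟩, hx⟩ := IsLocalizedModule.surj (Submonoid.powers r) g y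
    refine ⟨n, x, ?_⟩
    rw [h, ← map_pow, algebraMap_smul]
    exact hx.symm
  · rw [h] at hx
    obtain ⟨⟨_, n, rfl⟩, hc⟩ := IsLocalizedModule.exists_of_eq (S := Submonoid.powers r)
      (f := g) (x₁ := x) (x₂ := 0) (by rw [hx, map_zero])
    exact ⟨n, by rw [smul_zero] at hc; exact hc⟩

theorem IsAwayMap.ext (hσ : IsAwayRingHom σ r) {g : M →ₛₗ[σ] M'} (hg : IsAwayMap r g)
    {a b : M' →ₗ[R'] N'} (h : ∀ x, a (g x) = b (g x)) : a = b := by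
  ext y
  obtain ⟨n, x, hx⟩ := hg.1 y
  have := h x
  rw [hx, map_smul, map_smul] at this
  exact (hσ.isUnit.pow n).smul_left_cancel.mp this

theorem IsAwayMap.existsUnique_extend (hσ : IsAwayRingHom σ r) {g : M →ₛₗ[σ] M'}
    (hg : IsAwayMap r g) (l : M →ₛₗ[σ] N') :
    ∃! l' : M' →ₗ[R'] N', ∀ x, l' (g x) = l x := by
  letI := σ.toAlgebra
  haveI : IsLocalization.Away r R' := hσ
  letI := Module.compHom M' σ
  letI := Module.compHom N' σ
  haveI : IsScalarTower R R' M' := ⟨fun a b c => by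
    change (σ a * b) • c = σ a • b • c; rw [mul_smul]⟩
  haveI : IsScalarTower R R' N' := ⟨fun a b c => by
    change (σ a * b) • c = σ a • b • c; rw [mul_smul]⟩
  let g₀ : M →ₗ[R] M' := { toFun := g, map_add' := g.map_add, map_smul' := g.map_smul' }
  let l₀ : M →ₗ[R] N' := { toFun := l, map_add' := l.map_add, map_smul' := l.map_smul' }
  haveI : IsLocalizedModule (Submonoid.powers r) g₀ := hg.isLocalizedModule hσ
  have hu : ∀ x : Submonoid.powers r, IsUnit ((algebraMap R (Module.End R N')) x) := by
    rintro ⟨_, n, rfl⟩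
    have hu : IsUnit (σ (r ^ n)) := by rw [map_pow]; exact hσ.isUnit.pow n
    rw [Module.End.isUnit_iff]
    exact hu.smul_bijective
  refine ⟨(IsLocalizedModule.lift (Submonoid.powers r) g₀ l₀ hu).extendScalarsOfIsLocalization
    (Submonoid.powers r) R', fun x => ?_, fun l' hl' => hg.ext hσ fun x => ?_⟩
  · exact IsLocalizedModule.lift_apply (Submonoid.powers r) g₀ l₀ hu x
  · rw [hl']
    exact (IsLocalizedModule.lift_apply (Submonoid.powers r) g₀ l₀ hu x).symm

theorem IsAwayMap.tensor (hσ : IsAwayRingHom σ r) {g : M →ₛₗ[σ] M'} {h : N →ₛₗ[σ] N'}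
    (hg : IsAwayMap r g) (hh : IsAwayMap r h) : IsAwayMap r (TensorProduct.map g h) := by
  letI := σ.toAlgebra
  haveI : IsLocalization.Away r R' := hσ
  letI := Module.compHom M' σ
  letI := Module.compHom N' σ
  haveI : IsScalarTower R R' M' := ⟨fun a b c => by
    change (σ a * b) • c = σ a • b • c; rw [mul_smul]⟩
  haveI : IsScalarTower R R' N' := ⟨fun a b c => by
    change (σ a * b) • c = σ a • b • c; rw [mul_smul]⟩
  let g₀ : M →ₗ[R] M' := { toFun := g, map_add' := g.map_add, map_smul' := g.map_smul' }
  let h₀ : N →ₗ[R] N' := { toFun := h, map_add' := h.map_add, map_smul' := h.map_smul' }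
  haveI : IsLocalizedModule (Submonoid.powers r) g₀ := hg.isLocalizedModule hσ
  haveI : IsLocalizedModule (Submonoid.powers r) h₀ := hh.isLocalizedModule hσ
  let e := (IsLocalization.moduleTensorEquiv (Submonoid.powers r) R' M' N').symm.restrictScalars R
  have := IsLocalizedModule.of_linearEquiv (Submonoid.powers r) (TensorProduct.map g₀ h₀) e
  refine IsAwayMap.of_isLocalizedModule (e.toLinearMap ∘ₗ TensorProduct.map g₀ h₀) _ fun x => ?_
  induction x with
  | zero => simp
  | add x y hx hy => rw [map_add, map_add, hx, hy]
  | tmul x y => rfl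

/-- The dual of a finitely presented module commutes with localization. -/
theorem IsAwayMap.dual [Module.FinitePresentation R M] (hσ : IsAwayRingHom σ r) {g : M →ₛₗ[σ] M'}
    (hg : IsAwayMap r g) (d : Module.Dual R M →ₛₗ[σ] Module.Dual R' M')
    (hd : ∀ l x, d l (g x) = σ (l x)) : IsAwayMap r d := by
  letI := σ.toAlgebra
  haveI : IsLocalization.Away r R' := hσ
  letI := Module.compHom M' σ
  haveI : IsScalarTower R R' M' := ⟨fun a b c => by
    change (σ a * b) • c = σ a • b • c; rw [mul_smul]⟩
  let g₀ : M →ₗ[R] M' := { toFun := g, map_add' := g.map_add, map_smul' := g.map_smul' }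
  haveI : IsLocalizedModule (Submonoid.powers r) g₀ := hg.isLocalizedModule hσ
  refine IsAwayMap.of_isLocalizedModule
    (IsLocalizedModule.mapExtendScalars (Submonoid.powers r) g₀ (Algebra.linearMap R R') R') d
    fun l => hg.ext hσ fun x => ?_
  rw [hd]
  exact (IsLocalizedModule.map_apply (Submonoid.powers r) g₀ (Algebra.linearMap R R') l x).symm

variable (σ) in
/-- The ring homomorphism `Sym_R M → Sym_R' M'` induced by a semilinear map `M → M'`. -/
noncomputable def symMap (g : M →ₛₗ[σ] M') : SymmetricAlgebra R M →+* SymmetricAlgebra R' M' :=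
  letI : Algebra R (SymmetricAlgebra R' M') := ((algebraMap R' _).comp σ).toAlgebra
  (SymmetricAlgebra.lift (R := R) (A := SymmetricAlgebra R' M')
    { toFun := fun x => SymmetricAlgebra.ι R' M' (g x)
      map_add' := fun x y => by rw [map_add, map_add]
      map_smul' := fun a x => by
        rw [map_smulₛₗ, map_smul, Algebra.smul_def, Algebra.smul_def]; rfl }).toRingHom

@[simp] theorem symMap_ι (g : M →ₛₗ[σ] M') (x : M) :
    symMap σ g (SymmetricAlgebra.ι R M x) = SymmetricAlgebra.ι R' M' (g x) := by
  letI : Algebra R (SymmetricAlgebra R' M') := ((algebraMap R' _).comp σ).toAlgebra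
  exact SymmetricAlgebra.lift_ι_apply _ x

@[simp] theorem symMap_algebraMap (g : M →ₛₗ[σ] M') (a : R) :
    symMap σ g (algebraMap R (SymmetricAlgebra R M) a) =
      algebraMap R' (SymmetricAlgebra R' M') (σ a) := by
  letI : Algebra R (SymmetricAlgebra R' M') := ((algebraMap R' _).comp σ).toAlgebra
  exact AlgHom.commutes _ a

theorem sym_ringHom_ext {A : Type*} [CommRing A] {φ ψ : SymmetricAlgebra R M →+* A}
    (h₀ : ∀ a, φ (algebraMap R (SymmetricAlgebra R M) a) = ψ (algebraMap R (SymmetricAlgebra R M) a))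
    (h₁ : ∀ x, φ (SymmetricAlgebra.ι R M x) = ψ (SymmetricAlgebra.ι R M x)) : φ = ψ := by
  refine RingHom.ext fun s => ?_
  induction s using SymmetricAlgebra.induction with
  | algebraMap a => exact h₀ a
  | ι x => exact h₁ x
  | mul a b ha hb => rw [map_mul, map_mul, ha, hb]
  | add a b ha hb => rw [map_add, map_add, ha, hb]

theorem IsAwayMap.symMap (hσ : IsAwayRingHom σ r) {g : M →ₛₗ[σ] M'} (hg : IsAwayMap r g) :
    IsAwayRingHom (symMap σ g) (algebraMap R (SymmetricAlgebra R M) r) := by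
  let L := Localization.Away (algebraMap R (SymmetricAlgebra R M) r)
  letI := σ.toAlgebra
  haveI : IsLocalization.Away r R' := hσ
  let iL : SymmetricAlgebra R M →+* L := algebraMap _ L
  let γ : R →+* L := iL.comp (algebraMap R (SymmetricAlgebra R M))
  have hγ : IsUnit (γ r) :=
    IsLocalization.Away.algebraMap_isUnit (S := L) (algebraMap R (SymmetricAlgebra R M) r)
  let τ : R' →+* L := IsLocalization.Away.lift r (g := γ) hγ
  have hτ : ∀ a, τ (σ a) = iL (algebraMap R (SymmetricAlgebra R M) a) :=
    fun a => IsLocalization.Away.lift_eq r hγ a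
  letI : Algebra R' L := τ.toAlgebra
  have hsm : ∀ (a : R') (x : L), a • x = τ a * x := fun a x => Algebra.smul_def a x
  obtain ⟨m, hm, -⟩ := hg.existsUnique_extend hσ (N' := L)
    { toFun := fun x => iL (SymmetricAlgebra.ι R M x)
      map_add' := fun x y => by rw [map_add, map_add]
      map_smul' := fun a x => by
        rw [map_smul, Algebra.smul_def, hsm, map_mul, hτ] }
  replace hm : ∀ x, m (g x) = iL (SymmetricAlgebra.ι R M x) := hm
  let ψ : SymmetricAlgebra R' M' →+* L := (SymmetricAlgebra.lift m).toRingHom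
  have hψι : ∀ y, ψ (SymmetricAlgebra.ι R' M' y) = m y := SymmetricAlgebra.lift_ι_apply m
  have hψa : ∀ a, ψ (algebraMap R' (SymmetricAlgebra R' M') a) = τ a :=
    fun a => AlgHom.commutes _ a
  have hu : IsUnit (_root_.symMap σ g (algebraMap R (SymmetricAlgebra R M) r)) := by
    rw [symMap_algebraMap]; exact hσ.isUnit.map _
  let φ : L →+* SymmetricAlgebra R' M' := IsLocalization.Away.lift _ hu
  have hφ : ∀ s, φ (iL s) = _root_.symMap σ g s := fun s => IsLocalization.Away.lift_eq _ hu s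
  have hφτ : ∀ a, φ (τ a) = algebraMap R' (SymmetricAlgebra R' M') a := by
    have : (φ.comp τ) = algebraMap R' (SymmetricAlgebra R' M') := by
      apply IsLocalization.ringHom_ext (Submonoid.powers r)
      refine RingHom.ext fun a => ?_
      change φ (τ (σ a)) = algebraMap R' (SymmetricAlgebra R' M') (σ a)
      rw [hτ, hφ, symMap_algebraMap]
    exact fun a => congr($this a)
  have h1 : ψ.comp φ = RingHom.id L := by
    apply IsLocalization.ringHom_ext (Submonoid.powers (algebraMap R (SymmetricAlgebra R M) r))
    apply sym_ringHom_ext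
    · intro a
      change ψ (φ (iL (algebraMap R (SymmetricAlgebra R M) a))) = iL _
      rw [hφ, symMap_algebraMap, hψa, hτ]
    · intro x
      change ψ (φ (iL (SymmetricAlgebra.ι R M x))) = iL _
      rw [hφ, symMap_ι, hψι, hm]
  have h2 : φ.comp ψ = RingHom.id _ := by
    apply sym_ringHom_ext
    · intro a
      change φ (ψ (algebraMap R' (SymmetricAlgebra R' M') a)) = _
      rw [hψa, hφτ]; rfl
    · intro y
      change φ (ψ (SymmetricAlgebra.ι R' M' y)) = SymmetricAlgebra.ι R' M' y
      rw [hψι]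
      obtain ⟨n, x, hx⟩ := hg.1 y
      have hun : IsUnit (algebraMap R' (SymmetricAlgebra R' M') (σ r ^ n)) :=
        (hσ.isUnit.pow n).map _
      apply hun.mul_left_cancel
      rw [← hφτ, ← map_mul, ← hsm, ← m.map_smul, ← hx, hm, hφ, symMap_ι, hx,
        (SymmetricAlgebra.ι R' M').map_smul, Algebra.smul_def, hφτ]
  let e : L ≃+* SymmetricAlgebra R' M' := RingEquiv.ofRingHom φ ψ h2 h1
  letI : Algebra (SymmetricAlgebra R M) (SymmetricAlgebra R' M') := (_root_.symMap σ g).toAlgebra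
  exact IsLocalization.isLocalization_of_algEquiv
    (Submonoid.powers (algebraMap R (SymmetricAlgebra R M) r))
    (AlgEquiv.ofRingEquiv (f := e) hφ : L ≃ₐ[SymmetricAlgebra R M] SymmetricAlgebra R' M')

end SemilinearLocalization

section AffineBlowup

variable {B C B' C' : Type u} [CommRing B] [CommRing C] [CommRing B'] [CommRing C']

/-- The subring of `C` consisting of the `s` with `J ^ n * s ⊆ I ^ n` for some `n`, where
`ρ : B → C` and `J ⊆ I` are ideals of `B`. When `J = (b)` and `C = B[1/b]`, this is the affine blowup
algebra `B[I/b]`, the subring of `B[1/b]` of all fractions `x / b ^ n` with `x ∈ I ^ n`. -/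
def blowupSubring (ρ : B →+* C) (I J : Ideal B) (h : J ≤ I) : Subring C where
  carrier := {s | ∃ n : ℕ, ∀ j ∈ J ^ n, ∃ i ∈ I ^ n, ρ i = ρ j * s}
  one_mem' := ⟨0, fun j _ => ⟨j, by simp, by simp⟩⟩
  zero_mem' := ⟨0, fun j _ => ⟨0, by simp, by simp⟩⟩
  neg_mem' := by
    rintro s ⟨n, hs⟩
    refine ⟨n, fun j hj => ?_⟩
    obtain ⟨i, hi, e⟩ := hs j hj
    exact ⟨-i, neg_mem hi, by rw [map_neg, e, mul_neg]⟩
  mul_mem' := by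
    rintro s t ⟨n, hs⟩ ⟨m, ht⟩
    refine ⟨n + m, fun j hj => ?_⟩
    rw [pow_add] at hj
    induction hj using Submodule.mul_induction_on' with
    | mem_mul_mem a ha b hb =>
      obtain ⟨i, hi, e⟩ := hs a ha
      obtain ⟨k, hk, e'⟩ := ht b hb
      refine ⟨i * k, by rw [pow_add]; exact Ideal.mul_mem_mul hi hk, ?_⟩
      rw [map_mul, map_mul, e, e']; ring
    | add x _ y _ hx hy =>
      obtain ⟨i, hi, e⟩ := hx
      obtain ⟨k, hk, e'⟩ := hy
      exact ⟨i + k, add_mem hi hk, by rw [map_add, map_add, e, e', add_mul]⟩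
  add_mem' := by
    have key : ∀ (n m : ℕ) (s : C), (∀ j ∈ J ^ n, ∃ i ∈ I ^ n, ρ i = ρ j * s) →
        ∀ j ∈ J ^ (n + m), ∃ i ∈ I ^ (n + m), ρ i = ρ j * s := by
      intro n m s hs j hj
      rw [pow_add] at hj
      induction hj using Submodule.mul_induction_on' with
      | mem_mul_mem a ha b hb =>
        obtain ⟨i, hi, e⟩ := hs a ha
        refine ⟨i * b, by rw [pow_add]; exact Ideal.mul_mem_mul hi (Ideal.pow_right_mono h m hb), ?_⟩
        rw [map_mul, map_mul, e]; ring
      | add x _ y _ hx hy =>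
        obtain ⟨i, hi, e⟩ := hx
        obtain ⟨k, hk, e'⟩ := hy
        exact ⟨i + k, add_mem hi hk, by rw [map_add, map_add, e, e', add_mul]⟩
    rintro s t ⟨n, hs⟩ ⟨m, ht⟩
    refine ⟨n + m, fun j hj => ?_⟩
    obtain ⟨i, hi, e⟩ := key n m s hs j hj
    obtain ⟨k, hk, e'⟩ := key m n t ht j (by rwa [add_comm])
    exact ⟨i + k, add_mem hi (by rwa [add_comm] at hk), by rw [map_add, e, e', mul_add]⟩

theorem mem_blowupSubring {ρ : B →+* C} {I J : Ideal B} {h : J ≤ I} {s : C} :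
    s ∈ blowupSubring ρ I J h ↔ ∃ n : ℕ, ∀ j ∈ J ^ n, ∃ i ∈ I ^ n, ρ i = ρ j * s := Iff.rfl

/-- If `J = (b)` is principal, the elements of the affine blowup algebra are exactly the fractions
`x / b ^ n` with `x ∈ I ^ n`. -/
theorem mem_blowupSubring_span_singleton {ρ : B →+* C} {I : Ideal B} {b : B}
    {h : Ideal.span {b} ≤ I} {s : C} :
    s ∈ blowupSubring ρ I (Ideal.span {b}) h ↔ ∃ n : ℕ, ∃ x ∈ I ^ n, ρ b ^ n * s = ρ x := by
  rw [mem_blowupSubring]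
  refine exists_congr fun n => ⟨fun hs => ?_, ?_⟩
  · obtain ⟨x, hx, e⟩ := hs (b ^ n) (Ideal.pow_mem_pow (Ideal.mem_span_singleton_self b) n)
    exact ⟨x, hx, by rw [e, map_pow]⟩
  · rintro ⟨x, hx, e⟩ j hj
    rw [Ideal.span_singleton_pow, Ideal.mem_span_singleton'] at hj
    obtain ⟨a, rfl⟩ := hj
    exact ⟨a * x, Ideal.mul_mem_left _ _ hx, by rw [map_mul, map_mul, map_pow, mul_assoc, e]⟩

theorem algebraMap_mem_blowupSubring (ρ : B →+* C) (I J : Ideal B) (h : J ≤ I) (x : B) :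
    ρ x ∈ blowupSubring ρ I J h :=
  ⟨0, fun j _ => ⟨j * x, by simp, map_mul _ _ _⟩⟩

theorem map_mem_blowupSubring {ρ : B →+* C} {ρ' : B' →+* C'} {β : B →+* B'} {γ : C →+* C'}
    (comm : ∀ x, γ (ρ x) = ρ' (β x)) {I J : Ideal B} {h : J ≤ I} {I' J' : Ideal B'} {h' : J' ≤ I'}
    (hI : I.map β = I') (hJ : J.map β = J') {s : C} (hs : s ∈ blowupSubring ρ I J h) :
    γ s ∈ blowupSubring ρ' I' J' h' := by
  subst hI hJ
  obtain ⟨n, hs⟩ := hs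
  refine ⟨n, fun j hj => ?_⟩
  rw [← Ideal.map_pow] at hj ⊢
  induction hj using Submodule.span_induction with
  | mem x hx =>
    obtain ⟨j, hj, rfl⟩ := hx
    obtain ⟨i, hi, e⟩ := hs j hj
    exact ⟨β i, Ideal.mem_map_of_mem _ hi, by rw [← comm, ← comm, e, map_mul]⟩
  | zero => exact ⟨0, zero_mem _, by simp⟩
  | add x y _ _ hx hy =>
    obtain ⟨i, hi, e⟩ := hx
    obtain ⟨k, hk, e'⟩ := hy
    exact ⟨i + k, add_mem hi hk, by rw [map_add, map_add, e, e', add_mul]⟩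
  | smul a x _ hx =>
    obtain ⟨i, hi, e⟩ := hx
    exact ⟨a * i, Ideal.mul_mem_left _ _ hi, by rw [smul_eq_mul, map_mul, map_mul, e, mul_assoc]⟩

theorem IsAwayRingHom.surj {σ : B →+* B'} {r : B} (h : IsAwayRingHom σ r) (y : B') :
    ∃ (n : ℕ) (x : B), σ x = σ r ^ n * y := by
  letI := σ.toAlgebra
  haveI : IsLocalization.Away r B' := h
  obtain ⟨n, x, e⟩ := IsLocalization.Away.surj r y
  exact ⟨n, x, by rw [mul_comm]; exact e.symm⟩

theorem IsAwayRingHom.inj {σ : B →+* B'} {r : B} (h : IsAwayRingHom σ r) {x : B} (hx : σ x = 0) :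
    ∃ n : ℕ, r ^ n * x = 0 := by
  letI := σ.toAlgebra
  haveI : IsLocalization.Away r B' := h
  obtain ⟨⟨_, n, rfl⟩, e⟩ := (IsLocalization.map_eq_zero_iff (Submonoid.powers r) B' x).mp hx
  exact ⟨n, e⟩

theorem IsAwayRingHom.mk' {σ : B →+* B'} {r : B} (hu : IsUnit (σ r))
    (hs : ∀ y, ∃ (n : ℕ) (x : B), σ x = σ r ^ n * y)
    (hi : ∀ x, σ x = 0 → ∃ n : ℕ, r ^ n * x = 0) : IsAwayRingHom σ r := by
  letI := σ.toAlgebra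
  refine IsLocalization.Away.mk r hu (fun y => ?_) fun a b hab => ?_
  · obtain ⟨n, x, e⟩ := hs y
    exact ⟨n, x, by rw [mul_comm]; exact e.symm⟩
  · obtain ⟨n, hn⟩ := hi (a - b) (by rw [map_sub, sub_eq_zero]; exact hab)
    exact ⟨n, by rwa [mul_sub, sub_eq_zero] at hn⟩

theorem IsAwayRingHom.mem_map {σ : B →+* B'} {r : B} (h : IsAwayRingHom σ r) {I : Ideal B} {y : B'}
    (hy : y ∈ I.map σ) : ∃ (n : ℕ) (x : B), x ∈ I ∧ σ x = σ r ^ n * y := by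
  letI := σ.toAlgebra
  haveI : IsLocalization.Away r B' := h
  obtain ⟨⟨⟨x, hx⟩, ⟨_, n, rfl⟩⟩, e⟩ :=
    (IsLocalization.mem_map_algebraMap_iff (Submonoid.powers r) B').mp hy
  refine ⟨n, x, hx, ?_⟩
  rw [← map_pow, mul_comm]
  exact e.symm

theorem IsAwayRingHom.blowupSubring {ρ : B →+* C} {ρ' : B' →+* C'} {β : B →+* B'} {γ : C →+* C'}
    (comm : ∀ x, γ (ρ x) = ρ' (β x)) {I J : Ideal B} {h : J ≤ I} {I' J' : Ideal B'} {h' : J' ≤ I'}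
    (hI : I.map β = I') (hJ : J.map β = J') {r : B} (hβ : IsAwayRingHom β r)
    (hγ : IsAwayRingHom γ (ρ r)) (hfg : J.FG) :
    IsAwayRingHom (γ.restrict (blowupSubring ρ I J h) (_root_.blowupSubring ρ' I' J' h')
      fun _ hs => map_mem_blowupSubring comm hI hJ hs)
      ⟨ρ r, algebraMap_mem_blowupSubring ρ I J h r⟩ := by
  subst hI hJ
  refine IsAwayRingHom.mk' ?_ ?_ ?_
  · obtain ⟨u, hu⟩ := hβ.isUnit.exists_right_inv
    refine IsUnit.of_mul_eq_one ⟨ρ' u, algebraMap_mem_blowupSubring _ _ _ _ u⟩ (Subtype.ext ?_)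
    change γ (ρ r) * ρ' u = 1
    rw [comm, ← map_mul, hu, map_one]
  · rintro ⟨s, n, hs⟩
    obtain ⟨N, t, ht⟩ := hγ.surj s
    have hfgn : (J ^ n).FG := hfg.pow
    obtain ⟨G, hG⟩ := hfgn
    -- for each generator, a power of `r` does the job
    have step : ∀ j ∈ J ^ n, ∃ M : ℕ, ∃ i ∈ I ^ n, ρ i = ρ j * (ρ r ^ M * t) := by
      intro j hj
      obtain ⟨i', hi', e⟩ := hs (β j) (by
        rw [← Ideal.map_pow]; exact Ideal.mem_map_of_mem _ hj)
      rw [← Ideal.map_pow] at hi'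
      obtain ⟨a, i, hi, ei⟩ := hβ.mem_map hi'
      have h0 : γ (ρ (r ^ N * i) - ρ j * (ρ r ^ a * t)) = 0 := by
        rw [map_sub, comm, map_mul, map_mul, map_mul, map_mul, ei, map_mul, e, ht, comm, map_pow,
          map_pow, map_pow, map_pow, comm]
        ring
      obtain ⟨b, hb⟩ := hγ.inj h0
      refine ⟨b + a, r ^ b * (r ^ N * i), Ideal.mul_mem_left _ _ (Ideal.mul_mem_left _ _ hi), ?_⟩
      rw [mul_sub, sub_eq_zero] at hb
      rw [map_mul, map_pow, hb]
      ring
    choose! M hM using step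
    let T := ∑ j ∈ G, M j
    refine ⟨T + N, ⟨ρ r ^ T * t, n, fun j hj => ?_⟩, Subtype.ext ?_⟩
    · rw [← hG] at hj
      induction hj using Submodule.span_induction with
      | mem j hj =>
        have hj' : j ∈ J ^ n := hG ▸ Submodule.subset_span hj
        obtain ⟨i, hi, e⟩ := hM j hj'
        have hle : M j ≤ T := Finset.single_le_sum (f := M) (fun _ _ => Nat.zero_le _) hj
        refine ⟨r ^ (T - M j) * i, Ideal.mul_mem_left _ _ hi, ?_⟩
        rw [map_mul, e, map_pow]
        calc _ = ρ j * ((ρ r ^ (T - M j) * ρ r ^ M j) * t) := by ring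
          _ = _ := by rw [← pow_add, Nat.sub_add_cancel hle]
      | zero => exact ⟨0, zero_mem _, by simp⟩
      | add x y _ _ hx hy =>
        obtain ⟨i, hi, e⟩ := hx
        obtain ⟨k, hk, e'⟩ := hy
        exact ⟨i + k, add_mem hi hk, by rw [map_add, map_add, e, e', add_mul]⟩
      | smul a x _ hx =>
        obtain ⟨i, hi, e⟩ := hx
        exact ⟨a * i, Ideal.mul_mem_left _ _ hi, by
          rw [smul_eq_mul, map_mul, map_mul, e, mul_assoc]⟩
    · change γ (ρ r ^ T * t) = γ (ρ r) ^ (T + N) * s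
      rw [map_mul, map_pow, ht, pow_add, mul_assoc]
  · rintro ⟨s, hs⟩ h0
    obtain ⟨n, hn⟩ := hγ.inj (x := s) (congrArg Subtype.val h0)
    exact ⟨n, Subtype.ext hn⟩

theorem IsAwayRingHom.map_nonZeroDivisors {σ : B →+* B'} {r : B} (h : IsAwayRingHom σ r) {b : B}
    (hb : b ∈ nonZeroDivisors B) : σ b ∈ nonZeroDivisors B' := by
  letI := σ.toAlgebra
  haveI : IsLocalization.Away r B' := h
  exact IsLocalization.map_nonZeroDivisors_le (Submonoid.powers r) B' ⟨b, hb, rfl⟩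

theorem IsAwayRingHom.fg_map {σ : B →+* B'} {r : B} (h : IsAwayRingHom σ r) {I : Ideal B}
    (hI : (I.map σ).FG) : (I.map (algebraMap B (Localization.Away r))).FG := by
  letI := σ.toAlgebra
  haveI : IsLocalization.Away r B' := h
  let e := IsLocalization.algEquiv (Submonoid.powers r) B' (Localization.Away r)
  have h1 : I.map (algebraMap B (Localization.Away r)) = (I.map σ).map e.toRingHom := by
    rw [Ideal.map_map]
    congr 1
    ext x
    exact (e.commutes x).symm
  rw [h1]
  exact Ideal.FG.map hI _

end AffineBlowup

/-! ### Affine blowups -/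

open AlgebraicGeometry CategoryTheory Limits TopologicalSpace Opposite

namespace AlgebraicGeometry.Scheme

/-- A morphism out of a glued scheme, given by a compatible family of morphisms on the charts. -/
noncomputable def Cover.RelativeGluingData.desc {S : Scheme.{u}} {𝒰 : S.OpenCover}
    [Category 𝒰.I₀] [𝒰.LocallyDirected] [Small.{u} 𝒰.I₀] [Quiver.IsThin 𝒰.I₀]
    (d : Cover.RelativeGluingData 𝒰) (c : Cocone d.functor) : d.glued ⟶ c.pt :=
  colimit.desc _ c

theorem Cover.RelativeGluingData.cover_f_desc {S : Scheme.{u}} {𝒰 : S.OpenCover}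
    [Category 𝒰.I₀] [𝒰.LocallyDirected] [Small.{u} 𝒰.I₀] [Quiver.IsThin 𝒰.I₀]
    (d : Cover.RelativeGluingData 𝒰) (c : Cocone d.functor) (i : 𝒰.I₀) :
    d.cover.f i ≫ d.desc c = c.ι.app i :=
  colimit.ι_desc c i

variable {X : Scheme.{u}}

/-- The restriction homomorphism `Γ(X, V) → Γ(X, U)` for open subsets `U ⊆ V`. -/
abbrev resHom {U V : X.Opens} (h : U ≤ V) : Γ(X, V) →+* Γ(X, U) :=
  (X.presheaf.map (homOfLE h).op).hom

theorem resHom_resHom {U V W : X.Opens} (h : U ≤ V) (h' : V ≤ W) (x : Γ(X, W)) :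
    resHom h (resHom h' x) = resHom (h.trans h') x := by
  change (X.presheaf.map _ ≫ X.presheaf.map _).hom x = _
  rw [← Functor.map_comp]; rfl

theorem resHom_self {U : X.Opens} (h : U ≤ U) (x : Γ(X, U)) : resHom h x = x := by
  change (X.presheaf.map (𝟙 (op U))).hom x = x
  rw [X.presheaf.map_id]; rfl

theorem isAwayRingHom_resHom {U : X.Opens} (hU : IsCompact U.1) (hU' : IsQuasiSeparated U.1)
    (f : Γ(X, U)) {V : X.Opens} (hV : X.basicOpen f = V) :
    IsAwayRingHom (resHom (hV ▸ X.basicOpen_le f : V ≤ U)) f := by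
  subst hV
  exact isLocalization_basicOpen_of_qcqs hU hU' f

/-- An object of the small affine Zariski site, as an affine open subset. -/
def AffineZariskiSite.aff (U : X.AffineZariskiSite) : X.affineOpens := U

theorem AffineZariskiSite.le {U V : X.AffineZariskiSite} (h : U ≤ V) : U.aff.1 ≤ V.aff.1 :=
  AffineZariskiSite.toOpens_mono h

theorem AffineZariskiSite.isAffineOpen (U : X.AffineZariskiSite) : IsAffineOpen U.aff.1 := U.2

theorem AffineZariskiSite.aff_mono {U V : X.AffineZariskiSite} (h : U ≤ V) : U.aff ≤ V.aff :=
  AffineZariskiSite.le h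

namespace IdealSheafData

/-- The closed subscheme `V(J)` is locally principal: locally `J` is generated by one element. -/
def IsLocallyPrincipal (J : X.IdealSheafData) : Prop :=
  ∀ x : X, ∃ U : X.affineOpens, x ∈ U.1 ∧ ∃ b : Γ(X, U), J.ideal U = Ideal.span {b}

/-- The closed subscheme `V(J)` is an effective Cartier divisor: locally `J` is generated by one
nonzerodivisor. -/
def IsEffectiveCartier (J : X.IdealSheafData) : Prop :=
  ∀ x : X, ∃ U : X.affineOpens, x ∈ U.1 ∧
    ∃ b ∈ nonZeroDivisors Γ(X, U), J.ideal U = Ideal.span {b}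

theorem IsEffectiveCartier.isLocallyPrincipal {J : X.IdealSheafData} (hJ : J.IsEffectiveCartier) :
    J.IsLocallyPrincipal := fun x => by
  obtain ⟨U, hU, b, -, hb⟩ := hJ x
  exact ⟨U, hU, b, hb⟩

theorem map_resHom (I : X.IdealSheafData) {U V : X.affineOpens} (h : U ≤ V) :
    (I.ideal V).map (resHom h) = I.ideal U := I.map_ideal h

theorem isAway_affineBasicOpen (U : X.affineOpens) (f : Γ(X, U)) :
    IsAwayRingHom (resHom (X.affineBasicOpen_le f : (X.affineBasicOpen f).1 ≤ U.1)) f :=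
  isAwayRingHom_resHom U.2.isCompact U.2.isQuasiSeparated f rfl

theorem IsLocallyPrincipal.exists_basicOpen {J : X.IdealSheafData} (hJ : J.IsLocallyPrincipal)
    (U : X.affineOpens) (x : X) (hx : x ∈ U.1) : ∃ f : Γ(X, U), x ∈ X.basicOpen f ∧
      ∃ b, J.ideal (X.affineBasicOpen f) = Ideal.span {b} := by
  obtain ⟨V, hV, b, hb⟩ := hJ x
  obtain ⟨f, g, hfg, hxf⟩ := exists_basicOpen_le_affine_inter U.2 V.2 x ⟨hx, hV⟩
  have e : X.affineBasicOpen f = X.affineBasicOpen g := Subtype.ext hfg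
  refine ⟨f, hxf, ?_⟩
  rw [e]
  refine ⟨resHom (X.affineBasicOpen_le g) b, ?_⟩
  rw [← J.map_resHom (X.affineBasicOpen_le g), hb, Ideal.map_span, Set.image_singleton]

theorem IsEffectiveCartier.exists_basicOpen {J : X.IdealSheafData} (hJ : J.IsEffectiveCartier)
    (U : X.affineOpens) (x : X) (hx : x ∈ U.1) : ∃ f : Γ(X, U), x ∈ X.basicOpen f ∧
      ∃ b ∈ nonZeroDivisors Γ(X, X.affineBasicOpen f),
        J.ideal (X.affineBasicOpen f) = Ideal.span {b} := by
  obtain ⟨V, hV, b, hb0, hb⟩ := hJ x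
  obtain ⟨f, g, hfg, hxf⟩ := exists_basicOpen_le_affine_inter U.2 V.2 x ⟨hx, hV⟩
  have e : X.affineBasicOpen f = X.affineBasicOpen g := Subtype.ext hfg
  refine ⟨f, hxf, ?_⟩
  rw [e]
  refine ⟨resHom (X.affineBasicOpen_le g) b,
    (isAway_affineBasicOpen V g).map_nonZeroDivisors hb0, ?_⟩
  rw [← J.map_resHom (X.affineBasicOpen_le g), hb, Ideal.map_span, Set.image_singleton]

theorem IsLocallyPrincipal.fg {J : X.IdealSheafData} (hJ : J.IsLocallyPrincipal)
    (U : X.affineOpens) : (J.ideal U).FG := by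
  let s : Set Γ(X, U) := {f | ∃ b, J.ideal (X.affineBasicOpen f) = Ideal.span {b}}
  have hs : Ideal.span s = ⊤ := by
    rw [← U.2.self_le_iSup_basicOpen_iff]
    intro x hx
    obtain ⟨f, hxf, hf⟩ := hJ.exists_basicOpen U x hx
    exact Opens.mem_iSup.mpr ⟨⟨f, hf⟩, hxf⟩
  refine Ideal.fg_of_localizationSpan s hs ?_
  rintro ⟨f, b, hb⟩
  refine (isAway_affineBasicOpen U f).fg_map ?_
  rw [J.map_resHom, hb]
  exact ⟨{b}, by rw [Finset.coe_singleton]⟩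

/-- The part of the open set `U` outside the closed subscheme `V(J)`. -/
def outside (J : X.IdealSheafData) (U : X.Opens) : X.Opens := U ⊓ J.support.compl

theorem outside_le (J : X.IdealSheafData) (U : X.Opens) : J.outside U ≤ U := inf_le_left

theorem outside_mono (J : X.IdealSheafData) {U V : X.Opens} (h : U ≤ V) :
    J.outside U ≤ J.outside V := inf_le_inf_right _ h

theorem outside_inf_basicOpen (J : X.IdealSheafData) (U : X.Opens) (f : Γ(X, U)) :
    J.outside U ⊓ X.basicOpen f = J.outside (X.basicOpen f) := by
  change (U ⊓ J.support.compl) ⊓ X.basicOpen f = X.basicOpen f ⊓ J.support.compl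
  rw [inf_right_comm, inf_eq_right.mpr (X.basicOpen_le f)]

/-- The affine blowup algebra over the affine open `U`: the sections `s` of `𝒪_X` over `U ∖ D` with
`J ^ n * s ⊆ I ^ n` for some `n`. If `J = (b)` over `U`, then `Γ(X, U ∖ D) = Γ(X, U)[1/b]` and this is
the ring `Γ(X, U)[I/b]` of fractions `x / b ^ n` with `x ∈ I ^ n`. -/
def affineBlowupSubring {I J : X.IdealSheafData} (h : J ≤ I) (U : X.AffineZariskiSite) :
    Subring Γ(X, J.outside U.aff) :=
  blowupSubring (resHom (J.outside_le U.aff)) (I.ideal U.aff) (J.ideal U.aff) (h U.aff)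

theorem resHom_comm (J : X.IdealSheafData) {U V : X.Opens} (h : U ≤ V) (x : Γ(X, V)) :
    resHom (J.outside_mono h) (resHom (J.outside_le V) x) =
      resHom (J.outside_le U) (resHom h x) := by
  rw [resHom_resHom, resHom_resHom]

/-- The restriction homomorphisms of the affine blowup algebra. -/
def affineBlowupRes {I J : X.IdealSheafData} (h : J ≤ I) {U V : X.AffineZariskiSite}
    (hUV : U ≤ V) : affineBlowupSubring h V →+* affineBlowupSubring h U :=
  (resHom (J.outside_mono (AffineZariskiSite.le hUV))).restrict _ _ fun _ hs =>
    map_mem_blowupSubring (resHom_comm J (AffineZariskiSite.le hUV))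
      (I.map_resHom (AffineZariskiSite.aff_mono hUV))
      (J.map_resHom (AffineZariskiSite.aff_mono hUV)) hs

/-- The affine blowup algebra, as a presheaf of rings on affine opens. -/
def affineBlowupAlgebra {I J : X.IdealSheafData} (h : J ≤ I) :
    X.AffineZariskiSiteᵒᵖ ⥤ CommRingCat.{u} where
  obj U := .of (affineBlowupSubring h U.unop)
  map i := CommRingCat.ofHom (affineBlowupRes h i.unop.le)
  map_id _ := CommRingCat.hom_ext <| RingHom.ext fun _ => Subtype.ext (resHom_self _ _)
  map_comp i j := CommRingCat.hom_ext <| RingHom.ext fun x =>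
    Subtype.ext (resHom_resHom (J.outside_mono (AffineZariskiSite.le j.unop.le))
      (J.outside_mono (AffineZariskiSite.le i.unop.le)) x.1).symm

/-- The structure map `𝒪_X → 𝒪_X[ℐ/𝒥]`. -/
def toAffineBlowupAlgebra {I J : X.IdealSheafData} (h : J ≤ I) :
    (AffineZariskiSite.toOpensFunctor X).op ⋙ X.presheaf ⟶ affineBlowupAlgebra h where
  app U := CommRingCat.ofHom ((resHom (J.outside_le U.unop.aff.1)).codRestrict
    (affineBlowupSubring h U.unop) (algebraMap_mem_blowupSubring _ _ _ _))
  naturality _ _ i := CommRingCat.hom_ext <| RingHom.ext fun x =>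
    Subtype.ext (resHom_comm J (AffineZariskiSite.le i.unop.le) x).symm

theorem isCompact_outside {J : X.IdealSheafData} {U : X.affineOpens} (hJ : (J.ideal U).FG) :
    IsCompact (J.outside U.1).1 := by
  obtain ⟨G, hG⟩ := hJ
  have : (J.outside U.1).1 = ⋃ g ∈ G, (X.basicOpen g).1 := by
    ext x
    simp only [Set.mem_iUnion]
    constructor
    · rintro ⟨hxU, hx⟩
      have hx' : x ∉ J.support := hx
      rw [mem_support_iff_of_mem (show x ∈ U.1 from hxU), ← hG, zeroLocus_span,
        mem_zeroLocus_iff] at hx'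
      push Not at hx'
      obtain ⟨g, hg, hxg⟩ := hx'
      exact ⟨g, hg, hxg⟩
    · rintro ⟨g, hg, hxg⟩
      have hxU : x ∈ U.1 := X.basicOpen_le g hxg
      refine ⟨hxU, fun hx => ?_⟩
      have hx' : x ∈ J.support := hx
      rw [mem_support_iff_of_mem hxU, ← hG, zeroLocus_span, mem_zeroLocus_iff] at hx'
      exact hx' g hg hxg
  rw [this]
  exact G.isCompact_biUnion fun g _ => (U.2.basicOpen g).isCompact

theorem coequifibered_toAffineBlowupAlgebra {I J : X.IdealSheafData} (h : J ≤ I)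
    (hJ : J.IsLocallyPrincipal) : (toAffineBlowupAlgebra h).Coequifibered := by
  refine AffineZariskiSite.coequifibered_iff_forall_isLocalizationAway.mpr fun U f => ?_
  have hle := X.affineBasicOpen_le (V := U.aff) f
  exact IsAwayRingHom.blowupSubring (ρ := resHom (J.outside_le U.aff))
    (ρ' := resHom (J.outside_le (X.affineBasicOpen (U := U.aff) f).1))
    (β := resHom hle)
    (γ := resHom (J.outside_mono hle))
    (resHom_comm J hle)
    (I.map_resHom hle)
    (J.map_resHom hle)
    (isAway_affineBasicOpen U.aff f)
    (isAwayRingHom_resHom (isCompact_outside (hJ.fg U.aff))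
      (U.aff.2.isQuasiSeparated.of_subset (J.outside_le U.aff)) _
      ((X.basicOpen_res f (homOfLE (J.outside_le U.aff)).op).trans
        (J.outside_inf_basicOpen U.aff.1 f)))
    (hJ.fg U.aff)

/-- The affine blowup (dilatation) `Bl_Z^D X` of `X` in the center `Z = V(I)` along `D = V(J)`: the
relative spectrum over `X` of the quasi-coherent affine blowup algebra. -/
noncomputable def dilatation {I J : X.IdealSheafData} (h : J ≤ I) (hJ : J.IsLocallyPrincipal) :
    Scheme.{u} :=
  (AffineZariskiSite.relativeGluingData (coequifibered_toAffineBlowupAlgebra h hJ)).glued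

/-- The structure morphism `Bl_Z^D X ⟶ X`. -/
noncomputable def dilatationι {I J : X.IdealSheafData} (h : J ≤ I) (hJ : J.IsLocallyPrincipal) :
    dilatation h hJ ⟶ X :=
  (AffineZariskiSite.relativeGluingData (coequifibered_toAffineBlowupAlgebra h hJ)).toBase

/-- The open immersion of the part of `Bl_Z^D X` over the affine open `U`. -/
noncomputable def dilatationChart {I J : X.IdealSheafData} (h : J ≤ I) (hJ : J.IsLocallyPrincipal)
    (U : X.AffineZariskiSite) :
    Spec (.of (affineBlowupSubring h U)) ⟶ dilatation h hJ :=
  (AffineZariskiSite.relativeGluingData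
    (coequifibered_toAffineBlowupAlgebra h hJ)).cover.f U

/-! ### Quasi-coherent modules on a closed subscheme -/

/-- `Γ(Z ∩ U, 𝒪_Z) = Γ(X, U) / I(U)` for the closed subscheme `Z = V(I)` -/
abbrev quot (I : X.IdealSheafData) (U : X.AffineZariskiSite) : Type u :=
  Γ(X, U.aff) ⧸ I.ideal U.aff

/-- The restriction homomorphism of `𝒪_Z` from `Z ∩ V` to `Z ∩ U`. -/
def quotRes (I : X.IdealSheafData) {U V : X.AffineZariskiSite} (h : U ≤ V) :
    I.quot V →+* I.quot U :=
  Ideal.quotientMap (I.ideal U.aff) (resHom (AffineZariskiSite.le h))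
    (I.ideal_le_comap_ideal (AffineZariskiSite.aff_mono h))

@[simp] theorem quotRes_mk (I : X.IdealSheafData) {U V : X.AffineZariskiSite} (h : U ≤ V)
    (x : Γ(X, V.aff)) : I.quotRes h (Ideal.Quotient.mk (I.ideal V.aff) x) =
      Ideal.Quotient.mk (I.ideal U.aff) (resHom (AffineZariskiSite.le h) x) :=
  Ideal.quotientMap_mk

theorem quotRes_self (I : X.IdealSheafData) {U : X.AffineZariskiSite} (h : U ≤ U) (x : I.quot U) :
    I.quotRes h x = x := by
  obtain ⟨x, rfl⟩ := Ideal.Quotient.mk_surjective x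
  rw [quotRes_mk, resHom_self]

theorem quotRes_quotRes (I : X.IdealSheafData) {U V W : X.AffineZariskiSite} (h : U ≤ V)
    (h' : V ≤ W) (x : I.quot W) : I.quotRes h (I.quotRes h' x) = I.quotRes (h.trans h') x := by
  obtain ⟨x, rfl⟩ := Ideal.Quotient.mk_surjective x
  rw [quotRes_mk, quotRes_mk, quotRes_mk, resHom_resHom]

theorem isAwayRingHom_quotRes (I : X.IdealSheafData) (U : X.AffineZariskiSite) (f : Γ(X, U.aff)) :
    IsAwayRingHom (I.quotRes (U.basicOpen_le f)) (Ideal.Quotient.mk (I.ideal U.aff) f) :=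
  I.isLocalization_away (X.affineBasicOpen_le (V := U.aff) f) f rfl

/-- A presheaf of `𝒪_Z`-modules, for `Z = V(I)`, on the basis of open subsets `Z ∩ U` of `Z` with `U`
an affine open of `X`; restriction maps are given along the inclusions of basic open subsets. -/
structure ModulePresheaf (I : X.IdealSheafData) where
  /-- the sections over `Z ∩ U` -/
  obj : X.AffineZariskiSite → Type u
  [addCommGroup : ∀ U, AddCommGroup (obj U)]
  [module : ∀ U, Module (I.quot U) (obj U)]
  /-- the restriction maps -/
  res : ∀ {U V : X.AffineZariskiSite} (h : U ≤ V), obj V →ₛₗ[I.quotRes h] obj U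
  res_self : ∀ {U : X.AffineZariskiSite} (h : U ≤ U) (x : obj U), res h x = x
  res_res : ∀ {U V W : X.AffineZariskiSite} (h : U ≤ V) (h' : V ≤ W) (x : obj W),
    res h (res h' x) = res (h.trans h') x

namespace ModulePresheaf

variable {I : X.IdealSheafData}

attribute [instance] addCommGroup module

/-- The module is quasi-coherent: `M(D(f)) = M(U)[1/f]` for every affine open `U` and `f` on `U`. -/
def IsQuasicoherent (M : I.ModulePresheaf) : Prop :=
  ∀ (U : X.AffineZariskiSite) (f : Γ(X, U.aff)),
    IsAwayMap (Ideal.Quotient.mk (I.ideal U.aff) f) (M.res (U.basicOpen_le f))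

/-- The structure sheaf `𝒪_Z`. -/
def structureSheaf (I : X.IdealSheafData) : I.ModulePresheaf where
  obj U := I.quot U
  res h := { toFun := I.quotRes h, map_add' := map_add _, map_smul' := fun a x => map_mul _ a x }
  res_self := I.quotRes_self
  res_res := I.quotRes_quotRes

/-- The tensor product `M ⊗ N` over `𝒪_Z`, computed on affine opens. -/
def tensor (M N : I.ModulePresheaf) : I.ModulePresheaf where
  obj U := M.obj U ⊗[I.quot U] N.obj U
  res h := TensorProduct.map (M.res h) (N.res h)
  res_self h x := by
    induction x with
    | zero => rw [map_zero]
    | add x y hx hy => rw [map_add, hx, hy]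
    | tmul x y => rw [TensorProduct.map_tmul, M.res_self, N.res_self]
  res_res h h' x := by
    induction x with
    | zero => rw [map_zero, map_zero, map_zero]
    | add x y hx hy => rw [map_add, map_add, map_add, hx, hy]
    | tmul x y => rw [TensorProduct.map_tmul, TensorProduct.map_tmul, TensorProduct.map_tmul,
        M.res_res, N.res_res]

theorem IsQuasicoherent.tensor {M N : I.ModulePresheaf} (hM : M.IsQuasicoherent)
    (hN : N.IsQuasicoherent) : (M.tensor N).IsQuasicoherent := fun U f =>
  (hM U f).tensor (I.isAwayRingHom_quotRes U f) (hN U f)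

theorem IsQuasicoherent.existsUnique_dual {M : I.ModulePresheaf} (hM : M.IsQuasicoherent)
    {U V : X.AffineZariskiSite} (h : U ≤ V) (l : Module.Dual (I.quot V) (M.obj V)) :
    ∃! l' : Module.Dual (I.quot U) (M.obj U), ∀ x, l' (M.res h x) = I.quotRes h (l x) := by
  obtain ⟨f, hf⟩ := h
  obtain rfl : V.basicOpen f = U := Subtype.ext hf
  exact (hM V f).existsUnique_extend (I.isAwayRingHom_quotRes V f)
    (((structureSheaf I).res (V.basicOpen_le f)).comp l)

/-- The restriction of a linear form: the unique linear form compatible with it. -/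
noncomputable def dualRes {M : I.ModulePresheaf} (hM : M.IsQuasicoherent)
    {U V : X.AffineZariskiSite} (h : U ≤ V) (l : Module.Dual (I.quot V) (M.obj V)) :
    Module.Dual (I.quot U) (M.obj U) := (hM.existsUnique_dual h l).choose

theorem dualRes_apply {M : I.ModulePresheaf} (hM : M.IsQuasicoherent)
    {U V : X.AffineZariskiSite} (h : U ≤ V) (l : Module.Dual (I.quot V) (M.obj V)) (x : M.obj V) :
    dualRes hM h l (M.res h x) = I.quotRes h (l x) :=
  (hM.existsUnique_dual h l).choose_spec.1 x

theorem dualRes_unique {M : I.ModulePresheaf} (hM : M.IsQuasicoherent)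
    {U V : X.AffineZariskiSite} (h : U ≤ V) (l : Module.Dual (I.quot V) (M.obj V))
    (l' : Module.Dual (I.quot U) (M.obj U)) (hl : ∀ x, l' (M.res h x) = I.quotRes h (l x)) :
    dualRes hM h l = l' :=
  (hM.existsUnique_dual h l).unique (dualRes_apply hM h l) hl

/-- The dual `ℋom(M, 𝒪_Z)`. -/
noncomputable def dual (M : I.ModulePresheaf) (hM : M.IsQuasicoherent) : I.ModulePresheaf where
  obj U := Module.Dual (I.quot U) (M.obj U)
  res h :=
    { toFun := dualRes hM h
      map_add' := fun l l' => dualRes_unique hM h _ _ fun x => by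
        rw [LinearMap.add_apply, LinearMap.add_apply, dualRes_apply, dualRes_apply, map_add]
      map_smul' := fun a l => dualRes_unique hM h _ _ fun x => by
        rw [LinearMap.smul_apply, LinearMap.smul_apply, dualRes_apply, smul_eq_mul, smul_eq_mul,
          map_mul] }
  res_self h l := dualRes_unique hM h _ _ fun x => by rw [M.res_self, quotRes_self]
  res_res h h' l := (dualRes_unique hM _ _ _ fun x => by
    change dualRes hM h (dualRes hM h' l) _ = _
    rw [← M.res_res h h', dualRes_apply, dualRes_apply, quotRes_quotRes]).symm

theorem IsQuasicoherent.dual {M : I.ModulePresheaf} (hM : M.IsQuasicoherent)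
    (hfp : ∀ U, Module.FinitePresentation (I.quot U) (M.obj U)) :
    (M.dual hM).IsQuasicoherent := fun U f => by
  have := hfp U
  exact (hM U f).dual (I.isAwayRingHom_quotRes U f) ((M.dual hM).res (U.basicOpen_le f))
    fun l x => dualRes_apply hM (U.basicOpen_le f) l x

/-! ### Subquotients of the structure sheaf of `X` -/

/-- The quotient `Q(U) / (P(U) ∩ Q(U))`. -/
abbrev subquotientObj (P Q : X.IdealSheafData) (U : X.AffineZariskiSite) : Type u :=
  Q.ideal U.aff ⧸ (P.ideal U.aff).submoduleOf (Q.ideal U.aff)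


theorem isTorsionBySet_subquotientObj {P Q : X.IdealSheafData} (hPQ : I * Q ≤ P)
    (U : X.AffineZariskiSite) :
    Module.IsTorsionBySet Γ(X, U.aff) (subquotientObj P Q U) (I.ideal U.aff : Set _) := by
  rintro x ⟨a, ha⟩
  obtain ⟨x, rfl⟩ := Submodule.Quotient.mk_surjective _ x
  rw [← Submodule.Quotient.mk_smul, Submodule.Quotient.mk_eq_zero]
  exact hPQ U.aff (Ideal.mul_mem_mul ha x.2)

/-- The restriction map `Q(V) / P(V) → Q(U) / P(U)`, linear over `Γ(X, V) → Γ(X, U)`. -/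
def subquotientRes (P Q : X.IdealSheafData) {U V : X.AffineZariskiSite} (h : U ≤ V) :
    subquotientObj P Q V →ₛₗ[resHom (AffineZariskiSite.le h)] subquotientObj P Q U :=
  Submodule.mapQ _ _
    { toFun := fun x => ⟨resHom (AffineZariskiSite.le h) x.1,
        Q.ideal_le_comap_ideal (AffineZariskiSite.aff_mono h) x.2⟩
      map_add' := fun x y => Subtype.ext (map_add _ x.1 y.1)
      map_smul' := fun a x => Subtype.ext (map_mul _ a x.1) }
    fun x hx => P.ideal_le_comap_ideal (AffineZariskiSite.aff_mono h)
      (show x.1 ∈ P.ideal V.aff from hx)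

theorem subquotientRes_mk (P Q : X.IdealSheafData) {U V : X.AffineZariskiSite} (h : U ≤ V)
    (x : Q.ideal V.aff) : subquotientRes P Q h (Submodule.Quotient.mk x) =
      Submodule.Quotient.mk ⟨resHom (AffineZariskiSite.le h) x.1,
        Q.ideal_le_comap_ideal (AffineZariskiSite.aff_mono h) x.2⟩ := rfl

/-- The module `Q / P` on the closed subscheme `Z = V(I)`, for ideal sheaves with `I Q ⊆ P ⊆ Q`. -/
def subquotient {P Q : X.IdealSheafData} (hPQ : I * Q ≤ P) : I.ModulePresheaf where
  obj U := subquotientObj P Q U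
  module U := (isTorsionBySet_subquotientObj hPQ U).module
  res {U V} h :=
    letI := (isTorsionBySet_subquotientObj hPQ U).module
    letI := (isTorsionBySet_subquotientObj hPQ V).module
    { toFun := subquotientRes P Q h
      map_add' := map_add _
      map_smul' := fun a x => by
        obtain ⟨a, rfl⟩ := Ideal.Quotient.mk_surjective a
        exact (subquotientRes P Q h).map_smulₛₗ a x }
  res_self h x := by
    obtain ⟨x, rfl⟩ := Submodule.Quotient.mk_surjective _ x
    exact congrArg _ (Subtype.ext (resHom_self _ _))
  res_res h h' x := by
    obtain ⟨x, rfl⟩ := Submodule.Quotient.mk_surjective _ x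
    exact congrArg _ (Subtype.ext (resHom_resHom _ _ _))

theorem isQuasicoherent_subquotient {P Q : X.IdealSheafData} (hPQ : I * Q ≤ P) :
    (subquotient hPQ).IsQuasicoherent := by
  refine fun U f => ⟨fun y => ?_, fun x hx => ?_⟩
  · obtain ⟨⟨y, hy⟩, rfl⟩ := Submodule.Quotient.mk_surjective _ y
    have hle := X.affineBasicOpen_le (V := U.aff) f
    have hy' : y ∈ (Q.ideal U.aff).map (resHom hle) := by rw [Q.map_resHom hle]; exact hy
    obtain ⟨n, x, hx, e⟩ := (isAway_affineBasicOpen U.aff f).mem_map hy'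
    refine ⟨n, Submodule.Quotient.mk ⟨x, hx⟩, ?_⟩
    rw [quotRes_mk, ← map_pow]
    exact congrArg _ (Subtype.ext e)
  · obtain ⟨⟨x, hxQ⟩, rfl⟩ := Submodule.Quotient.mk_surjective _ x
    have hle := X.affineBasicOpen_le (V := U.aff) f
    have hx' : resHom hle x ∈ (P.ideal U.aff).map (resHom hle) := by
      rw [P.map_resHom hle]
      exact (Submodule.Quotient.mk_eq_zero ((P.ideal (U.basicOpen f).aff).submoduleOf
        (Q.ideal (U.basicOpen f).aff))).mp hx
    obtain ⟨n, p, hp, e⟩ := (isAway_affineBasicOpen U.aff f).mem_map hx'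
    obtain ⟨m, hm⟩ := (isAway_affineBasicOpen U.aff f).inj (x := p - f ^ n * x) (by
      rw [map_sub, e, map_mul, map_pow, sub_self])
    refine ⟨m + n, ?_⟩
    rw [← map_pow]
    refine (Submodule.Quotient.mk_eq_zero ((P.ideal U.aff).submoduleOf (Q.ideal U.aff))).mpr
      (show f ^ (m + n) * x ∈ P.ideal U.aff from ?_)
    rw [mul_sub, sub_eq_zero] at hm
    rw [pow_add, mul_assoc, ← hm]
    exact Ideal.mul_mem_left _ _ hp

/-! ### Conormal and normal sheaves -/

/-- The conormal sheaf `C_{Z/D} = I/(I²+J)` of `Z = V(I)` in `D = V(J)` -/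
def conormal (I J : X.IdealSheafData) : I.ModulePresheaf :=
  subquotient (P := I * I ⊔ J) (Q := I) le_sup_left

/-- The restriction `J_Z = J|_Z = J/IJ` to `Z = V(I)`. -/
def idealRestrict (I J : X.IdealSheafData) : I.ModulePresheaf :=
  subquotient (P := I * J) (Q := J) le_rfl

theorem isQuasicoherent_conormal (I J : X.IdealSheafData) : (conormal I J).IsQuasicoherent :=
  isQuasicoherent_subquotient _

theorem isQuasicoherent_idealRestrict (I J : X.IdealSheafData) :
    (idealRestrict I J).IsQuasicoherent :=
  isQuasicoherent_subquotient _

/-- The class of a section of `J` in `J|_Z`. -/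
def idealRestrictMk (I J : X.IdealSheafData) (U : X.AffineZariskiSite) (x : J.ideal U.aff) :
    (idealRestrict I J).obj U :=
  Submodule.Quotient.mk (p := ((I * J).ideal U.aff).submoduleOf (J.ideal U.aff)) x

/-- The class of a section of `I` in `I/(I²+J)`. -/
def conormalMk (I J : X.IdealSheafData) (U : X.AffineZariskiSite) (x : I.ideal U.aff) :
    (conormal I J).obj U :=
  Submodule.Quotient.mk (p := ((I * I ⊔ J).ideal U.aff).submoduleOf (I.ideal U.aff)) x

/-- If `J = (b)` with `b` a nonzerodivisor then `J|_Z` is free of rank one. -/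
theorem finitePresentation_idealRestrict_aux (I J : X.IdealSheafData) (U : X.AffineZariskiSite)
    (b : Γ(X, U.aff)) (hb0 : b ∈ nonZeroDivisors Γ(X, U.aff))
    (hb : J.ideal U.aff = Ideal.span {b}) :
    Module.FinitePresentation (I.quot U) ((idealRestrict I J).obj U) := by
  have hbJ : b ∈ J.ideal U.aff := hb ▸ Ideal.mem_span_singleton_self b
  let l : I.quot U →ₗ[I.quot U] (idealRestrict I J).obj U :=
    LinearMap.toSpanSingleton (I.quot U) _ (idealRestrictMk I J U ⟨b, hbJ⟩)
  have hl (a : Γ(X, U.aff)) : l (Ideal.Quotient.mk (I.ideal U.aff) a) =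
      idealRestrictMk I J U ⟨a * b, Ideal.mul_mem_left _ _ hbJ⟩ := rfl
  refine Module.FinitePresentation.of_equiv (LinearEquiv.ofBijective l ⟨?_, fun y => ?_⟩)
  · rw [injective_iff_map_eq_zero]
    intro a ha
    obtain ⟨a, rfl⟩ := Ideal.Quotient.mk_surjective a
    rw [hl] at ha
    replace ha : a * b ∈ I.ideal U.aff * J.ideal U.aff := (Submodule.Quotient.mk_eq_zero
      (((I * J).ideal U.aff).submoduleOf (J.ideal U.aff))).mp ha
    rw [hb, Ideal.mem_mul_span_singleton] at ha
    obtain ⟨z, hz, e⟩ := ha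
    rw [Ideal.Quotient.eq_zero_iff_mem, ← mul_cancel_right_mem_nonZeroDivisors hb0 |>.mp e]
    exact hz
  · obtain ⟨⟨y, hy⟩, rfl⟩ := Submodule.Quotient.mk_surjective _ y
    have hy' := hy
    rw [hb, Ideal.mem_span_singleton'] at hy'
    obtain ⟨a, rfl⟩ := hy'
    exact ⟨Ideal.Quotient.mk _ a, hl a⟩

theorem finitePresentation_idealRestrict (I : X.IdealSheafData) {J : X.IdealSheafData}
    (hJ : J.IsEffectiveCartier) (U : X.AffineZariskiSite) :
    Module.FinitePresentation (I.quot U) ((idealRestrict I J).obj U) := by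
  let s : Set Γ(X, U.aff) := {f | ∃ b ∈ nonZeroDivisors Γ(X, X.affineBasicOpen f),
    J.ideal (X.affineBasicOpen f) = Ideal.span {b}}
  have hs : Ideal.span s = ⊤ := by
    rw [← U.aff.2.self_le_iSup_basicOpen_iff]
    intro x hx
    obtain ⟨f, hxf, hf⟩ := hJ.exists_basicOpen U.aff x hx
    exact Opens.mem_iSup.mpr ⟨⟨f, hf⟩, hxf⟩
  let s' : Set (I.quot U) := Ideal.Quotient.mk (I.ideal U.aff) '' s
  have hs' : Ideal.span s' = ⊤ := by rw [← Ideal.map_span, hs, Ideal.map_top]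
  have hr (r : s') : ∃ f ∈ s, Ideal.Quotient.mk (I.ideal U.aff) f = r.1 := r.2
  choose f hf hfr using hr
  let R' (r : s') : Type u := I.quot (U.basicOpen (f r))
  let M' (r : s') : Type u := (idealRestrict I J).obj (U.basicOpen (f r))
  letI (r : s') : Algebra (I.quot U) (R' r) := (I.quotRes (U.basicOpen_le (f r))).toAlgebra
  letI (r : s') : Module (I.quot U) (M' r) :=
    Module.compHom (M' r) (I.quotRes (U.basicOpen_le (f r)))
  haveI (r : s') : IsScalarTower (I.quot U) (R' r) (M' r) := ⟨fun a b c => by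
    change (I.quotRes (U.basicOpen_le (f r)) a * b) • c =
      I.quotRes (U.basicOpen_le (f r)) a • b • c
    rw [mul_smul]⟩
  haveI (r : s') : IsLocalization.Away r.1 (R' r) := by
    rw [← hfr r]
    exact I.isAwayRingHom_quotRes U (f r)
  let ϕ (r : s') : (idealRestrict I J).obj U →ₗ[I.quot U] M' r :=
    { toFun := (idealRestrict I J).res (U.basicOpen_le (f r))
      map_add' := map_add _
      map_smul' := ((idealRestrict I J).res (U.basicOpen_le (f r))).map_smulₛₗ }
  haveI (r : s') : IsLocalizedModule (Submonoid.powers r.1) (ϕ r) := by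
    rw [← hfr r]
    exact (isQuasicoherent_idealRestrict I J U (f r)).isLocalizedModule
      (I.isAwayRingHom_quotRes U (f r))
  refine Module.FinitePresentation.of_localizationSpan' s' hs' (Rₚ := R') ϕ fun r => ?_
  obtain ⟨b, hb0, hb⟩ := hf r
  exact finitePresentation_idealRestrict_aux I J (U.basicOpen (f r)) b hb0 hb

/-- The inverse `J_Z⁻¹`, the dual of the invertible module `J|_Z`. -/
noncomputable def idealRestrictInv (I J : X.IdealSheafData) : I.ModulePresheaf :=
  (idealRestrict I J).dual (isQuasicoherent_idealRestrict I J)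

/-- The normal sheaf `N_{Z/D}`, the dual of the conormal sheaf. -/
noncomputable def normal (I J : X.IdealSheafData) : I.ModulePresheaf :=
  (conormal I J).dual (isQuasicoherent_conormal I J)

/-- The module `C_{Z/D} ⊗ J_Z⁻¹`. -/
noncomputable def twistedConormal (I J : X.IdealSheafData) : I.ModulePresheaf :=
  (conormal I J).tensor (idealRestrictInv I J)

/-- The module `N_{Z/D} ⊗ J_Z`. -/
noncomputable def twistedNormal (I J : X.IdealSheafData) : I.ModulePresheaf :=
  (normal I J).tensor (idealRestrict I J)

theorem isQuasicoherent_twistedConormal (I : X.IdealSheafData) {J : X.IdealSheafData}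
    (hJ : J.IsEffectiveCartier) : (twistedConormal I J).IsQuasicoherent :=
  (isQuasicoherent_conormal I J).tensor
    ((isQuasicoherent_idealRestrict I J).dual (finitePresentation_idealRestrict I hJ))

/-! ### The vector bundle `𝕍(M)` -/

/-- The symmetric algebra `Sym M`, as a presheaf of rings on affine opens. -/
noncomputable def symAlgebra (M : I.ModulePresheaf) : X.AffineZariskiSiteᵒᵖ ⥤ CommRingCat.{u} where
  obj U := .of (SymmetricAlgebra (I.quot U.unop) (M.obj U.unop))
  map i := CommRingCat.ofHom (symMap (I.quotRes i.unop.le) (M.res i.unop.le))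
  map_id U := CommRingCat.hom_ext <| sym_ringHom_ext
    (fun a => by
      change symMap _ _ (algebraMap _ _ a) = algebraMap _ _ a
      rw [symMap_algebraMap, quotRes_self])
    fun x => by
      change symMap _ _ (SymmetricAlgebra.ι _ _ x) = SymmetricAlgebra.ι _ _ x
      rw [symMap_ι, M.res_self]
  map_comp i j := CommRingCat.hom_ext <| sym_ringHom_ext
    (fun a => by
      change symMap _ _ (algebraMap _ _ a) = symMap _ _ (symMap _ _ (algebraMap _ _ a))
      rw [symMap_algebraMap, symMap_algebraMap, symMap_algebraMap, quotRes_quotRes])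
    fun x => by
      change symMap _ _ (SymmetricAlgebra.ι _ _ x) = symMap _ _ (symMap _ _ (SymmetricAlgebra.ι _ _ x))
      rw [symMap_ι, symMap_ι, symMap_ι, M.res_res]

/-- The structure map `𝒪_X → 𝒪_Z → Sym M`. -/
noncomputable def toSymAlgebra (M : I.ModulePresheaf) :
    (AffineZariskiSite.toOpensFunctor X).op ⋙ X.presheaf ⟶ symAlgebra M where
  app U := CommRingCat.ofHom ((algebraMap (I.quot U.unop)
    (SymmetricAlgebra (I.quot U.unop) (M.obj U.unop))).comp
      (Ideal.Quotient.mk (I.ideal U.unop.aff)))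
  naturality U V i := CommRingCat.hom_ext <| RingHom.ext fun a => by
    exact ((symMap_algebraMap (M.res i.unop.le) (Ideal.Quotient.mk (I.ideal U.unop.aff) a)).trans
      (congrArg _ (I.quotRes_mk i.unop.le a))).symm

theorem IsQuasicoherent.coequifibered_toSymAlgebra {M : I.ModulePresheaf}
    (hM : M.IsQuasicoherent) : (toSymAlgebra M).Coequifibered :=
  AffineZariskiSite.coequifibered_iff_forall_isLocalizationAway.mpr fun U f =>
    (hM U f).symMap (I.isAwayRingHom_quotRes U f)

/-- The vector bundle `𝕍(M)`, the relative spectrum of `Sym M`. -/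
noncomputable def vectorBundle (M : I.ModulePresheaf) (hM : M.IsQuasicoherent) : Scheme.{u} :=
  (AffineZariskiSite.relativeGluingData hM.coequifibered_toSymAlgebra).glued

/-- The open immersion of the part `Spec Sym M(U)` of `𝕍(M)` over the affine open `U`. -/
noncomputable def vectorBundleChart (M : I.ModulePresheaf) (hM : M.IsQuasicoherent)
    (U : X.AffineZariskiSite) :
    Spec ((symAlgebra M).obj (op U)) ⟶ vectorBundle M hM :=
  (AffineZariskiSite.relativeGluingData hM.coequifibered_toSymAlgebra).cover.f U

/-- The open immersion `Spec Γ(Z ∩ U, 𝒪_Z) ⟶ Z`. -/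
noncomputable def quotToSubscheme (I : X.IdealSheafData) (U : X.AffineZariskiSite) :
    Spec (.of (I.quot U)) ⟶ I.subscheme :=
  I.subschemeCover.f U.aff

theorem quotToSubscheme_subschemeι (I : X.IdealSheafData) (U : X.AffineZariskiSite) :
    quotToSubscheme I U ≫ I.subschemeι =
      Spec.map (CommRingCat.ofHom (Ideal.Quotient.mk (I.ideal U.aff))) ≫ U.isAffineOpen.fromSpec := by
  refine (I.subschemeCover_map_subschemeι U.aff).trans ?_
  exact (Category.assoc _ _ _).trans
    (congrArg (Spec.map (CommRingCat.ofHom (Ideal.Quotient.mk (I.ideal U.aff))) ≫ ·)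
      U.isAffineOpen.isoSpec_inv_ι)

/-- The morphism `Spec Sym M(U) ⟶ Spec Γ(Z ∩ U) ⊆ Z`. -/
noncomputable def symAlgebraToSubscheme (M : I.ModulePresheaf) (U : X.AffineZariskiSite) :
    Spec ((symAlgebra M).obj (op U)) ⟶ I.subscheme :=
  Spec.map (R := .of (I.quot U)) (S := (symAlgebra M).obj (op U))
    (CommRingCat.ofHom (algebraMap (I.quot U) (SymmetricAlgebra (I.quot U) (M.obj U)))) ≫
    quotToSubscheme I U

theorem symAlgebraToSubscheme_comp (M : I.ModulePresheaf) (U : X.AffineZariskiSite) :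
    symAlgebraToSubscheme M U ≫ I.subschemeι =
      Spec.map ((toSymAlgebra M).app (op U)) ≫ U.isAffineOpen.fromSpec := by
  rw [symAlgebraToSubscheme, Category.assoc, quotToSubscheme_subschemeι]
  exact (Spec.map_comp_assoc _ _ _).symm

theorem symAlgebraToSubscheme_naturality (M : I.ModulePresheaf) {U V : X.AffineZariskiSite}
    (i : U ⟶ V) : Spec.map ((symAlgebra M).map i.op) ≫ symAlgebraToSubscheme M V =
      symAlgebraToSubscheme M U := by
  rw [← cancel_mono I.subschemeι, Category.assoc, symAlgebraToSubscheme_comp,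
    symAlgebraToSubscheme_comp, ← V.isAffineOpen.map_fromSpec U.isAffineOpen
      (homOfLE (AffineZariskiSite.le i.le)).op]
  refine (Spec.map_comp_assoc _ _ _).symm.trans (Eq.trans ?_ (Spec.map_comp_assoc _ _ _))
  exact congrArg (Spec.map · ≫ V.isAffineOpen.fromSpec) ((toSymAlgebra M).naturality i.op).symm

/-- The structure morphism `𝕍(M) ⟶ Z`. -/
noncomputable def vectorBundleToSubscheme (M : I.ModulePresheaf) (hM : M.IsQuasicoherent) :
    vectorBundle M hM ⟶ I.subscheme :=
  (AffineZariskiSite.relativeGluingData hM.coequifibered_toSymAlgebra).desc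
    { pt := I.subscheme
      ι :=
        { app := fun U => symAlgebraToSubscheme M U
          naturality := fun _ _ i =>
            (symAlgebraToSubscheme_naturality M i).trans (Category.comp_id _).symm } }

theorem vectorBundleChart_toSubscheme (M : I.ModulePresheaf) (hM : M.IsQuasicoherent)
    (U : X.AffineZariskiSite) :
    vectorBundleChart M hM U ≫ vectorBundleToSubscheme M hM = symAlgebraToSubscheme M U :=
  (AffineZariskiSite.relativeGluingData hM.coequifibered_toSymAlgebra).cover_f_desc _ U

/-! ### Cohomology -/

/-- The compatible families of sections of `M` over all affine open subsets `U` of `X` with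
`Z ∩ U ⊆ V`, where `V` is an open subset of `Z = V(I)`. -/
def sections (M : I.ModulePresheaf) (V : I.subscheme.Opens) :
    AddSubgroup (∀ U : {U : X.AffineZariskiSite // I.subschemeι ⁻¹ᵁ U.aff.1 ≤ V}, M.obj U.1) where
  carrier := {s | ∀ (U U' : {U : X.AffineZariskiSite // I.subschemeι ⁻¹ᵁ U.aff.1 ≤ V})
    (h : U.1 ≤ U'.1), M.res h (s U') = s U}
  zero_mem' _ _ _ := map_zero _
  add_mem' hs ht U U' h := by
    rw [Pi.add_apply, Pi.add_apply, map_add, hs U U' h, ht U U' h]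
  neg_mem' hs U U' h := by rw [Pi.neg_apply, Pi.neg_apply, map_neg, hs U U' h]

/-- Restriction of compatible families. -/
def sectionsRes (M : I.ModulePresheaf) {V W : I.subscheme.Opens} (h : V ≤ W) :
    M.sections W →+ M.sections V where
  toFun s := ⟨fun U => s.1 ⟨U.1, U.2.trans h⟩, fun U U' hU => s.2 ⟨U.1, U.2.trans h⟩ ⟨U'.1, U'.2.trans h⟩ hU⟩
  map_zero' := rfl
  map_add' _ _ := rfl

/-- The presheaf of abelian groups on `Z` extending `M` from the basis of the opens `Z ∩ U`. -/
def toPresheaf (M : I.ModulePresheaf) : I.subscheme.Opensᵒᵖ ⥤ AddCommGrpCat.{u} where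
  obj V := .of (M.sections V.unop)
  map i := AddCommGrpCat.ofHom (M.sectionsRes i.unop.le)
  map_id _ := rfl
  map_comp _ _ := rfl

/-- The sheaf of abelian groups on `Z` given by `M` (for quasi-coherent `M` the compatible families
already form a sheaf, so that the sheafification changes nothing). -/
noncomputable def toSheaf (M : I.ModulePresheaf) : TopCat.Sheaf AddCommGrpCat.{u} I.subscheme :=
  (presheafToSheaf (Opens.grothendieckTopology I.subscheme) AddCommGrpCat.{u}).obj M.toPresheaf

/-- The sheaf cohomology group `Hⁿ(Z, M)`. -/
noncomputable abbrev H (M : I.ModulePresheaf) (n : ℕ) : Type u := Sheaf.H M.toSheaf n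

end ModulePresheaf

/-! ### The exceptional divisor -/

/-- The exceptional divisor `Bl_Z^D X ×_X Z ⟶ Z`. -/
noncomputable def exceptionalDivisor {I J : X.IdealSheafData} (h : J ≤ I)
    (hJ : J.IsLocallyPrincipal) : Over I.subscheme :=
  Over.mk (pullback.snd (dilatationι h hJ) I.subschemeι)

/-- `𝕍(C_{Z/D} ⊗ J_Z⁻¹) ⟶ Z`. -/
noncomputable def twistedNormalBundle (I : X.IdealSheafData) {J : X.IdealSheafData}
    (hJ : J.IsEffectiveCartier) : Over I.subscheme :=
  Over.mk (ModulePresheaf.vectorBundleToSubscheme _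
    (ModulePresheaf.isQuasicoherent_twistedConormal I hJ))

/-- For a closed subscheme `W = V(K)` containing `Z`, the isomorphism
`e : 𝕍(C_{Z/D} ⊗ J_Z⁻¹) ≅ Bl_Z^D X ×_X Z` over `Z` is the one defined by `W`: wherever `J = (b)`, the
fraction `k / b` with `k ∈ K` corresponds to `[k] ⊗ b^∨`, where `b^∨` is the linear form `l` on `J_Z`
with `l [b] = 1`. -/
def IsSplitBy {I J : X.IdealSheafData} (h : J ≤ I) (hJ : J.IsEffectiveCartier)
    {K : X.IdealSheafData} (hK : K ≤ I)
    (e : twistedNormalBundle I hJ ≅ exceptionalDivisor h hJ.isLocallyPrincipal) : Prop :=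
  ∀ (U : X.AffineZariskiSite) (b : J.ideal U.aff) (_ : J.ideal U.aff = Ideal.span {b.1})
    (l : Module.Dual (I.quot U) ((ModulePresheaf.idealRestrict I J).obj U))
    (_ : l (ModulePresheaf.idealRestrictMk I J U b) = 1),
    ∃ φ : (affineBlowupAlgebra h).obj (op U) ⟶
        (ModulePresheaf.symAlgebra (ModulePresheaf.twistedConormal I J)).obj (op U),
      ModulePresheaf.vectorBundleChart _ (ModulePresheaf.isQuasicoherent_twistedConormal I hJ) U ≫
          e.hom.left ≫ pullback.fst _ _ =
        Spec.map φ ≫ dilatationChart h hJ.isLocallyPrincipal U ∧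
      ∀ (k : K.ideal U.aff) (a : affineBlowupSubring h U),
        resHom (J.outside_le U.aff) b.1 * a.1 = resHom (J.outside_le U.aff) k.1 →
        φ.hom a = SymmetricAlgebra.ι (I.quot U) ((ModulePresheaf.twistedConormal I J).obj U)
          (ModulePresheaf.conormalMk I J U ⟨k.1, hK U.aff k.2⟩ ⊗ₜ l)

end IdealSheafData

/-- The closed immersion `f : Z ⟶ D` is regular: locally around each point of `Z` its ideal is
generated by a regular sequence. -/
def IsRegularClosedImmersion {Z D : Scheme.{u}} (f : Z ⟶ D) : Prop :=
  IsClosedImmersion f ∧ ∀ z : Z, ∃ U : D.affineOpens, f z ∈ U.1 ∧ ∃ rs : List Γ(D, U),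
    RingTheory.Sequence.IsRegular Γ(D, U) rs ∧ f.ker.ideal U = Ideal.ofList rs

/-- The restriction of a scheme over `Z` to the open subscheme `V` of `Z`. -/
noncomputable def overRestrict {Z : Scheme.{u}} (P : Over Z) (V : Z.Opens) : Over V.toScheme :=
  Over.mk (P.hom ∣_ V)

end AlgebraicGeometry.Scheme

open AlgebraicGeometry.Scheme AlgebraicGeometry.Scheme.IdealSheafData

/-! Near a point of Z the ring B of functions on X contains a weakly regular sequence b, x₁, …, xₙ
with J = (b) and I = (b, x₁, …, xₙ). The blowup algebra is generated over B by the fractions xᵢ/b.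
Since b is a nonzerodivisor modulo the polynomials bTᵢ − xᵢ, these polynomials generate all
relations between the fractions (`IsRegularModulo.mem_span_of_eval₂_eq_zero`). They vanish modulo I,
so the blowup algebra modulo I is the polynomial ring (B/I)[T₁, …, Tₙ].

The variable Tᵢ is not intrinsically [xᵢ] ⊗ b^∨: replacing xᵢ by xᵢ + db leaves its conormal class
unchanged but adds d to xᵢ/b. The ambiguity disappears once a splitting s : I/I² → J_Z of the
sequence 0 → J_Z → I/I² → C_{Z/D} → 0 is chosen. The rule z/b ↦ [z] ⊗ b^∨ + b^∨(s z) then identifies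
the blowup algebra modulo I with Sym(C_{Z/D} ⊗ J_Z⁻¹), whatever the generator b
(`IsRegularModulo.exists_hom_symmetricAlgebra`, `exists_isChartHom`). Being compatible with
restriction, these identifications glue, so a splitting over Z yields an isomorphism over Z
(`exists_iso_of_isSplitting`).

All the assertions thereby become statements about splittings. Locally one exists, because b, x₁, …,
xₙ induce a basis of I/I² and the coefficient of b can be read off (`exists_isSplitting`). Globally,
splittings are the lifts of the identity along the surjection ℋom(I/I², J_Z) → ℋom(J_Z, J_Z), whose
kernel is N_{Z/D} ⊗ J_Z (`shortExact_splittingComplex`), so that H¹(Z, N_{Z/D} ⊗ J_Z) = 0 suffices.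
For affine Z the local splittings are instead corrected by hand with a Čech argument
(`IsQuasicoherent.exists_sectionsRes_sub_eq`).

If Z = W ∩ D is transversal, then I = K + J, and there is exactly one splitting that kills K
(`exists_isSplitting_of_transversal`). It sends k/b to [k] ⊗ b^∨. Functions on X and the fractions
k/b generate the blowup algebra, which gives uniqueness (`IsSplitBy.unique`). -/

section RegularModulo

/-! ### Weakly regular sequences and their relations -/

variable {B : Type*} [CommRing B]

/-- The ideal `(b, x₀, …, x_{k-1})`. -/
def partialIdeal (b : B) (x : ℕ → B) (k : ℕ) : Ideal B :=
  Ideal.span {b} ⊔ Ideal.span (x '' Set.Iio k)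

/-- `b, x₀, …, x_{n-1}` is a weakly regular sequence. -/
structure IsRegularModulo (b : B) (x : ℕ → B) (n : ℕ) : Prop where
  nzd : b ∈ nonZeroDivisors B
  reg : ∀ k < n, ∀ c, c * x k ∈ partialIdeal b x k → c ∈ partialIdeal b x k

theorem IsRegularModulo.mono {b : B} {x : ℕ → B} {n m : ℕ} (h : IsRegularModulo b x n)
    (hm : m ≤ n) : IsRegularModulo b x m :=
  ⟨h.nzd, fun k hk => h.reg k (hk.trans_le hm)⟩

theorem self_mem_partialIdeal (b : B) (x : ℕ → B) (k : ℕ) : b ∈ partialIdeal b x k :=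
  Ideal.mem_sup_left (Ideal.mem_span_singleton_self b)

theorem mem_partialIdeal_of_lt (b : B) (x : ℕ → B) {i k : ℕ} (h : i < k) :
    x i ∈ partialIdeal b x k :=
  Ideal.mem_sup_right (Ideal.subset_span ⟨i, h, rfl⟩)

theorem partialIdeal_le_iff {b : B} {x : ℕ → B} {k : ℕ} {I : Ideal B} :
    partialIdeal b x k ≤ I ↔ b ∈ I ∧ ∀ i < k, x i ∈ I := by
  rw [partialIdeal, sup_le_iff, Ideal.span_singleton_le_iff_mem, Ideal.span_le]
  refine and_congr_right fun _ => ⟨fun h i hi => h ⟨i, hi, rfl⟩, ?_⟩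
  rintro h _ ⟨i, hi, rfl⟩
  exact h i hi

theorem partialIdeal_mono (b : B) (x : ℕ → B) {k l : ℕ} (h : k ≤ l) :
    partialIdeal b x k ≤ partialIdeal b x l :=
  partialIdeal_le_iff.mpr ⟨self_mem_partialIdeal _ _ _,
    fun _ hi => mem_partialIdeal_of_lt b x (hi.trans_le h)⟩

/-- The combinations with coefficients in 𝔞 form an ideal that contains the generating products.
Keeping track of 𝔞 matters for 𝔞 = (b, x): it turns a congruence modulo I² into an exact relation.
-/
theorem exists_of_mem_mul_partialIdeal {b : B} {x : ℕ → B} {k : ℕ} {𝔞 : Ideal B} {y : B}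
    (hy : y ∈ 𝔞 * partialIdeal b x k) : ∃ (a : B) (d : ℕ → B), a ∈ 𝔞 ∧ (∀ i, d i ∈ 𝔞) ∧
      y = a * b + ∑ i ∈ Finset.range k, d i * x i := by
  let N : Ideal B :=
    { carrier := {y | ∃ (a : B) (d : ℕ → B), a ∈ 𝔞 ∧ (∀ i, d i ∈ 𝔞) ∧
        y = a * b + ∑ i ∈ Finset.range k, d i * x i}
      zero_mem' := ⟨0, 0, zero_mem _, fun _ => zero_mem _, by simp⟩
      add_mem' := by
        rintro _ _ ⟨a, d, ha, hd, rfl⟩ ⟨a', d', ha', hd', rfl⟩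
        refine ⟨a + a', d + d', add_mem ha ha', fun i => add_mem (hd i) (hd' i), ?_⟩
        simp only [Pi.add_apply, add_mul, Finset.sum_add_distrib]
        ring
      smul_mem' := by
        rintro r _ ⟨a, d, ha, hd, rfl⟩
        refine ⟨r * a, fun i => r * d i, Ideal.mul_mem_left _ _ ha,
          fun i => Ideal.mul_mem_left _ _ (hd i), ?_⟩
        rw [smul_eq_mul, mul_add, Finset.mul_sum]
        simp only [mul_assoc] }
  have : 𝔞 * partialIdeal b x k ≤ N := by
    rw [Ideal.mul_le]
    intro r hr s hs
    suffices partialIdeal b x k ≤ Submodule.comap (LinearMap.mulLeft B r) N from this hs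
    rw [partialIdeal_le_iff]
    refine ⟨⟨r, 0, hr, fun _ => zero_mem _, by simp⟩, fun i hi =>
      ⟨0, Pi.single i r, zero_mem _, fun j => ?_, ?_⟩⟩
    · by_cases h : j = i
      · subst h; simpa using hr
      · simp [h]
    · simp [Pi.single_apply, hi]
  exact this hy

theorem exists_of_mem_partialIdeal {b : B} {x : ℕ → B} {k : ℕ} {y : B}
    (hy : y ∈ partialIdeal b x k) : ∃ (a : B) (d : ℕ → B),
      y = a * b + ∑ i ∈ Finset.range k, d i * x i := by
  obtain ⟨a, d, -, -, h⟩ := exists_of_mem_mul_partialIdeal (𝔞 := (⊤ : Ideal B)) (by rwa [Ideal.top_mul])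
  exact ⟨a, d, h⟩

theorem sum_mem_partialIdeal (b : B) (x d : ℕ → B) (a : B) (k : ℕ) :
    a * b + ∑ i ∈ Finset.range k, d i * x i ∈ partialIdeal b x k :=
  add_mem (Ideal.mul_mem_left _ _ (self_mem_partialIdeal _ _ _)) <| sum_mem fun _ hi =>
    Ideal.mul_mem_left _ _ (mem_partialIdeal_of_lt b x (Finset.mem_range.mp hi))

/-- The relations of a weakly regular sequence have coefficients in the ideal it generates. -/
theorem IsRegularModulo.mem_of_sum_eq_zero {b : B} {x : ℕ → B} {n : ℕ}
    (h : IsRegularModulo b x n) (a : B) (c : ℕ → B)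
    (e : a * b + ∑ i ∈ Finset.range n, c i * x i = 0) :
    a ∈ partialIdeal b x n ∧ ∀ i < n, c i ∈ partialIdeal b x n := by
  induction n generalizing a c with
  | zero =>
    rw [Finset.range_zero, Finset.sum_empty, add_zero] at e
    rw [(mul_right_mem_nonZeroDivisors_eq_zero_iff h.nzd).mp e]
    exact ⟨zero_mem _, fun i hi => absurd hi (Nat.not_lt_zero i)⟩
  | succ n ih =>
    rw [Finset.sum_range_succ] at e
    have hle := partialIdeal_mono b x (Nat.le_succ n)
    -- The relation expresses c n * x n through the earlier terms, so regularity at n puts c n in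
    -- their ideal.
    have hn : c n ∈ partialIdeal b x n := by
      refine h.reg n (Nat.lt_succ_self n) _ ?_
      have : c n * x n = -(a * b + ∑ i ∈ Finset.range n, c i * x i) := by
        linear_combination e
      rw [this]
      exact neg_mem (sum_mem_partialIdeal _ _ _ _ _)
    -- Expanding c n absorbs the last summand into the others and gives a shorter relation. Its
    -- coefficients differ from the old ones by multiples of x n, which is itself in the larger
    -- ideal.
    obtain ⟨a', d, hd⟩ := exists_of_mem_partialIdeal hn
    obtain ⟨h1, h2⟩ := ih (h.mono (Nat.le_succ n)) (a + a' * x n) (fun i => c i + d i * x n) (by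
      simp only [add_mul, Finset.sum_add_distrib]
      rw [hd, add_mul, Finset.sum_mul] at e
      rw [← e, Finset.sum_congr rfl fun i _ => mul_right_comm (d i) (x n) (x i)]
      ring)
    have hx : x n ∈ partialIdeal b x (n + 1) := mem_partialIdeal_of_lt b x (Nat.lt_succ_self n)
    refine ⟨?_, fun i hi => ?_⟩
    · exact (Ideal.add_mem_iff_left _ (Ideal.mul_mem_left _ _ hx)).mp (hle h1)
    · rcases Nat.lt_succ_iff_lt_or_eq.mp hi with hi | rfl
      · exact (Ideal.add_mem_iff_left _ (Ideal.mul_mem_left _ _ hx)).mp (hle (h2 i hi))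
      · exact hle hn

/-- The sequence `b, x₀, …, x_{n-1}` gives a basis of `I / I²`. -/
theorem IsRegularModulo.mem_of_sum_mem_sq {b : B} {x : ℕ → B} {n : ℕ}
    (h : IsRegularModulo b x n) (a : B) (c : ℕ → B)
    (e : a * b + ∑ i ∈ Finset.range n, c i * x i ∈ partialIdeal b x n * partialIdeal b x n) :
    a ∈ partialIdeal b x n ∧ ∀ i < n, c i ∈ partialIdeal b x n := by
  -- Subtracting an expression of the same element with coefficients in the ideal leaves an exact
  -- relation.
  obtain ⟨a', d, ha', hd, e'⟩ := exists_of_mem_mul_partialIdeal e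
  obtain ⟨h1, h2⟩ := h.mem_of_sum_eq_zero (a - a') (c - d) (by
    simp only [Pi.sub_apply, sub_mul, Finset.sum_sub_distrib]
    linear_combination e')
  exact ⟨by simpa using add_mem h1 ha', fun i hi => by simpa using add_mem (h2 i hi) (hd i)⟩

/-- `b` is a nonzerodivisor modulo `x₀, …, x_{n-1}`. -/
theorem IsRegularModulo.mem_span_of_mul_mem {b : B} {x : ℕ → B} {n : ℕ}
    (h : IsRegularModulo b x n) {y : B} (hy : b * y ∈ Ideal.span (x '' Set.Iio n)) :
    y ∈ Ideal.span (x '' Set.Iio n) := by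
  induction n generalizing y with
  | zero =>
    have : x '' Set.Iio 0 = ∅ := by simp
    rw [this, Ideal.span_empty, Ideal.mem_bot] at hy ⊢
    exact (mul_left_mem_nonZeroDivisors_eq_zero_iff h.nzd).mp hy
  | succ n ih =>
    have e : x '' Set.Iio (n + 1) = x '' Set.Iio n ∪ {x n} := by
      rw [← Set.image_singleton, ← Set.image_union]
      congr 1
      ext i
      simp [or_comm, le_iff_lt_or_eq]
    rw [e, Ideal.span_union, Submodule.mem_sup] at hy ⊢
    obtain ⟨w, hw, _, hz, e⟩ := hy
    obtain ⟨g, rfl⟩ := Ideal.mem_span_singleton'.mp hz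
    -- Here b * y = w + g * x n, so g * x n lies in the ideal of b, x₀, …, x_{n-1} and regularity
    -- applies to g. Writing g = d * b + w' then makes b * (y - d * x n) a member of the shorter
    -- span, where the induction hypothesis holds.
    have hg : g ∈ partialIdeal b x n := by
      refine h.reg n (Nat.lt_succ_self n) _ ?_
      rw [eq_sub_of_add_eq' e]
      exact sub_mem (Ideal.mul_mem_right _ _ (self_mem_partialIdeal _ _ _)) (Ideal.mem_sup_right hw)
    obtain ⟨_, hb, w', hw', e'⟩ := Submodule.mem_sup.mp hg
    obtain ⟨d, rfl⟩ := Ideal.mem_span_singleton'.mp hb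
    refine ⟨y - d * x n, ih (h.mono (Nat.le_succ n)) ?_, d * x n,
      Ideal.mem_span_singleton'.mpr ⟨d, rfl⟩, by ring⟩
    have : b * (y - d * x n) = w + x n * w' := by
      rw [← e'] at e
      linear_combination -e
    rw [this]
    exact add_mem hw (Ideal.mul_mem_left _ _ hw')

/-! ### Relations between the fractions x_i / b -/

section Polynomial

open MvPolynomial

variable {n : ℕ}

/-- The polynomial `b T_k - x_k`. -/
noncomputable def blowupRelation (b : B) (x : ℕ → B) (n k : ℕ) : MvPolynomial (Fin n) B :=
  -- Indexing by ℕ lets `partialIdeal` apply; the 0 for k ≥ n is only a filler.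
  C b * (if h : k < n then X ⟨k, h⟩ else 0) - C (x k)

/-- Modulo b the polynomial b T_k - x_k is just -x_k. -/
theorem partialIdeal_blowupRelation (b : B) (x : ℕ → B) (n k : ℕ) :
    partialIdeal (C b) (blowupRelation b x n) k = (partialIdeal b x k).map C := by
  apply le_antisymm
  · rw [partialIdeal_le_iff]
    refine ⟨Ideal.mem_map_of_mem _ (self_mem_partialIdeal _ _ _), fun i hi => ?_⟩
    exact sub_mem (Ideal.mul_mem_right _ _ (Ideal.mem_map_of_mem _ (self_mem_partialIdeal _ _ _)))
      (Ideal.mem_map_of_mem _ (mem_partialIdeal_of_lt b x hi))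
  · rw [Ideal.map_le_iff_le_comap, partialIdeal_le_iff]
    refine ⟨self_mem_partialIdeal _ _ _, fun i hi => ?_⟩
    have := mem_partialIdeal_of_lt (C b) (blowupRelation b x n) hi
    have h2 : C b * (if h : i < n then X ⟨i, h⟩ else 0) ∈
        partialIdeal (C b) (blowupRelation b x n) k :=
      Ideal.mul_mem_right _ _ (self_mem_partialIdeal _ _ _)
    have h3 := sub_mem h2 this
    rwa [blowupRelation, sub_sub_cancel] at h3

/-- The ideals involved are extended from B, where membership is tested coefficient by coefficient,
and modulo b multiplication by b T_k - x_k is multiplication by -x_k. So regularity over B gives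
regularity over B[T], and `IsRegularModulo.mem_span_of_mul_mem` becomes available for the relations.
-/
theorem IsRegularModulo.blowupRelation {b : B} {x : ℕ → B} (h : IsRegularModulo b x n) :
    IsRegularModulo (C b) (blowupRelation b x n) n := by
  refine ⟨?_, fun k hk c hc => ?_⟩
  · rw [mem_nonZeroDivisors_iff_right]
    intro F hF
    ext m
    have := congrArg (coeff m) hF
    rw [mul_comm, coeff_C_mul, coeff_zero, mul_comm] at this
    exact (mul_right_mem_nonZeroDivisors_eq_zero_iff h.nzd).mp this
  · rw [partialIdeal_blowupRelation] at hc ⊢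
    have h1 : C (x k) * c ∈ (partialIdeal b x k).map (C (σ := Fin n)) := by
      have h2 : c * (C b * (if h : k < n then X ⟨k, h⟩ else 0)) ∈
          (partialIdeal b x k).map (C (σ := Fin n)) :=
        Ideal.mul_mem_left _ _
          (Ideal.mul_mem_right _ _ (Ideal.mem_map_of_mem _ (self_mem_partialIdeal _ _ _)))
      have h3 := sub_mem h2 hc
      rwa [_root_.blowupRelation, mul_sub, sub_sub_cancel, mul_comm] at h3
    rw [mem_map_C_iff] at h1 ⊢
    intro m
    refine h.reg k hk _ ?_
    have := h1 m
    rwa [coeff_C_mul, mul_comm] at this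

variable {A : Type*} [CommRing A] {ρ : B →+* A} {b : B} {x : ℕ → B} {y : Fin n → A}

theorem eval₂_eq_zero_of_mem_span_blowupRelation (hy : ∀ i : Fin n, ρ b * y i = ρ (x i))
    {F : MvPolynomial (Fin n) B} (hF : F ∈ Ideal.span (blowupRelation b x n '' Set.Iio n)) :
    eval₂Hom ρ y F = 0 := by
  suffices Ideal.span (blowupRelation b x n '' Set.Iio n) ≤ RingHom.ker (eval₂Hom ρ y) from this hF
  rw [Ideal.span_le]
  rintro _ ⟨k, hk, rfl⟩
  have hk' : k < n := hk
  rw [SetLike.mem_coe, RingHom.mem_ker, blowupRelation, dif_pos hk', map_sub, map_mul]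
  simp [hy]

/-- Each factor b converts one variable T_i into the constant x_i modulo the relations, so a large
power of b turns any polynomial into a constant. -/
theorem exists_pow_mul_sub_C_mem_span_blowupRelation (b : B) (x : ℕ → B)
    (F : MvPolynomial (Fin n) B) : ∃ (N : ℕ) (β : B),
      C b ^ N * F - C β ∈ Ideal.span (blowupRelation b x n '' Set.Iio n) := by
  induction F using MvPolynomial.induction_on with
  | C a => exact ⟨0, a, by simp⟩
  | add F G hF hG =>
    obtain ⟨N, β, hN⟩ := hF
    obtain ⟨M, γ, hM⟩ := hG
    refine ⟨N + M, b ^ M * β + b ^ N * γ, ?_⟩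
    have : C b ^ (N + M) * (F + G) - C (b ^ M * β + b ^ N * γ) =
        C b ^ M * (C b ^ N * F - C β) + C b ^ N * (C b ^ M * G - C γ) := by
      simp only [map_add, map_mul, map_pow]
      ring
    rw [this]
    exact add_mem (Ideal.mul_mem_left _ _ hN) (Ideal.mul_mem_left _ _ hM)
  | mul_X F i hF =>
    obtain ⟨N, β, hN⟩ := hF
    refine ⟨N + 1, β * x i, ?_⟩
    have : C b ^ (N + 1) * (F * X i) - C (β * x i) =
        (C b * X i) * (C b ^ N * F - C β) + C β * blowupRelation b x n i := by
      rw [blowupRelation, dif_pos i.2, map_mul]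
      ring
    rw [this]
    exact add_mem (Ideal.mul_mem_left _ _ hN)
      (Ideal.mul_mem_left _ _ (Ideal.subset_span ⟨i, i.2, rfl⟩))

/-- The relations between the fractions `x_i / b` are generated by `b T_i - x_i`. -/
theorem IsRegularModulo.mem_span_of_eval₂_eq_zero (h : IsRegularModulo b x n)
    (hρ : Function.Injective ρ) (hy : ∀ i : Fin n, ρ b * y i = ρ (x i))
    {F : MvPolynomial (Fin n) B} (hF : eval₂Hom ρ y F = 0) :
    F ∈ Ideal.span (_root_.blowupRelation b x n '' Set.Iio n) := by
  obtain ⟨N, β, hN⟩ := exists_pow_mul_sub_C_mem_span_blowupRelation b x F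
  -- Evaluation at the fractions shows ρ β = 0, hence β = 0, and b ^ N * F is a combination of the
  -- relations.
  have h0 := eval₂_eq_zero_of_mem_span_blowupRelation hy hN
  rw [map_sub, map_mul, hF, mul_zero, zero_sub, neg_eq_zero] at h0
  have hβ : β = 0 := hρ (by simpa using h0)
  rw [hβ, map_zero, sub_zero] at hN
  -- The factors b cancel one at a time, since b is a nonzerodivisor modulo the relations.
  induction N with
  | zero => simpa using hN
  | succ N ih =>
    rw [pow_succ', mul_assoc] at hN
    exact ih (h.blowupRelation.mem_span_of_mul_mem hN)

/-- A polynomial in the `x_i / b` which is divisible by `b` in `B[x_i / b]` has coefficients in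
`(b, x₀, …, x_{n-1})`. -/
theorem IsRegularModulo.map_mk_eq_zero (h : IsRegularModulo b x n)
    (hρ : Function.Injective ρ) (hy : ∀ i : Fin n, ρ b * y i = ρ (x i))
    {F G : MvPolynomial (Fin n) B} (hF : eval₂Hom ρ y F = ρ b * eval₂Hom ρ y G) :
    map (Ideal.Quotient.mk (partialIdeal b x n)) F = 0 := by
  have h1 : F - C b * G ∈ Ideal.span (_root_.blowupRelation b x n '' Set.Iio n) := by
    refine h.mem_span_of_eval₂_eq_zero hρ hy ?_
    rw [map_sub, hF, map_mul, coe_eval₂Hom, eval₂_C, sub_self]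
  -- The relations b T_i - x_i have all their coefficients in (b, x), and so does b * G.
  have h2 : F - C b * G ∈ (partialIdeal b x n).map C := by
    rw [← partialIdeal_blowupRelation b x n n]
    exact Ideal.mem_sup_right h1
  have h3 : F ∈ (partialIdeal b x n).map C := by
    have h4 : C b * G ∈ (partialIdeal b x n).map C :=
      Ideal.mul_mem_right _ _ (Ideal.mem_map_of_mem _ (self_mem_partialIdeal _ _ _))
    simpa using add_mem h2 h4
  rw [mem_map_C_iff] at h3
  ext m
  rw [coeff_map, coeff_zero, Ideal.Quotient.eq_zero_iff_mem]
  exact h3 m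

end Polynomial

end RegularModulo

/-! ### The affine blowup algebra modulo I -/

section BlowupChart

theorem partialIdeal_sub_mul {B : Type*} [CommRing B] (b : B) (x d : ℕ → B) (k : ℕ) :
    partialIdeal b (fun i => x i - d i * b) k = partialIdeal b x k := by
  apply le_antisymm
  · exact partialIdeal_le_iff.mpr ⟨self_mem_partialIdeal _ _ _, fun i hi =>
      sub_mem (mem_partialIdeal_of_lt b x hi) (Ideal.mul_mem_left _ _ (self_mem_partialIdeal _ _ _))⟩
  · refine partialIdeal_le_iff.mpr ⟨self_mem_partialIdeal _ _ _, fun i hi => ?_⟩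
    have h1 := mem_partialIdeal_of_lt b (fun i => x i - d i * b) hi
    have h2 : d i * b ∈ partialIdeal b (fun i => x i - d i * b) k :=
      Ideal.mul_mem_left _ _ (self_mem_partialIdeal _ _ _)
    simpa using add_mem h1 h2

/-- Changing the x_i by multiples of b affects none of the partial ideals. This freedom is used to
make a given splitting vanish on the sequence. -/
theorem IsRegularModulo.sub_mul {B : Type*} [CommRing B] {b : B} {x : ℕ → B} {n : ℕ}
    (h : IsRegularModulo b x n) (d : ℕ → B) : IsRegularModulo b (fun i => x i - d i * b) n := by
  refine ⟨h.nzd, fun k hk c hc => ?_⟩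
  rw [partialIdeal_sub_mul] at hc ⊢
  refine h.reg k hk c ?_
  have h2 : c * (d k * b) ∈ partialIdeal b x k :=
    Ideal.mul_mem_left _ _ (Ideal.mul_mem_left _ _ (self_mem_partialIdeal _ _ _))
  have := add_mem hc h2
  rwa [mul_sub, sub_add_cancel] at this

variable {B A : Type u} [CommRing B] [CommRing A] {ρ : B →+* A} {I J : Ideal B} {h : J ≤ I} {b : B}

variable (ρ I J h) in
/-- The structure homomorphism of the affine blowup algebra. -/
def toBlowupSubring : B →+* blowupSubring ρ I J h :=
  ρ.codRestrict _ (algebraMap_mem_blowupSubring ρ I J h)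

theorem IsAwayRingHom.injective (hρ : IsAwayRingHom ρ b) (hb : b ∈ nonZeroDivisors B) :
    Function.Injective ρ := by
  rw [injective_iff_map_eq_zero]
  intro y hy
  obtain ⟨n, hn⟩ := hρ.inj hy
  exact (mul_left_mem_nonZeroDivisors_eq_zero_iff (pow_mem hb n)).mp hn

theorem exists_fraction (hJ : J = Ideal.span {b}) (hρ : IsUnit (ρ b)) {x : B} (hx : x ∈ I) :
    ∃ t : blowupSubring ρ I J h, ρ b * t.1 = ρ x := by
  subst hJ
  obtain ⟨u, hu⟩ := hρ.exists_right_inv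
  refine ⟨⟨u * ρ x, mem_blowupSubring_span_singleton.mpr ⟨1, x, by rwa [pow_one], ?_⟩⟩, ?_⟩
  · rw [pow_one, ← mul_assoc, hu, one_mul]
  · rw [← mul_assoc, hu, one_mul]

/-- An element of I ^ (m + 1) is a sum of products r * s with r ∈ I and s ∈ I ^ m, and r * s / b ^
(m + 1) = (r / b) * (s / b ^ m). Fractions of degree one therefore generate all the others. -/
theorem fraction_mem {S : Subring A} (hu : IsUnit (ρ b)) (h₀ : ∀ a, ρ a ∈ S)
    (h₁ : ∀ x ∈ I, ∀ t, ρ b * t = ρ x → t ∈ S) (m : ℕ) :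
    ∀ y ∈ I ^ m, ∀ t, ρ b ^ m * t = ρ y → t ∈ S := by
  induction m with
  | zero =>
    intro y _ t ht
    rw [pow_zero, one_mul] at ht
    exact ht ▸ h₀ y
  | succ m ih =>
    obtain ⟨v, hv⟩ := hu.exists_right_inv
    intro y hy
    rw [pow_succ'] at hy
    induction hy using Submodule.mul_induction_on' with
    | mem_mul_mem r hr s hs =>
      intro t ht
      have h1 : v * ρ r ∈ S := h₁ r hr _ (by rw [← mul_assoc, hv, one_mul])
      have h2 : v ^ m * ρ s ∈ S := ih s hs _ (by rw [← mul_assoc, ← mul_pow, hv, one_pow, one_mul])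
      convert mul_mem h1 h2 using 1
      apply (hu.pow (m + 1)).mul_left_cancel
      rw [ht, map_mul]
      calc ρ r * ρ s = (ρ b * v) ^ (m + 1) * (ρ r * ρ s) := by rw [hv, one_pow, one_mul]
        _ = _ := by ring
    | add x _ y _ hx hy =>
      intro t ht
      have h1 := hx (v ^ (m + 1) * ρ x) (by rw [← mul_assoc, ← mul_pow, hv, one_pow, one_mul])
      have h2 := hy (v ^ (m + 1) * ρ y) (by rw [← mul_assoc, ← mul_pow, hv, one_pow, one_mul])
      convert add_mem h1 h2 using 1
      apply (hu.pow (m + 1)).mul_left_cancel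
      rw [ht, map_add]
      calc ρ x + ρ y = (ρ b * v) ^ (m + 1) * (ρ x + ρ y) := by rw [hv, one_pow, one_mul]
        _ = _ := by ring

/-- The affine blowup algebra is generated by the fractions `x / b` with `x ∈ I`. -/
theorem blowupSubring_subring_eq_top (hJ : J = Ideal.span {b}) (hu : IsUnit (ρ b))
    {S : Subring (blowupSubring ρ I J h)} (h₀ : ∀ a, toBlowupSubring ρ I J h a ∈ S)
    (h₁ : ∀ x ∈ I, ∀ t : blowupSubring ρ I J h, ρ b * t.1 = ρ x → t ∈ S)
    (t : blowupSubring ρ I J h) : t ∈ S := by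
  subst hJ
  have key : t.1 ∈ S.map (blowupSubring ρ I _ h).subtype := by
    obtain ⟨m, y, hy, e⟩ := mem_blowupSubring_span_singleton.mp t.2
    refine fraction_mem (I := I) hu (fun a => Subring.mem_map.mpr ⟨_, h₀ a, rfl⟩) (fun x hx t ht => ?_) m y hy t.1 e
    obtain ⟨s, hs⟩ := exists_fraction (h := h) rfl hu hx
    have : t = s.1 := hu.mul_left_cancel (ht.trans hs.symm)
    exact Subring.mem_map.mpr ⟨s, h₁ x hx s hs, this.symm⟩
  obtain ⟨s, hs, e⟩ := key
  rwa [← Subtype.ext (show s.1 = t.1 from e)]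

theorem blowupSubring_ringHom_ext {S : Type*} [CommRing S] (hJ : J = Ideal.span {b})
    (hu : IsUnit (ρ b)) {φ φ' : blowupSubring ρ I J h →+* S}
    (h₀ : ∀ a, φ (toBlowupSubring ρ I J h a) = φ' (toBlowupSubring ρ I J h a))
    (h₁ : ∀ x ∈ I, ∀ t : blowupSubring ρ I J h, ρ b * t.1 = ρ x → φ t = φ' t) : φ = φ' :=
  RingHom.ext fun t => blowupSubring_subring_eq_top (S := φ.eqLocus φ') hJ hu h₀ h₁ t

variable {N : Type u} [AddCommGroup N] [Module (B ⧸ I) N] {x : ℕ → B} {n : ℕ}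
  {q : I →ₛₗ[Ideal.Quotient.mk I] N}

/-- The module N is kept abstract: q only has to identify it with I / (I² + (b)). This covers both
the conormal module and its twist by J_Z⁻¹. The class of b is zero, so the classes of the x_i span.
-/
theorem span_range_eq_top_of_partialIdeal (hI : I = partialIdeal b x n)
    (hq : Function.Surjective q) (hqk : ∀ z, q z = 0 ↔ z.1 ∈ I * I ⊔ Ideal.span {b})
    (hx : ∀ i < n, x i ∈ I) :
    ⊤ ≤ Submodule.span (B ⧸ I) (Set.range fun i : Fin n => q ⟨x i, hx i i.2⟩) := by
  rintro y -
  obtain ⟨⟨z, hz⟩, rfl⟩ := hq y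
  obtain ⟨a, d, e⟩ := exists_of_mem_partialIdeal (hI ▸ hz)
  have hb : b ∈ I := hI ▸ self_mem_partialIdeal b x n
  have : (⟨z, hz⟩ : I) = a • ⟨b, hb⟩ + ∑ i : Fin n, d i • ⟨x i, hx i i.2⟩ := by
    apply Subtype.ext
    rw [Submodule.coe_add, Submodule.coe_sum]
    simp only [SetLike.val_smul, smul_eq_mul]
    rw [e, ← Fin.sum_univ_eq_sum_range (fun i => d i * x i)]
  have hqb : q ⟨b, hb⟩ = 0 :=
    (hqk _).mpr (Ideal.mem_sup_right (Ideal.mem_span_singleton_self b))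
  rw [this, map_add, map_sum, q.map_smulₛₗ, hqb, smul_zero, zero_add]
  refine sum_mem fun i _ => ?_
  rw [q.map_smulₛₗ]
  exact Submodule.smul_mem _ _ (Submodule.subset_span ⟨i, rfl⟩)

/-- A relation in N says that Σ d_i x_i is in I² up to a multiple of b. Moving that multiple to the
other side, `IsRegularModulo.mem_of_sum_mem_sq` puts every d_i in I. -/
theorem IsRegularModulo.linearIndependent (hr : IsRegularModulo b x n)
    (hI : I = partialIdeal b x n) (hqk : ∀ z, q z = 0 ↔ z.1 ∈ I * I ⊔ Ideal.span {b})
    (hx : ∀ i < n, x i ∈ I) :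
    LinearIndependent (B ⧸ I) (fun i : Fin n => q ⟨x i, hx i i.2⟩) := by
  rw [Fintype.linearIndependent_iff]
  intro g hg i
  choose g' hg' using fun i => Ideal.Quotient.mk_surjective (g i)
  let d : ℕ → B := fun i => if h : i < n then g' ⟨i, h⟩ else 0
  have hd (i : Fin n) : d i = g' i := dif_pos i.2
  have h0 : q (∑ i : Fin n, d i • ⟨x i, hx i i.2⟩) = 0 := by
    rw [map_sum, ← hg]
    refine Finset.sum_congr rfl fun i _ => ?_
    rw [q.map_smulₛₗ, hd, hg']
  rw [hqk, Submodule.coe_sum] at h0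
  simp only [SetLike.val_smul, smul_eq_mul] at h0
  rw [Fin.sum_univ_eq_sum_range (fun i => d i * x i)] at h0
  obtain ⟨y, hy, _, hz, e⟩ := Submodule.mem_sup.mp h0
  obtain ⟨a, rfl⟩ := Ideal.mem_span_singleton'.mp hz
  have := (hr.mem_of_sum_mem_sq (-a) d (by
    rw [← e, ← hI]; convert hy using 1; ring)).2 i i.2
  rw [← hg', ← hd, Ideal.Quotient.eq_zero_iff_mem, hI]
  exact this

/-- The classes of `x₀, …, x_{n-1}` are a basis of `I / (I² + (b))`. -/
noncomputable def IsRegularModulo.basis (hr : IsRegularModulo b x n)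
    (hI : I = partialIdeal b x n) (hq : Function.Surjective q)
    (hqk : ∀ z, q z = 0 ↔ z.1 ∈ I * I ⊔ Ideal.span {b}) (hx : ∀ i < n, x i ∈ I) :
    Module.Basis (Fin n) (B ⧸ I) N :=
  Module.Basis.mk (hr.linearIndependent hI hqk hx) (span_range_eq_top_of_partialIdeal hI hq hqk hx)

theorem IsRegularModulo.basis_apply (hr : IsRegularModulo b x n)
    (hI : I = partialIdeal b x n) (hq : Function.Surjective q)
    (hqk : ∀ z, q z = 0 ↔ z.1 ∈ I * I ⊔ Ideal.span {b}) (hx : ∀ i < n, x i ∈ I) (i : Fin n) :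
    hr.basis hI hq hqk hx i = q ⟨x i, hx i i.2⟩ :=
  Module.Basis.mk_apply _ _ i

open MvPolynomial in
/-- The fractions `x_i / b` identify the affine blowup algebra modulo `I` with a polynomial ring. -/
theorem IsRegularModulo.exists_hom_mvPolynomial (hr : IsRegularModulo b x n)
    (hI : I = partialIdeal b x n) (hJ : J = Ideal.span {b}) (hρ : IsAwayRingHom ρ b) :
    ∃ φ : blowupSubring ρ I J h →+* MvPolynomial (Fin n) (B ⧸ I),
      (∀ a, φ (toBlowupSubring ρ I J h a) = C (Ideal.Quotient.mk I a)) ∧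
      (∀ (i : Fin n) (t : blowupSubring ρ I J h), ρ b * t.1 = ρ (x i) → φ t = X i) ∧
      Function.Surjective φ ∧
      ∀ t, φ t = 0 → t ∈ I.map (toBlowupSubring ρ I J h) := by
  have hu := hρ.isUnit
  have hx (i : Fin n) : x i ∈ I := hI ▸ mem_partialIdeal_of_lt b x i.2
  have hbI : b ∈ I := hI ▸ self_mem_partialIdeal b x n
  choose y hy using fun i : Fin n => exists_fraction (h := h) hJ hu (hx i)
  let ev : MvPolynomial (Fin n) B →+* blowupSubring ρ I J h :=
    eval₂Hom (toBlowupSubring ρ I J h) y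
  have hev : ∀ F, (ev F).1 = eval₂Hom ρ (fun i => (y i).1) F := by
    intro F
    change (blowupSubring ρ I J h).subtype (eval₂ _ _ F) = _
    rw [MvPolynomial.eval₂_comp_left]
    rfl
  have hevC (a : B) : ev (C a) = toBlowupSubring ρ I J h a := eval₂_C _ _ _
  have hevX (i : Fin n) : ev (X i) = y i := eval₂_X _ _ _
  have hsurj : Function.Surjective ev := by
    intro t
    refine blowupSubring_subring_eq_top (S := ev.range) hJ hu (fun a => ⟨C a, hevC a⟩) ?_ t
    intro z hz t ht
    -- If z = a b + Σ d_i x_i, then z / b = a + Σ d_i (x_i / b).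
    obtain ⟨a, d, e⟩ := exists_of_mem_partialIdeal (hI ▸ hz)
    refine ⟨C a + ∑ i : Fin n, C (d i) * X i, Subtype.ext (hu.mul_left_cancel ?_)⟩
    rw [ht, e, hev, map_add, map_sum, mul_add, Finset.mul_sum, map_add, map_mul, map_sum,
      ← Fin.sum_univ_eq_sum_range (fun i => ρ (d i * x i))]
    simp only [map_mul, coe_eval₂Hom, eval₂_C, eval₂_X]
    rw [mul_comm (ρ a)]
    congr 1
    refine Finset.sum_congr rfl fun i _ => ?_
    rw [← hy i]
    ring
  let red : MvPolynomial (Fin n) B →+* MvPolynomial (Fin n) (B ⧸ I) := map (Ideal.Quotient.mk I)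
  -- With G = 0 this says that reduction of coefficients modulo I kills the kernel of `ev`, so it
  -- descends to the blowup algebra.
  have key : ∀ F G, ev F = toBlowupSubring ρ I J h b * ev G → red F = 0 := by
    intro F G e
    subst hI
    refine hr.map_mk_eq_zero (hρ.injective hr.nzd) (y := fun i => (y i).1) hy (G := G) ?_
    rw [← hev, ← hev, e]
    rfl
  have hker : RingHom.ker ev ≤ RingHom.ker red := by
    intro F hF
    refine key F 0 ?_
    rw [map_zero, mul_zero]
    exact hF
  let φ := ev.liftOfSurjective hsurj ⟨red, hker⟩
  have hφ : ∀ F, φ (ev F) = red F := fun F => RingHom.liftOfRightInverse_comp_apply _ _ _ _ F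
  refine ⟨φ, fun a => ?_, fun i t ht => ?_, fun F => ?_, fun t ht => ?_⟩
  · rw [← hevC, hφ]; exact map_C _ _
  · have : t = y i := Subtype.ext (hu.mul_left_cancel (ht.trans (hy i).symm))
    rw [this, ← hevX, hφ]; exact map_X _ _
  · obtain ⟨G, rfl⟩ := map_surjective _ Ideal.Quotient.mk_surjective F
    exact ⟨ev G, hφ G⟩
  · obtain ⟨F, rfl⟩ := hsurj t
    rw [hφ] at ht
    -- The coefficients of F vanish modulo I, so F lies in the ideal generated by I, and so does its
    -- value t.
    have hF : F ∈ I.map C := by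
      rw [mem_map_C_iff]
      intro m
      rw [← Ideal.Quotient.eq_zero_iff_mem, ← coeff_map]
      exact (congrArg (coeff m) ht).trans (coeff_zero m)
    have := Ideal.mem_map_of_mem ev hF
    rw [Ideal.map_map] at this
    convert this using 2
    exact RingHom.ext fun a => (hevC a).symm

/-- A splitting `c` identifies the affine blowup algebra modulo `I` with the symmetric algebra of
the conormal module `N = I / (I² + (b))`. -/
theorem IsRegularModulo.exists_hom_symmetricAlgebra (hr : IsRegularModulo b x n)
    (hI : I = partialIdeal b x n) (hJ : J = Ideal.span {b}) (hρ : IsAwayRingHom ρ b)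
    (hq : Function.Surjective q) (hqk : ∀ z, q z = 0 ↔ z.1 ∈ I * I ⊔ Ideal.span {b})
    (c : I →ₗ[B] B ⧸ I) (hc : ∀ hb : b ∈ I, c ⟨b, hb⟩ = 1) :
    ∃ φ : blowupSubring ρ I J h →+* SymmetricAlgebra (B ⧸ I) N,
      (∀ a, φ (toBlowupSubring ρ I J h a) = algebraMap _ _ (Ideal.Quotient.mk I a)) ∧
      (∀ (z : I) (t : blowupSubring ρ I J h), ρ b * t.1 = ρ z.1 →
        φ t = SymmetricAlgebra.ι _ _ (q z) + algebraMap _ _ (c z)) ∧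
      Function.Surjective φ ∧
      ∀ t, φ t = 0 → t ∈ I.map (toBlowupSubring ρ I J h) := by
  have hu := hρ.isUnit
  have hbI : b ∈ I := hI ▸ self_mem_partialIdeal b x n
  -- we may assume that `c` vanishes on the sequence
  obtain ⟨x, hr, hI, hx, hcx⟩ : ∃ x : ℕ → B, IsRegularModulo b x n ∧ I = partialIdeal b x n ∧
      ∃ hx : ∀ i < n, x i ∈ I, ∀ i (hi : i < n), c ⟨x i, hx i hi⟩ = 0 := by
    have hx : ∀ i < n, x i ∈ I := fun i hi => hI ▸ mem_partialIdeal_of_lt b x hi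
    have : ∀ i, ∃ d : B, ∀ hi : i < n, c ⟨x i, hx i hi⟩ = Ideal.Quotient.mk I d := by
      intro i
      by_cases hi : i < n
      · obtain ⟨d, hd⟩ := Ideal.Quotient.mk_surjective (c ⟨x i, hx i hi⟩)
        exact ⟨d, fun _ => hd.symm⟩
      · exact ⟨0, fun h => absurd h hi⟩
    -- Since c b = 1, subtracting d_i b from x_i, where d_i lifts c x_i, makes c vanish on the new
    -- sequence.
    choose d hd using this
    have hI' : I = partialIdeal b (fun i => x i - d i * b) n :=
      hI.trans (partialIdeal_sub_mul b x d n).symm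
    have hx' : ∀ i < n, x i - d i * b ∈ I := fun i hi =>
      sub_mem (hx i hi) (Ideal.mul_mem_left _ _ hbI)
    refine ⟨_, hr.sub_mul d, hI', hx', fun i hi => ?_⟩
    have : (⟨x i - d i * b, hx' i hi⟩ : I) = ⟨x i, hx i hi⟩ - d i • ⟨b, hbI⟩ := rfl
    rw [this, map_sub, map_smul, hc, hd i hi, sub_eq_zero]
    exact (mul_one _).symm
  obtain ⟨φ₀, h₁, h₂, h₃, h₄⟩ := hr.exists_hom_mvPolynomial (h := h) hI hJ hρ
  let e := SymmetricAlgebra.equivMvPolynomial (hr.basis hI hq hqk hx)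
  have he (i : Fin n) : e.symm (MvPolynomial.X i) =
      SymmetricAlgebra.ι (B ⧸ I) N (q ⟨x i, hx i i.2⟩) := by
    rw [← hr.basis_apply hI hq hqk hx]
    exact SymmetricAlgebra.equivMvPolynomial_symm_X _ i
  have heC (a : B ⧸ I) : e.symm (MvPolynomial.C a) = algebraMap _ _ a := e.symm.commutes a
  let φ : blowupSubring ρ I J h →+* SymmetricAlgebra (B ⧸ I) N := e.symm.toRingHom.comp φ₀
  have hφ : ∀ t, φ t = e.symm (φ₀ t) := fun _ => rfl
  have hφ₀ : ∀ a, φ (toBlowupSubring ρ I J h a) = algebraMap _ _ (Ideal.Quotient.mk I a) :=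
    fun a => by rw [hφ, h₁, heC]
  refine ⟨φ, hφ₀, fun ⟨z, hz⟩ t ht => ?_, e.symm.surjective.comp h₃,
    fun t ht => h₄ t ((map_eq_zero_iff e.symm e.symm.injective).mp ht)⟩
  choose y hy using fun i : Fin n => exists_fraction (h := h) hJ hu (hx i i.2)
  -- For z = a b + Σ d_i x_i the two summands of the formula separate: q kills b, so q z = Σ d_i
  -- q(x_i), while c kills the x_i, so c z = a. On the other side z / b = a + Σ d_i (x_i / b).
  obtain ⟨a, d, e'⟩ := exists_of_mem_partialIdeal (hI ▸ hz)
  have hz' : (⟨z, hz⟩ : I) = a • ⟨b, hbI⟩ + ∑ i : Fin n, d i • ⟨x i, hx i i.2⟩ := by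
    apply Subtype.ext
    rw [Submodule.coe_add, Submodule.coe_sum]
    simp only [SetLike.val_smul, smul_eq_mul]
    rw [e', ← Fin.sum_univ_eq_sum_range (fun i => d i * x i)]
  have ht' : t = toBlowupSubring ρ I J h a + ∑ i : Fin n, toBlowupSubring ρ I J h (d i) * y i := by
    apply Subtype.ext
    apply hu.mul_left_cancel
    change _ = ρ b * ((blowupSubring ρ I J h).subtype (toBlowupSubring ρ I J h a +
      ∑ i : Fin n, toBlowupSubring ρ I J h (d i) * y i))
    rw [ht, map_add, map_sum, mul_add, Finset.mul_sum]
    change ρ z = ρ b * ρ a + _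
    rw [e', ← Fin.sum_univ_eq_sum_range (fun i => d i * x i), map_add, map_mul, map_sum,
      mul_comm (ρ b)]
    congr 1
    refine Finset.sum_congr rfl fun i _ => ?_
    rw [map_mul, map_mul, ← hy i]
    change _ = ρ b * (ρ (d i) * (y i).1)
    ring
  have hqb : q ⟨b, hbI⟩ = 0 :=
    (hqk _).mpr (Ideal.mem_sup_right (Ideal.mem_span_singleton_self b))
  rw [hz', q.map_add, c.map_add, map_add, c.map_smul, hc, map_sum, map_sum, q.map_smulₛₗ, hqb,
    smul_zero, map_zero, zero_add]
  have hc0 : c (∑ i : Fin n, d i • ⟨x i, hx i i.2⟩) = 0 := by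
    rw [map_sum]
    exact Finset.sum_eq_zero fun i _ => by rw [map_smul, hcx i i.2, smul_zero]
  have ha : a • (1 : B ⧸ I) = Ideal.Quotient.mk I a := congrArg (Ideal.Quotient.mk I) (mul_one a)
  rw [hc0, add_zero, ha, ht', map_add, hφ₀, add_comm, map_sum]
  congr 1
  refine Finset.sum_congr rfl fun i _ => ?_
  rw [map_mul, hφ₀, q.map_smulₛₗ, map_smul, Algebra.smul_def]
  congr 1
  rw [hφ, h₂ i _ (hy i), he]

end BlowupChart

/-! ### Regular sequences under localization, and their existence near every point of X -/

section

theorem partialIdeal_map {B B' : Type*} [CommRing B] [CommRing B'] (σ : B →+* B') (b : B) (x : ℕ → B)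
    (k : ℕ) : (partialIdeal b x k).map σ = partialIdeal (σ b) (σ ∘ x) k := by
  rw [partialIdeal, partialIdeal, Ideal.map_sup, Ideal.map_span, Ideal.map_span,
    Set.image_singleton, Set.image_comp]

/-- Denominators are cleared: after multiplication by powers of r, a membership over the
localization comes from one over B, where regularity applies. -/
theorem IsRegularModulo.map {B B' : Type u} [CommRing B] [CommRing B'] {σ : B →+* B'} {r : B}
    (hσ : IsAwayRingHom σ r) {b : B} {x : ℕ → B} {n : ℕ} (h : IsRegularModulo b x n) :
    IsRegularModulo (σ b) (σ ∘ x) n := by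
  refine ⟨hσ.map_nonZeroDivisors h.nzd, fun k hk c hc => ?_⟩
  rw [← partialIdeal_map] at hc ⊢
  obtain ⟨m, a, ha⟩ := hσ.surj c
  obtain ⟨N, y, hy, e⟩ := hσ.mem_map hc
  obtain ⟨M, hM⟩ := hσ.inj (x := r ^ m * y - r ^ N * (a * x k)) (by
    rw [map_sub, map_mul, e, map_mul, map_mul, ha, map_pow, map_pow, Function.comp_apply]
    ring)
  have h1 : (r ^ M * r ^ N * a) * x k ∈ partialIdeal b x k := by
    have : (r ^ M * r ^ N * a) * x k = r ^ M * (r ^ m * y) := by linear_combination -hM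
    rw [this]
    exact Ideal.mul_mem_left _ _ (Ideal.mul_mem_left _ _ hy)
  have h2 := Ideal.mem_map_of_mem σ (h.reg k hk _ h1)
  rw [map_mul, map_mul, ha, map_pow, map_pow, ← mul_assoc] at h2
  exact (Ideal.unit_mul_mem_iff_mem _
    (((hσ.isUnit.pow M).mul (hσ.isUnit.pow N)).mul (hσ.isUnit.pow m))).mp h2

open RingTheory.Sequence in
-- Any lifts to B of a weakly regular sequence on B/(b) will do. As ker π = (b), the ideal of b and
-- the first k lifts is the preimage of the ideal of the first k terms.
theorem IsRegularModulo.of_isWeaklyRegular {B S : Type*} [CommRing B] [CommRing S] {π : B →+* S}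
    (hπ : Function.Surjective π) {b : B} (hb : b ∈ nonZeroDivisors B)
    (hker : RingHom.ker π = Ideal.span {b}) {rs : List S} (hrs : IsWeaklyRegular S rs) :
    ∃ x : ℕ → B, IsRegularModulo b x rs.length ∧
      partialIdeal b x rs.length = (Ideal.ofList rs).comap π := by
  have : ∀ k, ∃ y : B, ∀ h : k < rs.length, π y = rs[k] := fun k => by
    by_cases h : k < rs.length
    · obtain ⟨y, hy⟩ := hπ rs[k]
      exact ⟨y, fun _ => hy⟩
    · exact ⟨0, fun h' => absurd h' h⟩
  choose x hx using this
  have hb0 : π b = 0 := by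
    rw [← RingHom.mem_ker, hker]; exact Ideal.mem_span_singleton_self b
  have key : ∀ k ≤ rs.length, partialIdeal b x k = (Ideal.ofList (rs.take k)).comap π := by
    intro k hk
    apply le_antisymm
    · rw [partialIdeal_le_iff]
      refine ⟨?_, fun i hi => ?_⟩
      · rw [Ideal.mem_comap, hb0]; exact zero_mem _
      · rw [Ideal.mem_comap, hx i (hi.trans_le hk)]
        refine Ideal.subset_span ?_
        exact List.mem_take_iff_getElem.mpr ⟨i, by omega, rfl⟩
    · intro c hc
      have h1 : Ideal.ofList (rs.take k) ≤ (partialIdeal b x k).map π := by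
        refine Ideal.span_le.mpr fun s hs => ?_
        obtain ⟨i, hi, rfl⟩ := List.mem_take_iff_getElem.mp hs
        rw [← hx i (by omega)]
        exact Ideal.mem_map_of_mem π (mem_partialIdeal_of_lt b x (by omega))
      obtain ⟨y, hy, e⟩ := (Ideal.mem_map_iff_of_surjective π hπ).mp (h1 hc)
      have h2 : c - y ∈ partialIdeal b x k := by
        refine Ideal.mem_sup_left ?_
        rw [← hker, RingHom.mem_ker, map_sub, e, sub_self]
      simpa using add_mem h2 hy
  refine ⟨x, ⟨hb, fun k hk c hc => ?_⟩, by rw [key _ le_rfl, List.take_length]⟩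
  rw [key k hk.le, Ideal.mem_comap] at hc ⊢
  have := hrs.regular_mod_prev k hk
  rw [map_mul, hx k hk] at hc
  have h1 := (isSMulRegular_quotient_iff_mem_of_smul_mem _ _).mp this (π c) (by
    rw [smul_eq_mul, Ideal.mul_top, smul_eq_mul, mul_comm]; exact hc)
  rwa [smul_eq_mul, Ideal.mul_top] at h1

end

namespace AlgebraicGeometry.Scheme
variable {X : Scheme.{u}}

/-- The relation U ≤ V on this site means that U is a basic open subset of V, not merely contained
in it. Every restriction along it is thus a localization. -/
theorem AffineZariskiSite.exists_isAwayRingHom {U V : X.AffineZariskiSite} (h : U ≤ V) :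
    ∃ f : Γ(X, V.aff), X.basicOpen f = U.aff.1 ∧
      IsAwayRingHom (resHom (AffineZariskiSite.le h)) f := by
  obtain ⟨f, hf⟩ := h
  exact ⟨f, hf, isAwayRingHom_resHom V.isAffineOpen.isCompact V.isAffineOpen.isQuasiSeparated f hf⟩

namespace IdealSheafData

/-- Over the affine open `U`, the ideal of `D` is generated by a nonzerodivisor and the one of `Z` by
this element and a regular sequence on `D`. -/
def IsRegularOn (I J : X.IdealSheafData) (U : X.AffineZariskiSite) : Prop :=
  ∃ (b : Γ(X, U.aff)) (x : ℕ → Γ(X, U.aff)) (n : ℕ), IsRegularModulo b x n ∧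
    J.ideal U.aff = Ideal.span {b} ∧ I.ideal U.aff = partialIdeal b x n

theorem IsRegularOn.mono {I J : X.IdealSheafData} {U V : X.AffineZariskiSite} (h : U ≤ V)
    (hV : IsRegularOn I J V) : IsRegularOn I J U := by
  obtain ⟨f, -, hf⟩ := AffineZariskiSite.exists_isAwayRingHom h
  obtain ⟨b, x, n, hr, hJ, hI⟩ := hV
  refine ⟨_, _, n, hr.map hf, ?_, ?_⟩
  · rw [← J.map_resHom (AffineZariskiSite.aff_mono h), hJ, Ideal.map_span, Set.image_singleton]
  · rw [← I.map_resHom (AffineZariskiSite.aff_mono h), hI, partialIdeal_map]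

/-- Away from Z the ideal I contains a unit locally. The unit ideal is generated by b and the
one-term sequence 1, which counts as weakly regular since no properness is demanded. Hence X itself,
and not only Z, is covered by the good affine opens. -/
theorem exists_isRegularOn_of_notMem {I J : X.IdealSheafData} (hJ : J.IsEffectiveCartier) {x : X}
    (hx : x ∉ I.support) : ∃ U : X.AffineZariskiSite, x ∈ U.aff.1 ∧ IsRegularOn I J U := by
  obtain ⟨U, hU, b, hb, e⟩ := hJ x
  rw [mem_support_iff_of_mem hU, mem_zeroLocus_iff] at hx
  push Not at hx
  obtain ⟨f, hf, hxf⟩ := hx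
  let V : X.AffineZariskiSite := AffineZariskiSite.basicOpen (X := X) U f
  have hVU : V.aff ≤ U := X.affineBasicOpen_le f
  have haw : IsAwayRingHom (resHom hVU) f := isAway_affineBasicOpen U f
  have hI : I.ideal V.aff = ⊤ := by
    rw [← I.map_resHom hVU]
    exact Ideal.eq_top_of_isUnit_mem _ (Ideal.mem_map_of_mem _ hf) haw.isUnit
  refine ⟨V, hxf, resHom hVU b, fun _ => 1, 1, ⟨haw.map_nonZeroDivisors hb, fun k _ c hc => ?_⟩, ?_, ?_⟩
  · rwa [mul_one] at hc
  · rw [← J.map_resHom hVU, e, Ideal.map_span, Set.image_singleton]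
  · rw [hI, eq_comm, Ideal.eq_top_iff_one]
    exact mem_partialIdeal_of_lt _ (fun _ => 1) one_pos

/-- Both sides are the kernel of the map to functions on Z, because Z → X factors through D. This
transfers the ideal of Z in D to the ideal of Z in X. -/
theorem ker_subschemeι_app_eq_comap {I J : X.IdealSheafData} (h : J ≤ I) (U : X.affineOpens)
    (hU : IsAffineOpen (J.subschemeι ⁻¹ᵁ U.1)) :
    ((inclusion h).ker.ideal ⟨_, hU⟩).comap (J.subschemeι.app U).hom = I.ideal U := by
  have : QuasiCompact (inclusion h ≫ J.subschemeι) := by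
    rw [inclusion_subschemeι]; infer_instance
  have : QuasiCompact (inclusion h) := .of_comp _ J.subschemeι
  rw [Hom.ker_apply, RingHom.comap_ker, ← CommRingCat.hom_comp]
  have h1 : (inclusion h ≫ J.subschemeι).ker = I := by
    rw [inclusion_subschemeι, ker_subschemeι]
  have h2 := Hom.ker_apply (inclusion h ≫ J.subschemeι) U
  rw [h1, Hom.comp_app] at h2
  exact h2.symm

/-- The regular sequence lives on an affine open of D, and the equation of D on an affine open of X.
A common basic open of D is cut out by a function that lifts to X; over the corresponding basic open
of X both data restrict, and the sequence lifts. -/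
theorem exists_isRegularOn {I J : X.IdealSheafData} {h : J ≤ I} (hJ : J.IsEffectiveCartier)
    (hZ : IsRegularClosedImmersion (inclusion h)) (x : X) :
    ∃ U : X.AffineZariskiSite, x ∈ U.aff.1 ∧ IsRegularOn I J U := by
  by_cases hx : x ∈ I.support
  swap
  · exact exists_isRegularOn_of_notMem hJ hx
  obtain ⟨z, rfl⟩ : x ∈ Set.range I.subschemeι := by rwa [range_subschemeι]
  obtain ⟨U₀, hU₀, b, hb, e⟩ := hJ (I.subschemeι z)
  obtain ⟨U, hU, rs, hrs, hI⟩ := hZ.2 z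
  have hz : J.subschemeι (inclusion h z) = I.subschemeι z := by
    rw [← Hom.comp_apply, inclusion_subschemeι]
  have hD (V : X.affineOpens) : IsAffineOpen (J.subschemeι ⁻¹ᵁ V.1) := V.2.preimage _
  obtain ⟨f, g, hfg, hzf⟩ := exists_basicOpen_le_affine_inter U.2 (hD U₀) (inclusion h z)
    ⟨hU, by rw [← hz] at hU₀; exact hU₀⟩
  -- Functions on D ∩ U₀ extend to U₀, so the basic open of D is the trace of a basic open of X.
  obtain ⟨g, rfl⟩ := J.subschemeι_app_surjective U₀ g
  let V : X.AffineZariskiSite := AffineZariskiSite.basicOpen (X := X) U₀ g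
  have hVU : V.aff ≤ U₀ := X.affineBasicOpen_le g
  have haw : IsAwayRingHom (resHom hVU) g := isAway_affineBasicOpen U₀ g
  have hV : J.subschemeι ⁻¹ᵁ V.aff.1 = J.subscheme.basicOpen f :=
    (J.subschemeι.preimage_basicOpen g).trans hfg.symm
  let W : J.subscheme.affineOpens := ⟨J.subschemeι ⁻¹ᵁ V.aff.1, hD V.aff⟩
  have hWU : W ≤ U := hV.trans_le (J.subscheme.basicOpen_le f)
  have haf : IsAwayRingHom (resHom hWU) f :=
    isAwayRingHom_resHom U.2.isCompact U.2.isQuasiSeparated f hV.symm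
  have hreg : RingTheory.Sequence.IsWeaklyRegular Γ(J.subscheme, W.1) (rs.map (resHom hWU)) := by
    letI := (resHom hWU).toAlgebra
    haveI : IsLocalization.Away f Γ(J.subscheme, W.1) := haf
    exact hrs.1.of_isLocalization _ (Submonoid.powers f)
  have hJV : J.ideal V.aff = Ideal.span {resHom hVU b} := by
    rw [← J.map_resHom hVU, e, Ideal.map_span, Set.image_singleton]
  obtain ⟨x, hx, hx'⟩ := IsRegularModulo.of_isWeaklyRegular (J.subschemeι_app_surjective V.aff)
    (haw.map_nonZeroDivisors hb) ((J.ker_subschemeι_app V.aff).trans hJV) hreg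
  refine ⟨V, ?_, _, x, _, hx, hJV, ?_⟩
  · rw [← hz]
    have : inclusion h z ∈ J.subschemeι ⁻¹ᵁ V.aff.1 := by rw [hV]; exact hzf
    exact this
  · rw [hx', ← Ideal.map_ofList, ← hI, IdealSheafData.map_resHom]
    exact (ker_subschemeι_app_eq_comap h V.aff _).symm

theorem exists_basicOpen_isRegularOn {I J : X.IdealSheafData} {h : J ≤ I}
    (hJ : J.IsEffectiveCartier) (hZ : IsRegularClosedImmersion (inclusion h))
    (U : X.AffineZariskiSite) {x : X} (hx : x ∈ U.aff.1) :
    ∃ V ≤ U, x ∈ V.aff.1 ∧ IsRegularOn I J V := by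
  obtain ⟨V, hV, hreg⟩ := exists_isRegularOn hJ hZ x
  obtain ⟨f, g, hfg, hxf⟩ := exists_basicOpen_le_affine_inter U.isAffineOpen V.isAffineOpen x ⟨hx, hV⟩
  refine ⟨U.basicOpen f, U.basicOpen_le f, hxf, ?_⟩
  have : U.basicOpen f = V.basicOpen g := Subtype.ext hfg
  rw [this]
  exact hreg.mono (V.basicOpen_le g)

end IdealSheafData
end AlgebraicGeometry.Scheme

/-! ### Quasi-coherent modules as Zariski sheaves -/

namespace AlgebraicGeometry.Scheme
variable {X : Scheme.{u}}

/-- This replaces intersections of affine opens: common points have arbitrarily small neighbourhoods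
that are basic in both. -/
theorem AffineZariskiSite.exists_le_le {U V : X.AffineZariskiSite} {x : X} (hU : x ∈ U.aff.1)
    (hV : x ∈ V.aff.1) : ∃ W ≤ U, W ≤ V ∧ x ∈ W.aff.1 := by
  obtain ⟨f, g, hfg, hxf⟩ := exists_basicOpen_le_affine_inter U.isAffineOpen V.isAffineOpen x ⟨hU, hV⟩
  exact ⟨U.basicOpen f, U.basicOpen_le f, ⟨g, hfg.symm⟩, hxf⟩

namespace IdealSheafData
variable {I : X.IdealSheafData}

/-- Modules on Z are indexed by affine opens of X, which may contain points off Z. Around such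
points the ring of functions on Z is zero and all sections agree, so they never obstruct equality or
gluing. -/
theorem exists_basicOpen_ideal_eq_top (U : X.AffineZariskiSite) {x : X} (hxU : x ∈ U.aff.1)
    (hx : x ∉ I.support) : ∃ V ≤ U, x ∈ V.aff.1 ∧ I.ideal V.aff = ⊤ := by
  rw [mem_support_iff_of_mem hxU, mem_zeroLocus_iff] at hx
  push Not at hx
  obtain ⟨f, hf, hxf⟩ := hx
  have hVU := X.affineBasicOpen_le (V := U.aff) f
  refine ⟨U.basicOpen f, U.basicOpen_le f, hxf, ?_⟩
  change I.ideal (X.affineBasicOpen (U := U.aff) f) = ⊤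
  rw [← I.map_resHom hVU]
  exact Ideal.eq_top_of_isUnit_mem _ (Ideal.mem_map_of_mem _ hf) (isAway_affineBasicOpen U.aff f).isUnit

theorem ideal_eq_top_mono {U V : X.AffineZariskiSite} (h : U ≤ V) (hV : I.ideal V.aff = ⊤) :
    I.ideal U.aff = ⊤ := by
  rw [← I.map_resHom (AffineZariskiSite.aff_mono h), hV, Ideal.map_top]

namespace ModulePresheaf

variable {M : I.ModulePresheaf}

theorem subsingleton_obj (M : I.ModulePresheaf) {U : X.AffineZariskiSite}
    (hU : I.ideal U.aff = ⊤) : Subsingleton (M.obj U) := by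
  have : Subsingleton (I.quot U) := Ideal.Quotient.subsingleton_iff.mpr hU
  exact Module.subsingleton (I.quot U) _

theorem IsQuasicoherent.exists_smul_eq_zero (hM : M.IsQuasicoherent) {U V : X.AffineZariskiSite}
    {f : Γ(X, V.aff)} (hf : X.basicOpen f = U.aff.1) (h : U ≤ V) {m : M.obj V}
    (hm : M.res h m = 0) : ∃ n : ℕ, Ideal.Quotient.mk (I.ideal V.aff) f ^ n • m = 0 := by
  obtain rfl : V.basicOpen f = U := Subtype.ext hf
  exact (hM V f).2 m hm

/-- The radical of the annihilator of m contains s, hence is the unit ideal, and then so is the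
annihilator. -/
theorem eq_zero_of_span_eq_top {R N : Type*} [CommRing R] [AddCommGroup N] [Module R N] {s : Set R}
    (hs : Ideal.span s = ⊤) {m : N} (h : ∀ f ∈ s, ∃ n : ℕ, f ^ n • m = 0) : m = 0 := by
  have h1 : Ideal.span s ≤ Ideal.radical (LinearMap.ker (LinearMap.toSpanSingleton R N m)) := by
    rw [Ideal.span_le]
    intro f hf
    obtain ⟨n, hn⟩ := h f hf
    exact ⟨n, hn⟩
  rw [hs, top_le_iff, Ideal.radical_eq_top, Ideal.eq_top_iff_one] at h1
  simpa using h1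

theorem span_mk_eq_top {U : X.AffineZariskiSite} {s : Set Γ(X, U.aff)}
    (hs : ∀ x ∈ U.aff.1, ∃ f ∈ s, x ∈ X.basicOpen f) :
    Ideal.span (Ideal.Quotient.mk (I.ideal U.aff) '' s) = ⊤ := by
  have : Ideal.span s = ⊤ := by
    rw [← U.aff.2.self_le_iSup_basicOpen_iff]
    intro x hx
    obtain ⟨f, hf, hxf⟩ := hs x hx
    exact Opens.mem_iSup.mpr ⟨⟨f, hf⟩, hxf⟩
  rw [← Ideal.map_span, this, Ideal.map_top]

/-- Sections of a quasi-coherent module which agree locally are equal. -/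
theorem IsQuasicoherent.eq_of_res_eq (hM : M.IsQuasicoherent) {U : X.AffineZariskiSite}
    {m m' : M.obj U} (h : ∀ x ∈ U.aff.1, ∃ (V : _) (hV : V ≤ U), x ∈ V.aff.1 ∧
      M.res hV m = M.res hV m') : m = m' := by
  rw [← sub_eq_zero]
  refine eq_zero_of_span_eq_top (s := Ideal.Quotient.mk (I.ideal U.aff) ''
    {f | ∃ n : ℕ, Ideal.Quotient.mk (I.ideal U.aff) f ^ n • (m - m') = 0})
    (span_mk_eq_top fun x hx => ?_) ?_
  · obtain ⟨V, hV, hxV, e⟩ := h x hx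
    obtain ⟨f, hf⟩ := id hV
    refine ⟨f, hM.exists_smul_eq_zero hf hV ?_, ?_⟩
    · rw [map_sub, e, sub_self]
    · exact (show V.aff.1 ≤ X.basicOpen f from hf.ge) hxV
  · rintro _ ⟨f, hf, rfl⟩
    exact hf

/-- The x_i stand for numerators of local sections x_i / f_i ^ n. After multiplication by f_i ^ K
for one large K they are compatible on the nose, and a partition of unity Σ a_i f_i ^ (n + K) = 1
glues them to Σ a_i f_i ^ K x_i. -/
theorem exists_glue_of_span_eq_top {R N ι : Type*} [CommRing R] [AddCommGroup N] [Module R N]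
    (t : Finset ι) (f : ι → R) (ht : Ideal.span (f '' t) = ⊤) (x : ι → N) (n : ℕ)
    (h : ∀ i ∈ t, ∀ j ∈ t, ∃ k : ℕ, (f i * f j) ^ k • (f j ^ n • x i - f i ^ n • x j) = 0) :
    ∃ (m : N) (l : ℕ), ∀ i ∈ t, f i ^ (n + l) • m = f i ^ l • x i := by
  choose! k hk using h
  let K := ∑ i ∈ t, ∑ j ∈ t, k i j
  have hK : ∀ i ∈ t, ∀ j ∈ t, f j ^ (n + K) • f i ^ K • x i = f i ^ (n + K) • f j ^ K • x j := by
    intro i hi j hj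
    have hle : k i j ≤ K :=
      (Finset.single_le_sum (f := fun j => k i j) (fun _ _ => Nat.zero_le _) hj).trans
        (Finset.single_le_sum (f := fun i => ∑ j ∈ t, k i j) (fun _ _ => Nat.zero_le _) hi)
    have h1 : (f i * f j) ^ K • (f j ^ n • x i - f i ^ n • x j) = 0 := by
      rw [← Nat.sub_add_cancel hle, pow_add, mul_smul, hk i hi j hj, smul_zero]
    rw [smul_sub, sub_eq_zero, smul_smul, smul_smul] at h1
    rw [smul_smul, smul_smul]
    convert h1 using 2 <;> ring
  have hspan : Ideal.span (f '' t) ≤ (Ideal.span ((fun i => f i ^ (n + K)) '' t)).radical := by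
    rw [Ideal.span_le]
    rintro _ ⟨i, hi, rfl⟩
    exact ⟨n + K, Ideal.subset_span ⟨i, hi, rfl⟩⟩
  rw [ht, top_le_iff, Ideal.radical_eq_top, Ideal.eq_top_iff_one] at hspan
  obtain ⟨a, ha⟩ := (Submodule.mem_span_image_finset_iff_exists_fun (R := R)).mp hspan
  refine ⟨∑ i : t, a i • f i ^ K • x i, K, fun j hj => ?_⟩
  calc f j ^ (n + K) • ∑ i : t, a i • f i ^ K • x i
      = ∑ i : t, (a i • f i ^ (n + K)) • f j ^ K • x j := by
        rw [Finset.smul_sum]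
        refine Finset.sum_congr rfl fun i _ => ?_
        rw [smul_comm, hK i i.2 j hj, smul_assoc]
    _ = f j ^ K • x j := by rw [← Finset.sum_smul, ha, one_smul]

/-- Compatible sections of a quasi-coherent module over a covering sieve glue. -/
theorem IsQuasicoherent.exists_glue (hM : M.IsQuasicoherent) {U : X.AffineZariskiSite}
    {S : Set X.AffineZariskiSite} (hS : ∀ V ∈ S, ∀ W ≤ V, W ∈ S)
    (hU : ∀ x ∈ U.aff.1, ∃ V ≤ U, V ∈ S ∧ x ∈ V.aff.1) (m : ∀ V ∈ S, M.obj V)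
    (hm : ∀ V (hV : V ∈ S) W (h : W ≤ V), M.res h (m V hV) = m W (hS V hV W h)) :
    ∃ m' : M.obj U, ∀ V (hV : V ∈ S) (h : V ≤ U), M.res h m' = m V hV := by
  classical
  let mk := Ideal.Quotient.mk (I.ideal U.aff)
  let s : Set Γ(X, U.aff) := {f | U.basicOpen f ∈ S}
  have hs : Ideal.span s = ⊤ := by
    rw [← U.aff.2.self_le_iSup_basicOpen_iff]
    intro x hx
    obtain ⟨V, hV, hVS, hxV⟩ := hU x hx
    obtain ⟨f, hf⟩ := id hV
    -- Members of S below U are basic opens of U, so they are recorded by elements of the ring;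
    -- finitely many of these already generate the unit ideal.
    obtain rfl : U.basicOpen f = V := Subtype.ext hf
    exact Opens.mem_iSup.mpr ⟨⟨f, hVS⟩, hxV⟩
  obtain ⟨t, hts, ht⟩ := (Ideal.span_eq_top_iff_finite s).mp hs
  have h1 : ∀ f : Γ(X, U.aff), ∃ n : ℕ, ∀ hf : f ∈ s, ∃ x : M.obj U,
      M.res (U.basicOpen_le f) x = I.quotRes (U.basicOpen_le f) (mk f) ^ n • m _ hf := by
    intro f
    by_cases hf : f ∈ s
    · obtain ⟨n, x, e⟩ := (hM U f).1 (m _ hf)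
      exact ⟨n, fun _ => ⟨x, e⟩⟩
    · exact ⟨0, fun h => absurd h hf⟩
  choose n hn using h1
  let N := ∑ f ∈ t, n f
  have h2 : ∀ f : Γ(X, U.aff), ∃ x : M.obj U, ∀ hf : f ∈ t,
      M.res (U.basicOpen_le f) x = I.quotRes (U.basicOpen_le f) (mk f) ^ N • m _ (hts hf) := by
    intro f
    by_cases hf : f ∈ t
    · obtain ⟨x, e⟩ := hn f (hts hf)
      have hle : n f ≤ N := Finset.single_le_sum (f := n) (fun _ _ => Nat.zero_le _) hf
      refine ⟨mk f ^ (N - n f) • x, fun _ => ?_⟩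
      rw [(M.res _).map_smulₛₗ, e, smul_smul, map_pow, ← pow_add, Nat.sub_add_cancel hle]
    · exact ⟨0, fun h => absurd h hf⟩
  choose x hx using h2
  obtain ⟨m', l, hm'⟩ := exists_glue_of_span_eq_top t mk (by
    rw [← Ideal.map_span, ht, Ideal.map_top]) x N (by
    intro f hf g hg
    rw [← map_mul]
    have hW := U.basicOpen_le (f * g)
    have hWf : U.basicOpen (f * g) ≤ U.basicOpen f :=
      ⟨resHom (X.basicOpen_le f) g, (X.basicOpen_res _ _).trans (X.basicOpen_mul _ _).symm⟩
    have hWg : U.basicOpen (f * g) ≤ U.basicOpen g := by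
      rw [mul_comm]
      exact ⟨resHom (X.basicOpen_le g) f, (X.basicOpen_res _ _).trans (X.basicOpen_mul _ _).symm⟩
    refine (hM U (f * g)).2 _ ?_
    rw [map_sub, (M.res _).map_smulₛₗ, (M.res _).map_smulₛₗ, ← M.res_res hWf (U.basicOpen_le f),
      hx f hf, ← M.res_res hWg (U.basicOpen_le g), hx g hg, (M.res _).map_smulₛₗ,
      (M.res _).map_smulₛₗ, hm, hm, map_pow, map_pow, map_pow, map_pow, quotRes_quotRes,
      quotRes_quotRes, smul_smul, smul_smul, mul_comm (I.quotRes _ (mk g) ^ N), sub_self])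
  -- On D(f) the powers of f are units and cancel from the equation defining m'.
  have hkey : ∀ f (hf : f ∈ t), M.res (U.basicOpen_le f) m' = m _ (hts hf) := by
    intro f hf
    have e := congrArg (M.res (U.basicOpen_le f)) (hm' f hf)
    rw [(M.res _).map_smulₛₗ, (M.res _).map_smulₛₗ, hx f hf, smul_smul, map_pow, map_pow, ← pow_add,
      add_comm l] at e
    exact (((I.isAwayRingHom_quotRes U f).isUnit.pow _).smul_left_cancel).mp e
  -- For the other members of S, equality is checked on common basic neighbourhoods with the
  -- finitely many D(f).
  refine ⟨m', fun V hV h => hM.eq_of_res_eq fun y hy => ?_⟩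
  have hyt : ∃ f ∈ t, y ∈ X.basicOpen f := by
    have := (U.aff.2.self_le_iSup_basicOpen_iff (s := (t : Set Γ(X, U.aff)))).mpr ht
    obtain ⟨⟨f, hf⟩, hy'⟩ := Opens.mem_iSup.mp (this (AffineZariskiSite.le h hy))
    exact ⟨f, hf, hy'⟩
  obtain ⟨f, hf, hyf⟩ := hyt
  obtain ⟨W, hWV, hWf, hyW⟩ := AffineZariskiSite.exists_le_le (U := V) (V := U.basicOpen f) hy hyf
  refine ⟨W, hWV, hyW, ?_⟩
  rw [M.res_res, hm, ← M.res_res hWf (U.basicOpen_le f), hkey f hf, hm]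

/-- Sections of `M` over affine opens are determined locally, and compatible sections over a covering
sieve of an affine open glue. -/
structure IsZariskiSheaf (M : I.ModulePresheaf) : Prop where
  eq_of_res_eq : ∀ {U : X.AffineZariskiSite} (m m' : M.obj U), (∀ x ∈ U.aff.1, ∃ (V : _)
    (hV : V ≤ U), x ∈ V.aff.1 ∧ M.res hV m = M.res hV m') → m = m'
  exists_glue : ∀ {U : X.AffineZariskiSite} {S : Set X.AffineZariskiSite}
    (hS : ∀ V ∈ S, ∀ W ≤ V, W ∈ S) (_ : ∀ x ∈ U.aff.1, ∃ V ≤ U, V ∈ S ∧ x ∈ V.aff.1)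
    (m : ∀ V ∈ S, M.obj V)
    (_ : ∀ V (hV : V ∈ S) W (h : W ≤ V), M.res h (m V hV) = m W (hS V hV W h)),
    ∃ m' : M.obj U, ∀ V (hV : V ∈ S) (h : V ≤ U), M.res h m' = m V hV

theorem IsQuasicoherent.isZariskiSheaf (hM : M.IsQuasicoherent) : M.IsZariskiSheaf :=
  ⟨fun _ _ => hM.eq_of_res_eq, hM.exists_glue⟩

/-- Near a point of Z the families are compared on a common basic open with one where they agree;
near any other point the module vanishes. -/
theorem sections_ext (hM : M.IsZariskiSheaf) {V : I.subscheme.Opens} {s s' : M.sections V}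
    (h : ∀ z ∈ V, ∃ (U : X.AffineZariskiSite) (hU : I.subschemeι ⁻¹ᵁ U.aff.1 ≤ V),
      I.subschemeι z ∈ U.aff.1 ∧ s.1 ⟨U, hU⟩ = s'.1 ⟨U, hU⟩) : s = s' := by
  apply Subtype.ext
  funext ⟨U, hU⟩
  refine hM.eq_of_res_eq _ _ fun x hx => ?_
  by_cases hxI : x ∈ I.support
  · obtain ⟨z, rfl⟩ : x ∈ Set.range I.subschemeι := by rwa [range_subschemeι]
    obtain ⟨W, hW, hzW, e⟩ := h z (hU hx)
    obtain ⟨W', hWU, hWW, hzW'⟩ := AffineZariskiSite.exists_le_le hx hzW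
    refine ⟨W', hWU, hzW', ?_⟩
    have h1 (s : M.sections V) : M.res hWU (s.1 ⟨U, hU⟩) = M.res hWW (s.1 ⟨W, hW⟩) :=
      (s.2 ⟨W', le_trans (fun _ h => AffineZariskiSite.le hWU h) hU⟩ ⟨U, hU⟩ hWU).trans
        (s.2 ⟨W', le_trans (fun _ h => AffineZariskiSite.le hWU h) hU⟩ ⟨W, hW⟩ hWW).symm
    rw [h1, h1, e]
  · obtain ⟨W, hWU, hxW, hW⟩ := exists_basicOpen_ideal_eq_top U hx hxI
    have := M.subsingleton_obj hW
    exact ⟨W, hWU, hxW, Subsingleton.elim _ _⟩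

/-- A compatible family of sections of a Zariski sheaf over a basis of an open subset `V` of
`Z` extends to a section over `V`. -/
theorem exists_sections (hM : M.IsZariskiSheaf) {V : I.subscheme.Opens}
    {T : Set X.AffineZariskiSite} (hT : ∀ U ∈ T, ∀ W ≤ U, W ∈ T)
    (hV : ∀ z ∈ V, ∃ U ∈ T, I.subschemeι z ∈ U.aff.1) (m : ∀ U ∈ T, M.obj U)
    (hm : ∀ U (hU : U ∈ T) W (h : W ≤ U), M.res h (m U hU) = m W (hT U hU W h)) :
    ∃ s : M.sections V, ∀ U (hU : U ∈ T) (h : I.subschemeι ⁻¹ᵁ U.aff.1 ≤ V),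
      s.1 ⟨U, h⟩ = m U hU := by
  classical
  -- T only covers points of Z. Adding the opens that miss Z, with the section 0 there, gives a
  -- covering of every affine open whose trace on Z lies in V.
  let S : Set X.AffineZariskiSite := {U | U ∈ T ∨ I.ideal U.aff = ⊤}
  have hS : ∀ U ∈ S, ∀ W ≤ U, W ∈ S := by
    rintro U (hU | hU) W h
    · exact Or.inl (hT U hU W h)
    · exact Or.inr (ideal_eq_top_mono h hU)
  let m' : ∀ U ∈ S, M.obj U := fun U _ => if h : U ∈ T then m U h else 0
  have hm' : ∀ U (hU : U ∈ S) W (h : W ≤ U), M.res h (m' U hU) = m' W (hS U hU W h) := by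
    intro U hU W h
    by_cases hUT : U ∈ T
    · simp only [m', dif_pos hUT, dif_pos (hT U hUT W h)]
      exact hm U hUT W h
    · have := M.subsingleton_obj (ideal_eq_top_mono h (hU.resolve_left hUT))
      exact Subsingleton.elim _ _
  have hex : ∀ U : {U : X.AffineZariskiSite // I.subschemeι ⁻¹ᵁ U.aff.1 ≤ V}, ∃ y : M.obj U.1,
      ∀ W (hW : W ∈ S) (h : W ≤ U.1), M.res h y = m' W hW := by
    rintro ⟨U, hU⟩
    refine hM.exists_glue hS (fun x hx => ?_) m' hm'
    by_cases hxI : x ∈ I.support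
    · obtain ⟨z, rfl⟩ : x ∈ Set.range I.subschemeι := by rwa [range_subschemeι]
      obtain ⟨W, hW, hzW⟩ := hV z (hU hx)
      obtain ⟨W', hWU, hWW, hzW'⟩ := AffineZariskiSite.exists_le_le hx hzW
      exact ⟨W', hWU, Or.inl (hT W hW W' hWW), hzW'⟩
    · obtain ⟨W, hWU, hxW, hW⟩ := exists_basicOpen_ideal_eq_top U hx hxI
      exact ⟨W, hWU, Or.inr hW, hxW⟩
  choose y hy using hex
  refine ⟨⟨y, fun U U' h => hM.eq_of_res_eq _ _ fun x hx => ?_⟩, fun U hU h => ?_⟩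
  · obtain ⟨W, hWU, hxW, hW⟩ : ∃ W ≤ U.1, x ∈ W.aff.1 ∧ W ∈ S := by
      by_cases hxI : x ∈ I.support
      · obtain ⟨z, rfl⟩ : x ∈ Set.range I.subschemeι := by rwa [range_subschemeι]
        obtain ⟨W, hW, hzW⟩ := hV z (U.2 hx)
        obtain ⟨W', hWU, hWW, hzW'⟩ := AffineZariskiSite.exists_le_le hx hzW
        exact ⟨W', hWU, hzW', Or.inl (hT W hW W' hWW)⟩
      · obtain ⟨W, hWU, hxW, hW⟩ := exists_basicOpen_ideal_eq_top U.1 hx hxI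
        exact ⟨W, hWU, hxW, Or.inr hW⟩
    refine ⟨W, hWU, hxW, ?_⟩
    rw [M.res_res, hy U' W hW, hy U W hW]
  · have := hy ⟨U, h⟩ U (Or.inl hU) le_rfl
    rw [M.res_self] at this
    exact this.trans (dif_pos hU)

end ModulePresheaf
end IdealSheafData
end AlgebraicGeometry.Scheme

/-! ### Gluing isomorphisms over Z, and charts of relative spectra -/

namespace AlgebraicGeometry.Scheme

/-- A family of open immersions that is jointly surjective, as an open cover. -/
def openCoverOfJointlySurjective {X : Scheme.{u}} {ι : Type*} {P : ι → Scheme.{u}}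
    (a : ∀ i, P i ⟶ X) [∀ i, IsOpenImmersion (a i)] (h : ∀ x, ∃ i y, a i y = x) : X.OpenCover where
  I₀ := ι
  X := P
  f := a
  mem₀ := by
    rw [presieve₀_mem_precoverage_iff]
    exact ⟨h, fun _ => inferInstance⟩

section Glue

variable {Z E F : Scheme.{u}} {ι : Type*} {P Q : ι → Scheme.{u}} {a : ∀ i, P i ⟶ E}
  {b : ∀ i, P i ⟶ F} {π : ∀ i, P i ⟶ Q i} {p : E ⟶ Z} {p' : F ⟶ Z} {q : ∀ i, Q i ⟶ Z}

theorem exists_chart_of_isPullback (ha : ∀ i, IsPullback (a i) (π i) p (q i)) {i : ι} {x : E} {y : Q i}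
    (h : q i y = p x) : ∃ w, a i w = x := by
  obtain ⟨w, hw, -⟩ := exists_preimage_of_isPullback (ha i) x y h.symm
  exact ⟨w, hw⟩

/-- Schemes over `Z` with compatible isomorphisms over the members of a cover of `Z` are
isomorphic. -/
theorem exists_iso_of_charts [∀ i, IsOpenImmersion (q i)]
    (ha : ∀ i, IsPullback (a i) (π i) p (q i)) (hb : ∀ i, IsPullback (b i) (π i) p' (q i))
    (hq : ∀ z, ∃ i y, q i y = z)
    (hab : ∀ i j y y', q i y = q j y' → ∃ (k : ι) (t : P k ⟶ P i) (t' : P k ⟶ P j) (w : Q k),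
      q k w = q i y ∧ t ≫ a i = a k ∧ t' ≫ a j = a k ∧ t ≫ b i = b k ∧ t' ≫ b j = b k) :
    ∃ e : Over.mk p ≅ Over.mk p', ∀ i, a i ≫ e.hom.left = b i := by
  have hao (i) : IsOpenImmersion (a i) := MorphismProperty.of_isPullback (ha i).flip inferInstance
  have hbo (i) : IsOpenImmersion (b i) := MorphismProperty.of_isPullback (hb i).flip inferInstance
  have hac (x) : ∃ i y, a i y = x := by
    obtain ⟨i, y, h⟩ := hq (p x)
    exact ⟨i, exists_chart_of_isPullback ha h⟩
  have hbc (x) : ∃ i y, b i y = x := by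
    obtain ⟨i, y, h⟩ := hq (p' x)
    exact ⟨i, exists_chart_of_isPullback hb h⟩
  let 𝒰 := openCoverOfJointlySurjective a hac
  let 𝒱 := openCoverOfJointlySurjective b hbc
  -- The overlap of two charts of E is covered by further charts P k mapping compatibly to both, and
  -- there the maps to F agree by assumption.
  have hov (i j : ι) : pullback.fst (a i) (a j) ≫ b i = pullback.snd (a i) (a j) ≫ b j := by
    let S := {k : Σ k, (P k ⟶ P i) × (P k ⟶ P j) // k.2.1 ≫ a i = a k.1 ∧ k.2.2 ≫ a j = a k.1 ∧
      k.2.1 ≫ b i = b k.1 ∧ k.2.2 ≫ b j = b k.1}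
    let c (k : S) : P k.1.1 ⟶ pullback (a i) (a j) :=
      pullback.lift k.1.2.1 k.1.2.2 (k.2.1.trans k.2.2.1.symm)
    let g := pullback.fst (a i) (a j) ≫ a i
    have hc (k : S) : c k ≫ g = a k.1.1 := by
      rw [pullback.lift_fst_assoc, k.2.1]
    have hco (k : S) : IsOpenImmersion (c k) := by
      have : IsOpenImmersion (c k ≫ g) := by rw [hc]; infer_instance
      exact .of_comp (c k) g
    have hcc (x) : ∃ k y, c k y = x := by
      have hx : q i (π i (pullback.fst (a i) (a j) x)) = q j (π j (pullback.snd (a i) (a j) x)) := by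
        simp only [← Hom.comp_apply, Category.assoc]
        rw [← (ha i).w, ← (ha j).w, pullback.condition_assoc]
      obtain ⟨k, t, t', w, hw, h1, h2, h3, h4⟩ := hab i j _ _ hx
      obtain ⟨y, hy⟩ := exists_chart_of_isPullback (x := g x) ha (i := k) (y := w) (by
        rw [hw]
        simp only [← Hom.comp_apply, Category.assoc, g]
        rw [← (ha i).w])
      refine ⟨⟨⟨k, t, t'⟩, h1, h2, h3, h4⟩, y, g.isOpenEmbedding.injective ?_⟩
      rw [← Hom.comp_apply, hc]
      exact hy
    refine Cover.hom_ext (openCoverOfJointlySurjective c hcc) _ _ fun k => ?_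
    change c k ≫ _ = c k ≫ _
    rw [pullback.lift_fst_assoc, pullback.lift_snd_assoc, k.2.2.2.1, k.2.2.2.2]
  let f : E ⟶ F := 𝒰.glueMorphisms b hov
  have hf (i) : a i ≫ f = b i := 𝒰.ι_glueMorphisms b hov i
  have hfp : f ≫ p' = p := by
    have hfp (i) : a i ≫ f ≫ p' = a i ≫ p := by
      rw [← Category.assoc, hf, (ha i).w, (hb i).w]
    exact Cover.hom_ext 𝒰 _ _ hfp
  -- Both P i → E and P i → F are base changes of Q i → Z, so the base change of f to the chart P i
  -- of F is the identity. Being an isomorphism is local on the target.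
  have hsq (i) : IsPullback (a i) (𝟙 _) f (b i) := by
    refine IsPullback.of_bot ?_ (by rw [hf, Category.id_comp]) (hb i)
    rw [hfp, Category.id_comp]
    exact ha i
  have hiso : IsIso f := by
    have hsnd (i) : IsIso (pullback.snd f (b i)) := by
      have h : IsIso ((hsq i).isoPullback.hom ≫ pullback.snd f (b i)) := by
        rw [(hsq i).isoPullback_hom_snd]; infer_instance
      exact IsIso.of_isIso_comp_left (hsq i).isoPullback.hom _
    exact MorphismProperty.of_zeroHypercover_target (P := .isomorphisms Scheme) 𝒱 hsnd
  exact ⟨Over.isoMk (asIso f) hfp, hf⟩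

end Glue

theorem Cover.RelativeGluingData.map_cover_f {S : Scheme.{u}} {𝒰 : S.OpenCover}
    [Category 𝒰.I₀] [𝒰.LocallyDirected] [Small.{u} 𝒰.I₀] [Quiver.IsThin 𝒰.I₀]
    (d : Cover.RelativeGluingData 𝒰) {i j : 𝒰.I₀} (t : i ⟶ j) :
    d.functor.map t ≫ d.cover.f j = d.cover.f i :=
  colimit.w d.functor t

theorem Cover.RelativeGluingData.isOpenImmersion_cover_f {S : Scheme.{u}} {𝒰 : S.OpenCover}
    [Category 𝒰.I₀] [𝒰.LocallyDirected] [Small.{u} 𝒰.I₀] [Quiver.IsThin 𝒰.I₀]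
    (d : Cover.RelativeGluingData 𝒰) (i : 𝒰.I₀) : IsOpenImmersion (d.cover.f i) :=
  d.cover.map_prop i

variable {X : Scheme.{u}}

section

variable {F : X.AffineZariskiSiteᵒᵖ ⥤ CommRingCat.{u}}
  {α : (AffineZariskiSite.toOpensFunctor X).op ⋙ X.presheaf ⟶ F} (H : α.Coequifibered)
  (U : X.AffineZariskiSite)

instance : IsOpenImmersion ((AffineZariskiSite.relativeGluingData H).cover.f U) :=
  (AffineZariskiSite.relativeGluingData H).isOpenImmersion_cover_f U

theorem AffineZariskiSite.cover_f_toBase :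
    (AffineZariskiSite.relativeGluingData H).cover.f U ≫
      (AffineZariskiSite.relativeGluingData H).toBase =
    Spec.map (α.app (op U)) ≫ U.isAffineOpen.fromSpec := by
  refine ((AffineZariskiSite.relativeGluingData H).ι_toBase U).trans ?_
  refine (Category.assoc _ _ _).trans ?_
  exact congrArg (Spec.map (α.app (op U)) ≫ ·) U.isAffineOpen.isoSpec_inv_ι

theorem AffineZariskiSite.toBase_preimage :
    (AffineZariskiSite.relativeGluingData H).toBase ⁻¹ᵁ U.aff.1 =
      ((AffineZariskiSite.relativeGluingData H).cover.f U).opensRange := by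
  have := (AffineZariskiSite.relativeGluingData H).toBase_preimage_eq_opensRange_ι U
  rw [← Opens.opensRange_ι U.aff.1]
  exact this

/-- The charts of the relative spectrum of a quasi-coherent algebra are base changes. -/
theorem AffineZariskiSite.isPullback_cover_f :
    IsPullback ((AffineZariskiSite.relativeGluingData H).cover.f U) (Spec.map (α.app (op U)))
      (AffineZariskiSite.relativeGluingData H).toBase U.isAffineOpen.fromSpec := by
  have : IsOpenImmersion U.isAffineOpen.fromSpec := U.isAffineOpen.isOpenImmersion_fromSpec
  refine (@IsOpenImmersion.isPullback _ _ _ _ _ _ _ _ _ this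
    (AffineZariskiSite.cover_f_toBase H U) ?_).flip
  rw [IsAffineOpen.opensRange_fromSpec]
  exact AffineZariskiSite.toBase_preimage H U

end

namespace IdealSheafData
namespace ModulePresheaf

instance (I : X.IdealSheafData) (U : X.AffineZariskiSite) : IsOpenImmersion (quotToSubscheme I U) :=
  I.subschemeCover.map_prop U.aff

theorem opensRange_quotToSubscheme (I : X.IdealSheafData) (U : X.AffineZariskiSite) :
    (quotToSubscheme I U).opensRange = I.subschemeι ⁻¹ᵁ U.aff.1 :=
  I.opensRange_subschemeCover_map U.aff

theorem subschemeι_quotToSubscheme_mem (I : X.IdealSheafData) (U : X.AffineZariskiSite)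
    (y : Spec (.of (I.quot U))) : I.subschemeι (quotToSubscheme I U y) ∈ U.aff.1 := by
  have : quotToSubscheme I U y ∈ I.subschemeι ⁻¹ᵁ U.aff.1 := by
    rw [← opensRange_quotToSubscheme]
    exact ⟨y, rfl⟩
  exact this

theorem exists_quotToSubscheme_eq {I : X.IdealSheafData} {U : X.AffineZariskiSite}
    {z : I.subscheme} (h : I.subschemeι z ∈ U.aff.1) : ∃ y, quotToSubscheme I U y = z := by
  have : z ∈ (quotToSubscheme I U).opensRange := by rw [opensRange_quotToSubscheme]; exact h
  exact this

variable {I : X.IdealSheafData}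

theorem vectorBundleToSubscheme_subschemeι (M : I.ModulePresheaf) (hM : M.IsQuasicoherent) :
    vectorBundleToSubscheme M hM ≫ I.subschemeι =
      (AffineZariskiSite.relativeGluingData hM.coequifibered_toSymAlgebra).toBase := by
  refine Cover.hom_ext (AffineZariskiSite.relativeGluingData hM.coequifibered_toSymAlgebra).cover
    _ _ fun U => ?_
  refine Eq.trans ?_ (AffineZariskiSite.cover_f_toBase hM.coequifibered_toSymAlgebra U).symm
  refine (Category.assoc _ _ _).symm.trans (Eq.trans ?_ (symAlgebraToSubscheme_comp M U))
  exact congrArg (· ≫ I.subschemeι) (vectorBundleChart_toSubscheme M hM U)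

instance (M : I.ModulePresheaf) (hM : M.IsQuasicoherent) (U : X.AffineZariskiSite) :
    IsOpenImmersion (vectorBundleChart M hM U) :=
  inferInstanceAs (IsOpenImmersion
    ((AffineZariskiSite.relativeGluingData hM.coequifibered_toSymAlgebra).cover.f U))

theorem isPullback_vectorBundleChart (M : I.ModulePresheaf) (hM : M.IsQuasicoherent)
    (U : X.AffineZariskiSite) :
    IsPullback (vectorBundleChart M hM U)
      (Spec.map (R := .of (I.quot U)) (S := (symAlgebra M).obj (op U))
        (CommRingCat.ofHom (algebraMap (I.quot U) (SymmetricAlgebra (I.quot U) (M.obj U)))))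
      (vectorBundleToSubscheme M hM) (quotToSubscheme I U) := by
  refine (IsOpenImmersion.isPullback _ _ _ _ (vectorBundleChart_toSubscheme M hM U) ?_).flip
  rw [opensRange_quotToSubscheme, ← Hom.comp_preimage, vectorBundleToSubscheme_subschemeι]
  exact AffineZariskiSite.toBase_preimage hM.coequifibered_toSymAlgebra U

theorem vectorBundleChart_naturality (M : I.ModulePresheaf) (hM : M.IsQuasicoherent)
    {U V : X.AffineZariskiSite} (h : U ≤ V) :
    Spec.map ((symAlgebra M).map (homOfLE h).op) ≫ vectorBundleChart M hM V =
      vectorBundleChart M hM U :=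
  (AffineZariskiSite.relativeGluingData hM.coequifibered_toSymAlgebra).map_cover_f (homOfLE h)

end ModulePresheaf

theorem dilatationChart_naturality {I J : X.IdealSheafData} (h : J ≤ I) (hJ : J.IsLocallyPrincipal)
    {U V : X.AffineZariskiSite} (hUV : U ≤ V) :
    Spec.map ((affineBlowupAlgebra h).map (homOfLE hUV).op) ≫ dilatationChart h hJ V =
      dilatationChart h hJ U :=
  (AffineZariskiSite.relativeGluingData
    (coequifibered_toAffineBlowupAlgebra h hJ)).map_cover_f (homOfLE hUV)

theorem isPullback_dilatationChart {I J : X.IdealSheafData} (h : J ≤ I) (hJ : J.IsLocallyPrincipal)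
    (U : X.AffineZariskiSite) :
    IsPullback (dilatationChart h hJ U) (Spec.map ((toAffineBlowupAlgebra h).app (op U)))
      (dilatationι h hJ) U.isAffineOpen.fromSpec :=
  AffineZariskiSite.isPullback_cover_f (coequifibered_toAffineBlowupAlgebra h hJ) U

end IdealSheafData

/-- The square given by a surjection `φ : B' → S` whose kernel is generated by the image of the
kernel of the surjection `B → R`. -/
theorem isPushout_of_ker_le_map {B B' R S : Type u} [CommRing B] [CommRing B'] [CommRing R]
    [CommRing S] {f : B →+* B'} {π : B →+* R} {φ : B' →+* S} {g : R →+* S}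
    (hπ : Function.Surjective π) (hφ : Function.Surjective φ) (comm : ∀ a, φ (f a) = g (π a))
    (hker : ∀ t, φ t = 0 → t ∈ (RingHom.ker π).map f) :
    IsPushout (CommRingCat.ofHom f) (CommRingCat.ofHom π) (CommRingCat.ofHom φ)
      (CommRingCat.ofHom g) := by
  refine ⟨⟨CommRingCat.hom_ext <| RingHom.ext comm⟩, ⟨PushoutCocone.IsColimit.mk _
    (fun s => CommRingCat.ofHom (RingHom.liftOfSurjective φ hφ ⟨s.inl.hom, ?_⟩)) ?_ ?_ ?_⟩⟩
  · have h1 (a : B) : s.inl.hom (f a) = s.inr.hom (π a) := congr($(s.condition).hom a)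
    refine fun t ht => (Ideal.map_le_iff_le_comap.mpr fun a ha => ?_ : (RingHom.ker π).map f ≤
      RingHom.ker s.inl.hom) (hker t ht)
    rw [Ideal.mem_comap, RingHom.mem_ker, h1, RingHom.mem_ker.mp ha, map_zero]
  · intro s
    exact CommRingCat.hom_ext <| RingHom.ext fun t => 
      RingHom.liftOfRightInverse_comp_apply _ _ (Function.rightInverse_surjInv hφ) _ t
  · intro s
    refine CommRingCat.hom_ext <| RingHom.ext fun r => ?_
    obtain ⟨a, rfl⟩ := hπ r
    have h1 : s.inl.hom (f a) = s.inr.hom (π a) := congr($(s.condition).hom a)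
    change RingHom.liftOfSurjective φ hφ _ (g (π a)) = _
    rw [← comm, ← h1]
    exact RingHom.liftOfRightInverse_comp_apply _ _ (Function.rightInverse_surjInv hφ) _ _
  · intro s m h1 _
    refine CommRingCat.hom_ext <| RingHom.ext fun r => ?_
    obtain ⟨t, rfl⟩ := hφ r
    have h1' : m.hom (φ t) = s.inl.hom t := congr(($h1).hom t)
    refine h1'.trans (Eq.symm ?_)
    exact RingHom.liftOfRightInverse_comp_apply _ _ (Function.rightInverse_surjInv hφ) _ t

end AlgebraicGeometry.Scheme

/-! ### The modules J_Z and C_{Z/D} ⊗ J_Z⁻¹ where J is principal -/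

namespace AlgebraicGeometry.Scheme
variable {X : Scheme.{u}}
namespace IdealSheafData
variable {I J : X.IdealSheafData}

theorem basicOpen_eq_outside {U : X.affineOpens} {b : Γ(X, U.1)}
    (hb : J.ideal U = Ideal.span {b}) : X.basicOpen b = J.outside U.1 := by
  ext x
  by_cases hxU : x ∈ U.1
  · have h1 : x ∈ J.support ↔ x ∉ X.basicOpen b := by
      rw [mem_support_iff_of_mem hxU, hb, zeroLocus_span, mem_zeroLocus_iff]
      simp
    have h2 : x ∈ J.outside U.1 ↔ x ∉ J.support := ⟨fun h => h.2, fun h => ⟨hxU, h⟩⟩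
    change x ∈ X.basicOpen b ↔ x ∈ J.outside U.1
    rw [h2, h1, not_not]
  · exact ⟨fun h => absurd (X.basicOpen_le b h) hxU, fun h => absurd h.1 hxU⟩

theorem isAwayRingHom_outside {U : X.affineOpens} {b : Γ(X, U.1)}
    (hb : J.ideal U = Ideal.span {b}) : IsAwayRingHom (resHom (J.outside_le U.1)) b :=
  isAwayRingHom_resHom U.2.isCompact U.2.isQuasiSeparated b (basicOpen_eq_outside hb)

namespace ModulePresheaf

/-! ### The invertible module `J_Z` and its dual over an affine open where `J` is principal -/

section Principal

variable {U V : X.AffineZariskiSite}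

theorem idealRestrictMk_mul (a : Γ(X, U.aff)) (x : J.ideal U.aff) :
    idealRestrictMk I J U (a • x) = Ideal.Quotient.mk (I.ideal U.aff) a • idealRestrictMk I J U x :=
  rfl

theorem idealRestrictMk_surjective : Function.Surjective (idealRestrictMk I J U) :=
  Submodule.Quotient.mk_surjective _

theorem conormalMk_surjective : Function.Surjective (conormalMk I J U) :=
  Submodule.Quotient.mk_surjective _

theorem conormalMk_eq_zero_iff (x : I.ideal U.aff) : conormalMk I J U x = 0 ↔
    x.1 ∈ I.ideal U.aff * I.ideal U.aff ⊔ J.ideal U.aff :=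
  Submodule.Quotient.mk_eq_zero _

theorem idealRestrictMk_eq_zero_iff (x : J.ideal U.aff) : idealRestrictMk I J U x = 0 ↔
    x.1 ∈ I.ideal U.aff * J.ideal U.aff :=
  Submodule.Quotient.mk_eq_zero _

theorem res_idealRestrictMk (h : U ≤ V) (x : J.ideal V.aff) :
    (idealRestrict I J).res h (idealRestrictMk I J V x) =
      idealRestrictMk I J U ⟨resHom (AffineZariskiSite.le h) x.1,
        J.ideal_le_comap_ideal (AffineZariskiSite.aff_mono h) x.2⟩ := rfl

variable {b : J.ideal U.aff}

theorem exists_smul_idealRestrictMk (hb : J.ideal U.aff = Ideal.span {b.1})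
    (y : (idealRestrict I J).obj U) :
    ∃ a : I.quot U, y = a • idealRestrictMk I J U b := by
  obtain ⟨⟨y, hy⟩, rfl⟩ := idealRestrictMk_surjective y
  have hy' := hy
  rw [hb, Ideal.mem_span_singleton'] at hy'
  obtain ⟨a, rfl⟩ := hy'
  exact ⟨Ideal.Quotient.mk _ a, rfl⟩

variable {l : Module.Dual (I.quot U) ((idealRestrict I J).obj U)}

theorem eq_smul_idealRestrictMk (hb : J.ideal U.aff = Ideal.span {b.1})
    (hl : l (idealRestrictMk I J U b) = 1)
    (y : (idealRestrict I J).obj U) : y = l y • idealRestrictMk I J U b := by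
  obtain ⟨a, rfl⟩ := exists_smul_idealRestrictMk hb y
  rw [map_smul, hl, smul_eq_mul, mul_one]

/-- The class [b] generates J_Z, so a linear form is determined by its value there, and l has value
1. -/
theorem eq_smul_dual (hb : J.ideal U.aff = Ideal.span {b.1})
    (hl : l (idealRestrictMk I J U b) = 1)
    (l' : Module.Dual (I.quot U) ((idealRestrict I J).obj U)) :
    l' = l' (idealRestrictMk I J U b) • l := by
  ext y
  rw [eq_smul_idealRestrictMk hb hl y]
  simp only [map_smul, LinearMap.smul_apply, hl, smul_eq_mul]
  ring

/-- The class [b] is a free generator: if a b ∈ I b, cancelling the nonzerodivisor b gives a ∈ I. -/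
theorem exists_dual_eq_one (hb : J.ideal U.aff = Ideal.span {b.1})
    (hb0 : b.1 ∈ nonZeroDivisors Γ(X, U.aff)) :
    ∃ l : Module.Dual (I.quot U) ((idealRestrict I J).obj U), l (idealRestrictMk I J U b) = 1 := by
  let l : I.quot U →ₗ[I.quot U] (idealRestrict I J).obj U :=
    LinearMap.toSpanSingleton (I.quot U) _ (idealRestrictMk I J U b)
  have hl (a : I.quot U) : l a = a • idealRestrictMk I J U b := rfl
  have hbij : Function.Bijective l := by
    refine ⟨?_, fun y => ?_⟩
    · rw [injective_iff_map_eq_zero]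
      intro a ha
      obtain ⟨a, rfl⟩ := Ideal.Quotient.mk_surjective a
      rw [hl, ← idealRestrictMk_mul, idealRestrictMk_eq_zero_iff] at ha
      replace ha : a * b.1 ∈ I.ideal U.aff * J.ideal U.aff := ha
      have hm : I.ideal U.aff * J.ideal U.aff = I.ideal U.aff * Ideal.span {b.1} := congrArg _ hb
      rw [hm, Ideal.mem_mul_span_singleton] at ha
      obtain ⟨z, hz, e⟩ := ha
      rw [Ideal.Quotient.eq_zero_iff_mem, ← mul_cancel_right_mem_nonZeroDivisors hb0 |>.mp e]
      exact hz
    · obtain ⟨a, ha⟩ := exists_smul_idealRestrictMk hb y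
      exact ⟨a, ha.symm⟩
  refine ⟨(LinearEquiv.ofBijective l hbij).symm.toLinearMap, ?_⟩
  change (LinearEquiv.ofBijective l hbij).symm _ = 1
  rw [LinearEquiv.symm_apply_eq]
  change _ = l 1
  rw [hl, one_smul]

/-- The semilinear map `x ↦ [x] ⊗ l` from `I` to `C_{Z/D} ⊗ J_Z⁻¹`. -/
noncomputable def twistedConormalMk (l : Module.Dual (I.quot U) ((idealRestrict I J).obj U)) :
    I.ideal U.aff →ₛₗ[Ideal.Quotient.mk (I.ideal U.aff)] (twistedConormal I J).obj U where
  toFun x := (conormalMk I J U x ⊗ₜ l :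
    (conormal I J).obj U ⊗[I.quot U] Module.Dual (I.quot U) ((idealRestrict I J).obj U))
  map_add' x y := TensorProduct.add_tmul (conormalMk I J U x) (conormalMk I J U y) l
  map_smul' a x := TensorProduct.smul_tmul' (Ideal.Quotient.mk (I.ideal U.aff) a)
    (conormalMk I J U x) l

/-- Scalars move across the tensor product, which is how a change of the generator of J is absorbed.
-/
theorem twistedConormalMk_smul (a : Γ(X, U.aff)) (x : I.ideal U.aff) :
    twistedConormalMk l (a • x) = twistedConormalMk (Ideal.Quotient.mk (I.ideal U.aff) a • l) x :=
  TensorProduct.smul_tmul (Ideal.Quotient.mk (I.ideal U.aff) a) (conormalMk I J U x) l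

theorem twistedConormalMk_surjective (hb : J.ideal U.aff = Ideal.span {b.1})
    (hl : l (idealRestrictMk I J U b) = 1) :
    Function.Surjective (twistedConormalMk l) := by
  intro y
  change (conormal I J).obj U ⊗[I.quot U] Module.Dual (I.quot U) ((idealRestrict I J).obj U) at y
  induction y with
  | zero => exact ⟨0, map_zero _⟩
  | add x y hx hy =>
    obtain ⟨x, rfl⟩ := hx
    obtain ⟨y, rfl⟩ := hy
    exact ⟨x + y, map_add _ _ _⟩
  | tmul m l' =>
    obtain ⟨x, rfl⟩ := conormalMk_surjective m
    obtain ⟨a, ha⟩ := Ideal.Quotient.mk_surjective (l' (idealRestrictMk I J U b))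
    refine ⟨a • x, ?_⟩
    rw [eq_smul_dual hb hl l', ← ha, TensorProduct.tmul_smul]
    exact (twistedConormalMk l).map_smulₛₗ a x

/-- Contracting with evaluation at [b] recovers [x] from [x] ⊗ l, so twisting loses nothing. -/
theorem twistedConormalMk_eq_zero_iff (hl : l (idealRestrictMk I J U b) = 1) (x : I.ideal U.aff) :
    twistedConormalMk l x = 0 ↔ x.1 ∈ I.ideal U.aff * I.ideal U.aff ⊔ J.ideal U.aff := by
  rw [← conormalMk_eq_zero_iff]
  refine ⟨fun h => ?_, fun h => ?_⟩
  · let ev : Module.Dual (I.quot U) ((idealRestrict I J).obj U) →ₗ[I.quot U] I.quot U :=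
      LinearMap.applyₗ (idealRestrictMk I J U b)
    have h1 := congrArg (TensorProduct.rid (I.quot U) ((conormal I J).obj U) ∘
      LinearMap.lTensor ((conormal I J).obj U) ev) (show (conormalMk I J U x ⊗ₜ l :
        (conormal I J).obj U ⊗[I.quot U] Module.Dual (I.quot U) ((idealRestrict I J).obj U)) = 0 from h)
    simp only [Function.comp_apply, LinearMap.lTensor_tmul, TensorProduct.rid_tmul, map_zero] at h1
    have h2 : ev l = 1 := hl
    rwa [h2, one_smul] at h1
  · change (conormalMk I J U x ⊗ₜ l :
      (conormal I J).obj U ⊗[I.quot U] Module.Dual (I.quot U) ((idealRestrict I J).obj U)) = 0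
    rw [h, TensorProduct.zero_tmul]

end Principal

end ModulePresheaf
end IdealSheafData
end AlgebraicGeometry.Scheme

/-! ### Chart homomorphisms defined by splittings -/

namespace AlgebraicGeometry.Scheme
variable {X : Scheme.{u}}
namespace IdealSheafData
variable {I J : X.IdealSheafData} (h : J ≤ I)

/-- The structure homomorphism of the affine blowup algebra over the affine open `U`. -/
def toAffineBlowupSubring (U : X.AffineZariskiSite) : Γ(X, U.aff) →+* affineBlowupSubring h U :=
  toBlowupSubring (resHom (J.outside_le U.aff)) (I.ideal U.aff) (J.ideal U.aff) (h U.aff)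

variable {h} in
theorem affineBlowupSubring_ringHom_ext {U : X.AffineZariskiSite} {S : Type*} [CommRing S]
    {b : Γ(X, U.aff)} (hb : J.ideal U.aff = Ideal.span {b}) {φ φ' : affineBlowupSubring h U →+* S}
    (h₀ : ∀ a, φ (toAffineBlowupSubring h U a) = φ' (toAffineBlowupSubring h U a))
    (h₁ : ∀ (z : I.ideal U.aff) (t : affineBlowupSubring h U),
      resHom (J.outside_le U.aff) b * t.1 = resHom (J.outside_le U.aff) z.1 → φ t = φ' t) : φ = φ' :=
  blowupSubring_ringHom_ext hb (isAwayRingHom_outside hb).isUnit h₀ fun z hz t ht => h₁ ⟨z, hz⟩ t ht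

namespace ModulePresheaf

/-- A splitting of `J_Z → I/I²` over the affine open `U`, as a semilinear map on `I(U)`. -/
def IsSplitting (U : X.AffineZariskiSite)
    (s : I.ideal U.aff →ₛₗ[Ideal.Quotient.mk (I.ideal U.aff)] (idealRestrict I J).obj U) : Prop :=
  ∀ j : J.ideal U.aff, s ⟨j.1, h U.aff j.2⟩ = idealRestrictMk I J U j

/-- The homomorphism from the affine blowup algebra to `Sym (C_{Z/D} ⊗ J_Z⁻¹)` defined by `s`: it
sends a fraction `z / b` to `[z] ⊗ l + l (s z)`, where `l` is the linear form with `l [b] = 1`. -/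
structure IsChartHom (U : X.AffineZariskiSite)
    (s : I.ideal U.aff →ₛₗ[Ideal.Quotient.mk (I.ideal U.aff)] (idealRestrict I J).obj U)
    (φ : affineBlowupSubring h U →+*
      SymmetricAlgebra (I.quot U) ((twistedConormal I J).obj U)) : Prop where
  structure_apply : ∀ a, φ (toAffineBlowupSubring h U a) =
    algebraMap _ _ (Ideal.Quotient.mk (I.ideal U.aff) a)
  -- All generators are allowed, so that the formula can be used with generators restricted from
  -- larger opens.
  fraction : ∀ (b : J.ideal U.aff) (_ : J.ideal U.aff = Ideal.span {b.1})
    (l : Module.Dual (I.quot U) ((idealRestrict I J).obj U)) (_ : l (idealRestrictMk I J U b) = 1)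
    (z : I.ideal U.aff) (t : affineBlowupSubring h U),
    resHom (J.outside_le U.aff) b.1 * t.1 = resHom (J.outside_le U.aff) z.1 →
      φ t = SymmetricAlgebra.ι _ _ (twistedConormalMk l z) + algebraMap _ _ (l (s z))

variable {h}

theorem _root_.AlgebraicGeometry.Scheme.IdealSheafData.IsRegularOn.exists_generator {U : X.AffineZariskiSite} (hU : IsRegularOn I J U) :
    ∃ b : J.ideal U.aff, J.ideal U.aff = Ideal.span {b.1} ∧ b.1 ∈ nonZeroDivisors Γ(X, U.aff) ∧
      ∃ l : Module.Dual (I.quot U) ((idealRestrict I J).obj U), l (idealRestrictMk I J U b) = 1 := by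
  obtain ⟨b, x, n, hr, hJ, -⟩ := hU
  let b' : J.ideal U.aff := ⟨b, hJ ▸ Ideal.mem_span_singleton_self b⟩
  exact ⟨b', hJ, hr.nzd, exists_dual_eq_one (b := b') hJ hr.nzd⟩

variable {U V : X.AffineZariskiSite}
  {s : I.ideal U.aff →ₛₗ[Ideal.Quotient.mk (I.ideal U.aff)] (idealRestrict I J).obj U}

/-- The exceptional divisor over an affine open where `Z` is regularly embedded in `D`. -/
theorem exists_isChartHom (hU : IsRegularOn I J U) (hs : IsSplitting h U s) :
    ∃ φ, IsChartHom h U s φ ∧ Function.Surjective φ ∧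
      ∀ t, φ t = 0 → t ∈ (I.ideal U.aff).map (toAffineBlowupSubring h U) := by
  obtain ⟨b₁, x, n, hr, hJ, hI⟩ := hU
  let b₁' : J.ideal U.aff := ⟨b₁, hJ ▸ Ideal.mem_span_singleton_self b₁⟩
  obtain ⟨l, hl⟩ := exists_dual_eq_one (I := I) (b := b₁') hJ hr.nzd
  -- In terms of the generator b₁, the splitting becomes a map to functions on Z with value 1 at b₁.
  let c : I.ideal U.aff →ₗ[Γ(X, U.aff)] I.quot U :=
    { toFun z := l (s z)
      map_add' z w := by rw [map_add, map_add]
      map_smul' a z := by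
        rw [s.map_smulₛₗ, map_smul]; rfl }
  obtain ⟨φ, h₀, h₁, h₂, h₃⟩ := hr.exists_hom_symmetricAlgebra (h := h U.aff)
    (ρ := resHom (J.outside_le U.aff.1)) hI hJ (isAwayRingHom_outside hJ)
    (twistedConormalMk_surjective (b := b₁') hJ hl)
    (fun z => by rw [twistedConormalMk_eq_zero_iff hl, hJ]) c
    (fun hbI => by
      change l (s ⟨b₁, hbI⟩) = 1
      rw [← hl]
      exact congrArg l (hs b₁'))
  refine ⟨φ, ⟨h₀, fun b' hb' l' hl' z t ht => ?_⟩, h₂, h₃⟩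
  -- For another generator b' write b₁ = v b'. Then z / b' = v z / b₁ and the form dual to b' is v •
  -- l, so the two factors v match.
  obtain ⟨v, hv⟩ := Ideal.mem_span_singleton'.mp
    (show b₁ ∈ Ideal.span {b'.1} from hb' ▸ b₁'.2)
  have hll : Ideal.Quotient.mk (I.ideal U.aff) v • l = l' := by
    rw [eq_smul_dual hb' hl' (Ideal.Quotient.mk (I.ideal U.aff) v • l), LinearMap.smul_apply,
      ← map_smul, ← idealRestrictMk_mul, show v • b' = b₁' from Subtype.ext hv, hl, one_smul]
  have hcz : c (v • z) = l' (s z) := by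
    rw [← hll]
    exact c.map_smul v z
  refine (h₁ (v • z) t ?_).trans ?_
  swap
  · rw [twistedConormalMk_smul, hll, hcz]
  · have hv' : b₁ = v * b'.1 := hv.symm
    rw [hv', map_mul, mul_assoc]
    exact (congrArg _ ht).trans (map_mul _ _ _).symm

/-- The homomorphism defined by a splitting is unique and compatible with restriction. -/
theorem IsChartHom.naturality (hVU : V ≤ U) (hU : IsRegularOn I J U) {φ} (hφ : IsChartHom h U s φ)
    {s'} {φ'} (hφ' : IsChartHom h V s' φ')
    (hs : ∀ z, s' ⟨resHom (AffineZariskiSite.le hVU) z.1,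
      I.ideal_le_comap_ideal (AffineZariskiSite.aff_mono hVU) z.2⟩ =
        (idealRestrict I J).res hVU (s z)) :
    φ'.comp (affineBlowupRes h hVU) =
      (symMap (I.quotRes hVU) ((twistedConormal I J).res hVU)).comp φ := by
  obtain ⟨b, hb, hb0, l, hl⟩ := hU.exists_generator
  have hqc := isQuasicoherent_idealRestrict I J
  let b' : J.ideal V.aff := ⟨resHom (AffineZariskiSite.le hVU) b.1,
    J.ideal_le_comap_ideal (AffineZariskiSite.aff_mono hVU) b.2⟩
  have hb' : J.ideal V.aff = Ideal.span {b'.1} := by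
    have : (J.ideal U.aff).map (resHom (AffineZariskiSite.le hVU)) = Ideal.span {b'.1} := by
      rw [hb, Ideal.map_span, Set.image_singleton]
    rw [← this, J.map_resHom (AffineZariskiSite.aff_mono hVU)]
  have hl' : dualRes hqc hVU l (idealRestrictMk I J V b') = 1 := by
    rw [← res_idealRestrictMk hVU b, dualRes_apply, hl, map_one]
  -- Functions on X and fractions z / b generate the blowup algebra, and the restricted form is dual
  -- to the restricted generator.
  refine affineBlowupSubring_ringHom_ext hb (fun a => ?_) fun z t ht => ?_
  · rw [RingHom.comp_apply, RingHom.comp_apply, hφ.structure_apply, symMap_algebraMap, quotRes_mk,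
      ← hφ'.structure_apply]
    exact congrArg φ' (Subtype.ext (resHom_comm J (AffineZariskiSite.le hVU) a))
  · rw [RingHom.comp_apply, RingHom.comp_apply, hφ.fraction b hb l hl z t ht, map_add,
      symMap_ι, symMap_algebraMap, hφ'.fraction b' hb' _ hl' ⟨resHom (AffineZariskiSite.le hVU) z.1,
      I.ideal_le_comap_ideal (AffineZariskiSite.aff_mono hVU) z.2⟩, hs z, dualRes_apply]
    · rfl
    · rw [← resHom_comm J (AffineZariskiSite.le hVU), ← resHom_comm J (AffineZariskiSite.le hVU),
        ← ht, map_mul]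
      rfl

/-- A surjection whose kernel is generated by I computes the base change of the blowup algebra to
functions on Z. -/
theorem isPushout_of_isChartHom {φ} (hφ : IsChartHom h U s φ) (hsurj : Function.Surjective φ)
    (hker : ∀ t, φ t = 0 → t ∈ (I.ideal U.aff).map (toAffineBlowupSubring h U)) :
    IsPushout ((toAffineBlowupAlgebra h).app (op U))
      (CommRingCat.ofHom (Ideal.Quotient.mk (I.ideal U.aff)))
      (CommRingCat.ofHom φ)
      (CommRingCat.ofHom (algebraMap (I.quot U)
        (SymmetricAlgebra (I.quot U) ((twistedConormal I J).obj U)))) := by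
  refine isPushout_of_ker_le_map (f := toAffineBlowupSubring h U) Ideal.Quotient.mk_surjective hsurj
        hφ.structure_apply fun t ht => ?_
  rw [Ideal.mk_ker]
  exact hker t ht

/-- A splitting over `U` identifies the exceptional divisor over `Z ∩ U` with the spectrum of the
symmetric algebra. -/
theorem exists_isPullback_exceptionalDivisor (hJ : J.IsLocallyPrincipal) (hU : IsRegularOn I J U)
    (hs : IsSplitting h U s) :
    ∃ (φ : _) (ε : Spec ((symAlgebra (twistedConormal I J)).obj (op U)) ⟶
        (exceptionalDivisor h hJ).left), IsChartHom h U s φ ∧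
      ε ≫ pullback.fst _ _ = Spec.map (CommRingCat.ofHom φ) ≫ dilatationChart h hJ U ∧
      IsPullback ε (Spec.map (R := .of (I.quot U))
        (S := (symAlgebra (twistedConormal I J)).obj (op U)) (CommRingCat.ofHom (algebraMap (I.quot U)
          (SymmetricAlgebra (I.quot U) ((twistedConormal I J).obj U)))))
        (exceptionalDivisor h hJ).hom (quotToSubscheme I U) := by
  obtain ⟨φ, hφ, hsurj, hker⟩ := exists_isChartHom hU hs
  have h1 := isPullback_SpecMap_of_isPushout _ _ _ _ (isPushout_of_isChartHom hφ hsurj hker)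
  -- Pasting with the chart of the dilatation gives its base change to Z ∩ U over X; cancelling the
  -- square that defines the exceptional divisor leaves a square over Z.
  have h2 := h1.paste_horiz (isPullback_dilatationChart h hJ U)
  have h3 := quotToSubscheme_subschemeι I U
  have h4 : IsPullback (Spec.map (CommRingCat.ofHom φ) ≫ dilatationChart h hJ U)
      (Spec.map (CommRingCat.ofHom (algebraMap (I.quot U)
          (SymmetricAlgebra (I.quot U) ((twistedConormal I J).obj U)))))
      (dilatationι h hJ) (quotToSubscheme I U ≫ I.subschemeι) := by
    rw [h3]; exact h2
  obtain ⟨ε, h5, h6⟩ : ∃ ε : Spec ((symAlgebra (twistedConormal I J)).obj (op U)) ⟶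
      (exceptionalDivisor h hJ).left,
      ε ≫ pullback.fst _ _ = Spec.map (CommRingCat.ofHom φ) ≫ dilatationChart h hJ U ∧
      ε ≫ pullback.snd _ _ = Spec.map (CommRingCat.ofHom (algebraMap (I.quot U)
          (SymmetricAlgebra (I.quot U) ((twistedConormal I J).obj U)))) ≫ quotToSubscheme I U :=
    ⟨pullback.lift _ _ (h4.w.trans (Category.assoc _ _ _).symm), pullback.lift_fst _ _ _,
      pullback.lift_snd _ _ _⟩
  exact ⟨φ, ε, hφ, h5, IsPullback.of_right (by rw [h5]; exact h4) h6
    (IsPullback.of_hasPullback (dilatationι h hJ) I.subschemeι)⟩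

end ModulePresheaf
end IdealSheafData
end AlgebraicGeometry.Scheme

/-! ### From compatible splittings to an isomorphism over Z -/

namespace AlgebraicGeometry.Scheme
variable {X : Scheme.{u}}
namespace IdealSheafData
namespace ModulePresheaf

variable {I J : X.IdealSheafData} {h : J ≤ I}

/-- A compatible family of splittings over the affine opens where `Z` is regularly embedded in `D`
identifies the exceptional divisor with `𝕍(C_{Z/D} ⊗ J_Z⁻¹)`. -/
theorem exists_iso_of_isSplitting (hJ : J.IsEffectiveCartier)
    (hZ : IsRegularClosedImmersion (inclusion h))
    (s : ∀ U, IsRegularOn I J U →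
      (I.ideal U.aff →ₛₗ[Ideal.Quotient.mk (I.ideal U.aff)] (idealRestrict I J).obj U))
    (hs : ∀ U hU, IsSplitting h U (s U hU))
    (hres : ∀ U (hU : IsRegularOn I J U) V (hVU : V ≤ U) (z : I.ideal U.aff),
      s V (hU.mono hVU) ⟨resHom (AffineZariskiSite.le hVU) z.1,
        I.ideal_le_comap_ideal (AffineZariskiSite.aff_mono hVU) z.2⟩ =
          (idealRestrict I J).res hVU (s U hU z)) :
    ∃ e : twistedNormalBundle I hJ ≅ exceptionalDivisor h hJ.isLocallyPrincipal,
      ∀ U hU, ∃ φ, IsChartHom h U (s U hU) φ ∧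
        vectorBundleChart _ (isQuasicoherent_twistedConormal I hJ) U ≫ e.hom.left ≫ pullback.fst _ _ =
          Spec.map (CommRingCat.ofHom φ) ≫ dilatationChart h hJ.isLocallyPrincipal U := by
  let M := twistedConormal I J
  have hM := isQuasicoherent_twistedConormal I hJ
  choose φ ε hφ hε hpb using fun U hU =>
    exists_isPullback_exceptionalDivisor hJ.isLocallyPrincipal hU (hs U hU)
  -- The chart maps ε agree on smaller opens: their components to the dilatation agree by naturality
  -- of the chart homomorphisms, and those to Z by construction.
  have hnat (U hU V) (hVU : V ≤ U) (hV : IsRegularOn I J V) :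
      Spec.map ((symAlgebra M).map (homOfLE hVU).op) ≫ ε U hU = ε V hV := by
    have h1 := IsChartHom.naturality hVU hU (hφ U hU) (hφ V hV) (hres U hU V hVU)
    have h2 : Spec.map ((symAlgebra M).map (homOfLE hVU).op) ≫ Spec.map (CommRingCat.ofHom (φ U hU)) =
        Spec.map (CommRingCat.ofHom (φ V hV)) ≫
          Spec.map ((affineBlowupAlgebra h).map (homOfLE hVU).op) :=
      (Spec.map_comp _ _).symm.trans
        ((congrArg Spec.map (CommRingCat.hom_ext h1.symm)).trans (Spec.map_comp _ _))
    have h3 : Spec.map ((symAlgebra M).map (homOfLE hVU).op) ≫ ε U hU ≫ pullback.fst _ _ =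
        ε V hV ≫ pullback.fst _ _ := by
      rw [hε U hU, hε V hV, ← dilatationChart_naturality h hJ.isLocallyPrincipal hVU]
      exact (Category.assoc _ _ _).symm.trans
        ((congrArg (· ≫ dilatationChart h hJ.isLocallyPrincipal U) h2).trans (Category.assoc _ _ _))
    have h4 (U hU) : ε U hU ≫ pullback.snd _ _ = symAlgebraToSubscheme M U := (hpb U hU).w
    have h5 : Spec.map ((symAlgebra M).map (homOfLE hVU).op) ≫ ε U hU ≫ pullback.snd _ _ =
        ε V hV ≫ pullback.snd _ _ := by
      rw [h4 U hU, h4 V hV]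
      exact symAlgebraToSubscheme_naturality M (homOfLE hVU)
    exact pullback.hom_ext ((Category.assoc _ _ _).trans h3) ((Category.assoc _ _ _).trans h5)
  obtain ⟨e, he⟩ := exists_iso_of_charts (ι := {U : X.AffineZariskiSite // IsRegularOn I J U})
    (a := fun U => vectorBundleChart M hM U.1) (b := fun U => ε U.1 U.2)
    (fun U => isPullback_vectorBundleChart M hM U.1) (fun U => hpb U.1 U.2)
    (fun z => by
      obtain ⟨U, hzU, hU⟩ := exists_isRegularOn hJ hZ (I.subschemeι z)
      obtain ⟨y, hy⟩ := exists_quotToSubscheme_eq hzU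
      exact ⟨⟨U, hU⟩, y, hy⟩)
    (fun U V y y' hy => by
      obtain ⟨W, hWU, hWV, hW⟩ := AffineZariskiSite.exists_le_le
        (subschemeι_quotToSubscheme_mem I U.1 y)
        (by rw [hy]; exact subschemeι_quotToSubscheme_mem I V.1 y')
      obtain ⟨w, hw⟩ := exists_quotToSubscheme_eq hW
      exact ⟨⟨W, U.2.mono hWU⟩, Spec.map ((symAlgebra M).map (homOfLE hWU).op),
        Spec.map ((symAlgebra M).map (homOfLE hWV).op), w, hw,
        vectorBundleChart_naturality M hM hWU, vectorBundleChart_naturality M hM hWV,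
        hnat _ _ _ _ _, hnat _ _ _ _ _⟩)
  refine ⟨e, fun U hU => ⟨φ U hU, hφ U hU, ?_⟩⟩
  rw [← hε U hU, ← he ⟨U, hU⟩]
  exact (Category.assoc _ _ _).symm

end ModulePresheaf
end IdealSheafData
end AlgebraicGeometry.Scheme

/-! ### Local structure of the exceptional divisor -/

namespace AlgebraicGeometry.Scheme

theorem nonempty_overRestrict_iso {Z P Q E : Scheme.{u}} {a : P ⟶ E} {π : P ⟶ Q} {p : E ⟶ Z}
    {q : Q ⟶ Z} [IsOpenImmersion q] (h : IsPullback a π p q) :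
    Nonempty (overRestrict (Over.mk p) q.opensRange ≅ Over.mk (π ≫ q.isoOpensRange.hom)) := by
  have h1 : IsPullback (π ≫ q.isoOpensRange.hom) a q.opensRange.ι p := by
    refine h.flip.of_iso (Iso.refl _) q.isoOpensRange (Iso.refl _) (Iso.refl _) ?_ ?_ ?_ ?_ <;> simp
  have h2 := isPullback_morphismRestrict p q.opensRange
  exact ⟨Over.isoMk (h2.isoIsPullback _ _ h1) (h2.isoIsPullback_hom_fst _ _ h1)⟩

theorem nonempty_affineSpace_iso {Z : Scheme.{u}} {R : Type u} [CommRing R] (n : ℕ)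
    (i : Spec (.of R) ≅ Z) {S : Type u} [CommRing S] [Algebra R S]
    (e : S ≃ₐ[R] MvPolynomial (ULift.{u} (Fin n)) R) :
    Nonempty (Over.mk (Spec.map (CommRingCat.ofHom (algebraMap R S)) ≫ i.hom) ≅
      Over.mk (𝔸(ULift.{u} (Fin n); Z) ↘ Z)) := by
  have h1 := AffineSpace.isPullback_map (n := ULift.{u} (Fin n)) i.hom
  have h2 : IsIso (AffineSpace.map (ULift.{u} (Fin n)) i.hom) := h1.isIso_fst_of_isIso
  let j : Spec (.of S) ≅ Spec (.of (MvPolynomial (ULift.{u} (Fin n)) R)) :=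
    Scheme.Spec.mapIso e.toRingEquiv.symm.toCommRingCatIso.op
  refine ⟨Over.isoMk (j ≪≫ (AffineSpace.SpecIso (ULift.{u} (Fin n)) (.of R)).symm ≪≫
    asIso (AffineSpace.map (ULift.{u} (Fin n)) i.hom)) ?_⟩
  change (j.hom ≫ (AffineSpace.SpecIso (ULift.{u} (Fin n)) (.of R)).inv ≫
    AffineSpace.map (ULift.{u} (Fin n)) i.hom) ≫ 𝔸(ULift.{u} (Fin n); Z) ↘ Z =
      Spec.map (CommRingCat.ofHom (algebraMap R S)) ≫ i.hom
  rw [Category.assoc, Category.assoc, AffineSpace.map_over, AffineSpace.SpecIso_inv_over_assoc,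
    ← Category.assoc]
  congr 1
  refine (Spec.map_comp _ _).symm.trans (congrArg Spec.map (CommRingCat.hom_ext ?_))
  refine RingHom.ext fun r => ?_
  exact (e.symm.commutes r)

variable {X : Scheme.{u}}
namespace IdealSheafData
namespace ModulePresheaf

variable {I J : X.IdealSheafData} {h : J ≤ I} {U : X.AffineZariskiSite}

/-- In z = a b + Σ d_i x_i the coefficient a is well defined modulo I by regularity. Hence z ↦ a [b]
is a splitting. -/
theorem exists_isSplitting (h : J ≤ I) (hU : IsRegularOn I J U) : ∃ s, IsSplitting h U s := by
  obtain ⟨b, x, n, hr, hJ, hI⟩ := hU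
  let b' : J.ideal U.aff := ⟨b, hJ ▸ Ideal.mem_span_singleton_self b⟩
  choose a d had using fun z : I.ideal U.aff =>
    exists_of_mem_partialIdeal (y := z.1) (b := b) (x := x) (k := n) (by rw [← hI]; exact z.2)
  have key (z : I.ideal U.aff) (a' : Γ(X, U.aff)) (d' : ℕ → Γ(X, U.aff))
      (e : z.1 = a' * b + ∑ i ∈ Finset.range n, d' i * x i) :
      Ideal.Quotient.mk (I.ideal U.aff) (a z) = Ideal.Quotient.mk (I.ideal U.aff) a' := by
    rw [Ideal.Quotient.eq, hI]
    refine (hr.mem_of_sum_mem_sq _ (d z - d') ?_).1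
    have : (a z - a') * b + ∑ i ∈ Finset.range n, (d z - d') i * x i = 0 := by
      simp only [Pi.sub_apply, sub_mul, Finset.sum_sub_distrib]
      linear_combination (had z).symm.trans e
    rw [this]
    exact zero_mem _
  refine ⟨{ toFun z := Ideal.Quotient.mk (I.ideal U.aff) (a z) • idealRestrictMk I J U b',
            map_add' z w := ?_
            map_smul' c z := ?_ }, fun j => ?_⟩
  · rw [← add_smul, ← map_add]
    congr 1
    refine key _ (a z + a w) (d z + d w) ?_
    rw [Submodule.coe_add, had z, had w]
    simp only [Pi.add_apply, add_mul, Finset.sum_add_distrib]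
    ring
  · rw [smul_smul, ← map_mul]
    congr 1
    refine key _ (c * a z) (fun i => c * d z i) ?_
    rw [SetLike.val_smul, smul_eq_mul, had z, mul_add, Finset.mul_sum]
    simp only [mul_assoc]
  · obtain ⟨c, hc⟩ := Ideal.mem_span_singleton'.mp
      (show j.1 ∈ Ideal.span {b} by rw [← hJ]; exact j.2)
    change Ideal.Quotient.mk (I.ideal U.aff) (a ⟨j.1, _⟩) • idealRestrictMk I J U b' = _
    rw [key _ c 0 (by simp [hc]), ← idealRestrictMk_mul]
    exact congrArg _ (Subtype.ext hc)

theorem exists_basis_twistedConormal (hU : IsRegularOn I J U) :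
    ∃ n : ℕ, Nonempty (Module.Basis (ULift.{u} (Fin n)) (I.quot U) ((twistedConormal I J).obj U)) := by
  obtain ⟨b, x, n, hr, hJ, hI⟩ := hU
  let b' : J.ideal U.aff := ⟨b, hJ ▸ Ideal.mem_span_singleton_self b⟩
  obtain ⟨l, hl⟩ := exists_dual_eq_one (I := I) (b := b') hJ hr.nzd
  exact ⟨n, ⟨(hr.basis hI (twistedConormalMk_surjective (b := b') hJ hl)
    (fun z => by rw [twistedConormalMk_eq_zero_iff hl, hJ])
    fun i hi => hI ▸ mem_partialIdeal_of_lt b x hi).reindex Equiv.ulift.symm⟩⟩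

/-- Over a good affine open some splitting exists, and the twisted conormal module has a basis, so
its symmetric algebra is a polynomial ring. -/
theorem exists_nhds_exceptionalDivisor (hJ : J.IsEffectiveCartier)
    (hZ : IsRegularClosedImmersion (inclusion h)) (z : I.subscheme) :
    ∃ V : I.subscheme.Opens, z ∈ V ∧
      Nonempty (overRestrict (exceptionalDivisor h hJ.isLocallyPrincipal) V ≅
        overRestrict (twistedNormalBundle I hJ) V) ∧
      ∃ n : ℕ, Nonempty (overRestrict (exceptionalDivisor h hJ.isLocallyPrincipal) V ≅
        Over.mk (𝔸(ULift.{u} (Fin n); V.toScheme) ↘ V.toScheme)) := by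
  obtain ⟨U, hzU, hU⟩ := exists_isRegularOn hJ hZ (I.subschemeι z)
  obtain ⟨s, hs⟩ := exists_isSplitting h hU
  obtain ⟨φ, ε, -, -, hε⟩ := exists_isPullback_exceptionalDivisor hJ.isLocallyPrincipal hU hs
  obtain ⟨y, hy⟩ := exists_quotToSubscheme_eq hzU
  obtain ⟨n, ⟨B⟩⟩ := exists_basis_twistedConormal hU
  obtain ⟨e₁⟩ := nonempty_overRestrict_iso hε
  obtain ⟨e₂⟩ := nonempty_overRestrict_iso (isPullback_vectorBundleChart _
    (isQuasicoherent_twistedConormal I hJ) U)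
  obtain ⟨e₃⟩ := nonempty_affineSpace_iso n (quotToSubscheme I U).isoOpensRange
    (SymmetricAlgebra.equivMvPolynomial B)
  exact ⟨(quotToSubscheme I U).opensRange, ⟨y, hy⟩, ⟨e₁ ≪≫ e₂.symm⟩, n, ⟨e₁ ≪≫ e₃⟩⟩

end ModulePresheaf
end IdealSheafData
end AlgebraicGeometry.Scheme

/-! ### Transversal intersections: the splitting defined by W -/

namespace AlgebraicGeometry.Scheme
variable {X : Scheme.{u}}
namespace IdealSheafData

/-- If `J` is the ideal of an effective Cartier divisor, every generator of `J` is a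
nonzerodivisor. -/
theorem IsEffectiveCartier.mem_nonZeroDivisors {J : X.IdealSheafData} (hJ : J.IsEffectiveCartier)
    {U : X.affineOpens} {b : Γ(X, U.1)} (hb : J.ideal U = Ideal.span {b}) :
    b ∈ nonZeroDivisors Γ(X, U.1) := by
  rw [mem_nonZeroDivisors_iff_right]
  intro c hc
  let s : Set Γ(X, U.1) := {f | ∃ n : ℕ, f ^ n • c = 0}
  have hs : Ideal.span s = ⊤ := by
    rw [← U.2.self_le_iSup_basicOpen_iff]
    intro x hx
    obtain ⟨f, hxf, b', hb', e⟩ := hJ.exists_basicOpen U x hx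
    have hle := X.affineBasicOpen_le (V := U) f
    have haw := isAway_affineBasicOpen U f
    -- Locally J has a generator b' that is a nonzerodivisor. It is a multiple of b, so c * b = 0
    -- forces c to vanish there.
    refine Opens.mem_iSup.mpr ⟨⟨f, haw.inj (x := c) ?_⟩, hxf⟩
    have h1 : b' ∈ Ideal.span {resHom hle b} := by
      rw [← Set.image_singleton, ← Ideal.map_span, ← hb, J.map_resHom hle, e]
      exact Ideal.mem_span_singleton_self b'
    obtain ⟨v, rfl⟩ := Ideal.mem_span_singleton'.mp h1
    refine (mul_right_mem_nonZeroDivisors_eq_zero_iff hb').mp ?_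
    rw [mul_left_comm, ← map_mul, hc, map_zero, mul_zero]
  exact ModulePresheaf.eq_zero_of_span_eq_top hs fun f hf => hf

variable {I J K : X.IdealSheafData} {h : J ≤ I} {hK : K ≤ I}

/-- The closed subscheme V(K + J) maps compatibly to W and D, hence to their fibre product Z, which
gives I ≤ K + J. -/
theorem eq_sup_of_isPullback
    (hp : IsPullback (inclusion hK) (inclusion h) K.subschemeι J.subschemeι) : I = K ⊔ J := by
  refine le_antisymm ?_ (sup_le hK h)
  let u := hp.lift (inclusion (le_sup_left : K ≤ K ⊔ J)) (inclusion (le_sup_right : J ≤ K ⊔ J))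
    (by rw [inclusion_subschemeι, inclusion_subschemeι])
  have hu : u ≫ I.subschemeι = (K ⊔ J).subschemeι := by
    rw [← inclusion_subschemeι hK, ← Category.assoc, hp.lift_fst, inclusion_subschemeι]
  have h1 := Hom.le_ker_comp u I.subschemeι
  rwa [hu, ker_subschemeι, ker_subschemeι] at h1

/-- The equations of `D` are nonzerodivisors on `W = V(K)` if `Z = W ∩ D` is an effective Cartier
divisor in `W`. -/
theorem mem_of_mul_mem (hI : I = K ⊔ J) (hC : (inclusion hK).ker.IsEffectiveCartier)
    {U : X.affineOpens} {b : Γ(X, U.1)} (hb : J.ideal U = Ideal.span {b}) {c : Γ(X, U.1)}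
    (hc : c * b ∈ K.ideal U) : c ∈ K.ideal U := by
  have hW : IsAffineOpen (K.subschemeι ⁻¹ᵁ U.1) := U.2.preimage _
  have hsurj : Function.Surjective (K.subschemeι.app U.1).hom := K.subschemeι_app_surjective U
  have hker : RingHom.ker (K.subschemeι.app U.1).hom = K.ideal U := K.ker_subschemeι_app U
  -- As I = K + (b), the ideal of Z in W is generated by the image of b, which is therefore a
  -- nonzerodivisor on W.
  have h1 : (inclusion hK).ker.ideal ⟨_, hW⟩ = Ideal.span {(K.subschemeι.app U.1).hom b} := by
    rw [← Ideal.map_comap_of_surjective _ hsurj ((inclusion hK).ker.ideal ⟨_, hW⟩),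
      ker_subschemeι_app_eq_comap hK U hW, hI]
    change (K.ideal U ⊔ J.ideal U).map _ = _
    rw [Ideal.map_sup, hb, Ideal.map_span, Set.image_singleton,
      (Ideal.map_eq_bot_iff_le_ker _).mpr hker.ge, bot_sup_eq]
  have h2 := hC.mem_nonZeroDivisors h1
  rw [← hker, RingHom.mem_ker] at hc ⊢
  rw [map_mul] at hc
  exact (mul_right_mem_nonZeroDivisors_eq_zero_iff h2).mp hc

namespace ModulePresheaf

variable {U V : X.AffineZariskiSite}

theorem exists_add_of_eq_sup (hI : I = K ⊔ J) (z : I.ideal U.aff) :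
    ∃ k ∈ K.ideal U.aff, ∃ j ∈ J.ideal U.aff, k + j = z.1 := by
  have hz : z.1 ∈ K.ideal U.aff ⊔ J.ideal U.aff := by
    have : I.ideal U.aff = K.ideal U.aff ⊔ J.ideal U.aff := congrArg (fun I => I.ideal U.aff) hI
    rw [← this]
    exact z.2
  exact Submodule.mem_sup.mp hz

/-- The splitting of `J_Z → I/I²` with kernel the image of `K`. -/
theorem exists_isSplitting_of_transversal (h : J ≤ I) (hI : I = K ⊔ J)
    (hC : (inclusion hK).ker.IsEffectiveCartier)
    (hU : ∃ b, J.ideal U.aff = Ideal.span {b}) :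
    ∃ s, IsSplitting h U s ∧ ∀ k (hk : k ∈ K.ideal U.aff), s ⟨k, hK U.aff hk⟩ = 0 := by
  obtain ⟨b, hb⟩ := hU
  let b' : J.ideal U.aff := ⟨b, hb ▸ Ideal.mem_span_singleton_self b⟩
  -- Write z = k + a b. Two choices of a differ by an element whose product with b is in K, so by
  -- transversality they differ by an element of K ⊆ I, and a [b] is well defined.
  have hex (z : I.ideal U.aff) : ∃ a, z.1 - a * b ∈ K.ideal U.aff := by
    obtain ⟨k, hk, j, hj, e⟩ := exists_add_of_eq_sup hI z
    rw [hb] at hj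
    obtain ⟨a, rfl⟩ := Ideal.mem_span_singleton'.mp hj
    exact ⟨a, by rw [← e, add_sub_cancel_right]; exact hk⟩
  choose a ha using hex
  have key (z : I.ideal U.aff) (a' : Γ(X, U.aff)) (e : z.1 - a' * b ∈ K.ideal U.aff) :
      Ideal.Quotient.mk (I.ideal U.aff) (a z) = Ideal.Quotient.mk (I.ideal U.aff) a' := by
    rw [Ideal.Quotient.eq]
    refine hK U.aff (mem_of_mul_mem hI hC hb ?_)
    have := sub_mem e (ha z)
    rwa [show z.1 - a' * b - (z.1 - a z * b) = (a z - a') * b by ring] at this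
  refine ⟨{ toFun z := Ideal.Quotient.mk (I.ideal U.aff) (a z) • idealRestrictMk I J U b',
            map_add' z w := ?_
            map_smul' c z := ?_ }, fun j => ?_, fun k hk => ?_⟩
  · rw [← add_smul, ← map_add]
    congr 1
    refine key _ (a z + a w) ?_
    have := add_mem (ha z) (ha w)
    rwa [show z.1 - a z * b + (w.1 - a w * b) = z.1 + w.1 - (a z + a w) * b by ring] at this
  · rw [smul_smul, ← map_mul]
    congr 1
    refine key _ (c * a z) ?_
    have := Ideal.mul_mem_left _ c (ha z)
    rwa [mul_sub, ← mul_assoc] at this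
  · obtain ⟨c, hc⟩ := Ideal.mem_span_singleton'.mp
      (show j.1 ∈ Ideal.span {b} by rw [← hb]; exact j.2)
    change Ideal.Quotient.mk (I.ideal U.aff) (a ⟨j.1, _⟩) • idealRestrictMk I J U b' = _
    rw [key _ c (by simp [hc]), ← idealRestrictMk_mul]
    exact congrArg _ (Subtype.ext hc)
  · change Ideal.Quotient.mk (I.ideal U.aff) (a ⟨k, _⟩) • idealRestrictMk I J U b' = _
    rw [key _ 0 (by simpa using hk), map_zero, zero_smul]

/-- On I = K + J a splitting that kills K is completely determined, so such splittings are
automatically compatible. -/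
theorem IsSplitting.res_eq_of_transversal (hI : I = K ⊔ J) (hVU : V ≤ U) {s s'}
    (hs : IsSplitting h U s) (hs₀ : ∀ k (hk : k ∈ K.ideal U.aff), s ⟨k, hK U.aff hk⟩ = 0)
    (hs' : IsSplitting h V s') (hs₀' : ∀ k (hk : k ∈ K.ideal V.aff), s' ⟨k, hK V.aff hk⟩ = 0)
    (z : I.ideal U.aff) :
    s' ⟨resHom (AffineZariskiSite.le hVU) z.1,
      I.ideal_le_comap_ideal (AffineZariskiSite.aff_mono hVU) z.2⟩ =
        (idealRestrict I J).res hVU (s z) := by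
  obtain ⟨k, hk, j, hj, e⟩ := exists_add_of_eq_sup hI z
  have hk' : resHom (AffineZariskiSite.le hVU) k ∈ K.ideal V.aff :=
    K.ideal_le_comap_ideal (AffineZariskiSite.aff_mono hVU) hk
  have hj' : resHom (AffineZariskiSite.le hVU) j ∈ J.ideal V.aff :=
    J.ideal_le_comap_ideal (AffineZariskiSite.aff_mono hVU) hj
  obtain rfl : z = ⟨k, hK U.aff hk⟩ + ⟨j, h U.aff hj⟩ := Subtype.ext e.symm
  have h1 : (⟨resHom (AffineZariskiSite.le hVU) (k + j), I.ideal_le_comap_ideal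
      (AffineZariskiSite.aff_mono hVU) (add_mem (hK U.aff hk) (h U.aff hj))⟩ : I.ideal V.aff) =
      ⟨resHom (AffineZariskiSite.le hVU) k, hK V.aff hk'⟩ +
        ⟨resHom (AffineZariskiSite.le hVU) j, h V.aff hj'⟩ := Subtype.ext (map_add _ _ _)
  refine (congrArg s' h1).trans ?_
  rw [map_add, map_add, hs₀ k hk, hs₀' _ hk', zero_add, zero_add]
  exact (hs' ⟨_, hj'⟩).trans ((res_idealRestrictMk hVU ⟨j, hj⟩).symm.trans
    (congrArg _ (hs ⟨j, hj⟩).symm))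

end ModulePresheaf
end IdealSheafData
end AlgebraicGeometry.Scheme

/-! ### Characterization and uniqueness of the canonical isomorphism -/

theorem RingHom.apply_eq_of_apply_sub_eq {A B : Type*} [Ring A] [Ring B] {f g : A →+* B} {a c : A}
    (h₁ : f (a - c) = g (a - c)) (h₂ : f c = g c) : f a = g a := by
  rwa [map_sub, map_sub, h₂, sub_left_inj] at h₁

namespace AlgebraicGeometry.Scheme
variable {X : Scheme.{u}}
namespace IdealSheafData

variable {I J K : X.IdealSheafData} {h : J ≤ I} {hK : K ≤ I}

instance (hJ : J.IsLocallyPrincipal) (U : X.AffineZariskiSite) :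
    IsOpenImmersion (dilatationChart h hJ U) :=
  inferInstanceAs (IsOpenImmersion ((AffineZariskiSite.relativeGluingData
    (coequifibered_toAffineBlowupAlgebra h hJ)).cover.f U))

theorem specMap_comp_dilatationChart_injective (hJ : J.IsLocallyPrincipal) {U : X.AffineZariskiSite}
    {R : CommRingCat.{u}} {φ ψ : (affineBlowupAlgebra h).obj (op U) ⟶ R}
    (e : Spec.map φ ≫ dilatationChart h hJ U = Spec.map ψ ≫ dilatationChart h hJ U) : φ = ψ :=
  Spec.map_injective ((cancel_mono (dilatationChart h hJ U)).mp e)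

namespace ModulePresheaf

theorem vectorBundle_hom_ext {M : I.ModulePresheaf} (hM : M.IsQuasicoherent) {T : Scheme.{u}}
    {S : Set X.AffineZariskiSite} (hS : ∀ x, ∃ U ∈ S, x ∈ U.aff.1) {f g : vectorBundle M hM ⟶ T}
    (hfg : ∀ U ∈ S, vectorBundleChart M hM U ≫ f = vectorBundleChart M hM U ≫ g) : f = g := by
  refine Cover.hom_ext (openCoverOfJointlySurjective (fun U : S => vectorBundleChart M hM U.1)
    fun x => ?_) _ _ fun U => hfg U.1 U.2
  obtain ⟨U, hU, hx⟩ := hS (I.subschemeι (vectorBundleToSubscheme M hM x))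
  obtain ⟨y, hy⟩ := exists_quotToSubscheme_eq hx
  obtain ⟨w, hw⟩ := exists_chart_of_isPullback (fun U : S => isPullback_vectorBundleChart M hM U.1)
    (i := ⟨U, hU⟩) hy
  exact ⟨⟨U, hU⟩, w, hw⟩

/-- The symmetric algebra localizes along with the module, so its elements are also determined
locally. This passes from the good affine opens to any affine open where J is principal. -/
theorem sym_eq_of_symMap_eq {M : I.ModulePresheaf} (hM : M.IsQuasicoherent)
    {U : X.AffineZariskiSite} {x y : SymmetricAlgebra (I.quot U) (M.obj U)}
    (hxy : ∀ p ∈ U.aff.1, ∃ (V : _) (hV : V ≤ U), p ∈ V.aff.1 ∧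
      symMap (I.quotRes hV) (M.res hV) x = symMap (I.quotRes hV) (M.res hV) y) : x = y := by
  rw [← sub_eq_zero]
  refine eq_zero_of_span_eq_top (s := Ideal.Quotient.mk (I.ideal U.aff) ''
    {f | ∃ n : ℕ, Ideal.Quotient.mk (I.ideal U.aff) f ^ n • (x - y) = 0})
    (span_mk_eq_top fun p hp => ?_) ?_
  · obtain ⟨V, hV, hpV, e⟩ := hxy p hp
    obtain ⟨f, hf⟩ := id hV
    obtain rfl : U.basicOpen f = V := Subtype.ext hf
    refine ⟨f, ?_, hpV⟩
    obtain ⟨n, hn⟩ := ((hM U f).symMap (I.isAwayRingHom_quotRes U f)).inj (x := x - y)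
      (by rw [map_sub, e, sub_self])
    exact ⟨n, by rw [Algebra.smul_def, map_pow]; exact hn⟩
  · rintro _ ⟨f, hf, rfl⟩
    exact hf

/-- A morphism from `𝕍(M)` to the dilatation over `X`, in charts. -/
theorem exists_chart_hom {M : I.ModulePresheaf} (hM : M.IsQuasicoherent)
    (hJ : J.IsLocallyPrincipal) (g : vectorBundle M hM ⟶ dilatation h hJ)
    (hg : g ≫ dilatationι h hJ = vectorBundleToSubscheme M hM ≫ I.subschemeι)
    (U : X.AffineZariskiSite) :
    ∃ φ : (affineBlowupAlgebra h).obj (op U) ⟶ (symAlgebra M).obj (op U),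
      vectorBundleChart M hM U ≫ g = Spec.map φ ≫ dilatationChart h hJ U ∧
      ∀ a, φ.hom (toAffineBlowupSubring h U a) = (toSymAlgebra M).app (op U) a := by
  have h1 : (vectorBundleChart M hM U ≫ g) ≫ dilatationι h hJ =
      Spec.map ((toSymAlgebra M).app (op U)) ≫ U.isAffineOpen.fromSpec := by
    rw [Category.assoc, hg, ← Category.assoc, vectorBundleChart_toSubscheme,
      symAlgebraToSubscheme_comp]
  have h2 := isPullback_dilatationChart h hJ U
  let g' : Spec ((symAlgebra M).obj (op U)) ⟶ Spec ((affineBlowupAlgebra h).obj (op U)) :=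
    h2.lift _ _ h1
  have hg₁ : g' ≫ dilatationChart h hJ U = vectorBundleChart M hM U ≫ g := h2.lift_fst _ _ h1
  have hg₂ : g' ≫ Spec.map ((toAffineBlowupAlgebra h).app (op U)) =
      Spec.map ((toSymAlgebra M).app (op U)) := h2.lift_snd _ _ h1
  refine ⟨Spec.preimage g', ?_, ?_⟩
  · rw [Spec.map_preimage, hg₁]
  · have h3 : (toAffineBlowupAlgebra h).app (op U) ≫ Spec.preimage g' =
        (toSymAlgebra M).app (op U) := by
      apply Spec.map_injective
      refine (Spec.map_comp _ _).trans ?_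
      rw [Spec.map_preimage]
      exact hg₂
    intro a
    exact congr($(h3).hom a)

theorem comp_dilatationι_of_over (hJ : J.IsEffectiveCartier)
    (e : twistedNormalBundle I hJ ⟶ exceptionalDivisor h hJ.isLocallyPrincipal) :
    (e.left ≫ pullback.fst _ _) ≫ dilatationι h hJ.isLocallyPrincipal =
      vectorBundleToSubscheme _ (isQuasicoherent_twistedConormal I hJ) ≫ I.subschemeι := by
  have h1 : e.left ≫ pullback.snd _ _ =
      vectorBundleToSubscheme _ (isQuasicoherent_twistedConormal I hJ) := Over.w e
  refine ((Category.assoc _ _ _).trans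
    (congrArg (e.left ≫ ·) pullback.condition)).trans ?_
  exact (Category.assoc _ _ _).symm.trans (congrArg (· ≫ I.subschemeι) h1)

/-- The isomorphism defined by the splitting given by `W` satisfies its characterization. -/
theorem isSplitBy_of_isChartHom (hJ : J.IsEffectiveCartier)
    (hZ : IsRegularClosedImmersion (inclusion h))
    {e : twistedNormalBundle I hJ ≅ exceptionalDivisor h hJ.isLocallyPrincipal}
    (he : ∀ U, IsRegularOn I J U → ∃ s φ, IsChartHom h U s φ ∧
      (∀ k (hk : k ∈ K.ideal U.aff), s ⟨k, hK U.aff hk⟩ = 0) ∧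
        vectorBundleChart _ (isQuasicoherent_twistedConormal I hJ) U ≫ e.hom.left ≫ pullback.fst _ _ =
          Spec.map (CommRingCat.ofHom φ) ≫ dilatationChart h hJ.isLocallyPrincipal U) :
    IsSplitBy h hJ hK e := by
  intro U b hb l hl
  have hM := isQuasicoherent_twistedConormal I hJ
  obtain ⟨φ, hφ, -⟩ := exists_chart_hom hM hJ.isLocallyPrincipal (e.hom.left ≫ pullback.fst _ _)
    (comp_dilatationι_of_over hJ e.hom) U
  refine ⟨φ, hφ, fun k a ha => ?_⟩
  refine sym_eq_of_symMap_eq hM fun p hp => ?_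
  obtain ⟨W, hWU, hpW, hW⟩ := exists_basicOpen_isRegularOn hJ hZ U hp
  refine ⟨W, hWU, hpW, ?_⟩
  obtain ⟨s, ψ, hψ, hs, e₁⟩ := he W hW
  let ψ' : (affineBlowupAlgebra h).obj (op W) ⟶ (symAlgebra (twistedConormal I J)).obj (op W) :=
    CommRingCat.ofHom ψ
  -- Both composites describe the same morphism from the chart over W to the chart over U of the
  -- dilatation, which is an open immersion into it.
  have h1 : φ ≫ (symAlgebra (twistedConormal I J)).map (homOfLE hWU).op =
      (affineBlowupAlgebra h).map (homOfLE hWU).op ≫ ψ' := by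
    refine specMap_comp_dilatationChart_injective hJ.isLocallyPrincipal ?_
    calc _ = (Spec.map ((symAlgebra (twistedConormal I J)).map (homOfLE hWU).op) ≫ Spec.map φ) ≫
          dilatationChart h hJ.isLocallyPrincipal U :=
        congrArg (· ≫ dilatationChart h hJ.isLocallyPrincipal U) (Spec.map_comp _ _)
      _ = Spec.map ((symAlgebra (twistedConormal I J)).map (homOfLE hWU).op) ≫
          vectorBundleChart _ hM U ≫ e.hom.left ≫ pullback.fst _ _ :=
        (Category.assoc _ _ _).trans (congrArg (_ ≫ ·) hφ.symm)
      _ = vectorBundleChart _ hM W ≫ e.hom.left ≫ pullback.fst _ _ :=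
        (Category.assoc _ _ _).symm.trans
          (congrArg (· ≫ e.hom.left ≫ pullback.fst _ _) (vectorBundleChart_naturality _ hM hWU))
      _ = Spec.map ψ' ≫ dilatationChart h hJ.isLocallyPrincipal W := e₁
      _ = Spec.map ψ' ≫ Spec.map ((affineBlowupAlgebra h).map (homOfLE hWU).op) ≫
          dilatationChart h hJ.isLocallyPrincipal U :=
        congrArg (Spec.map ψ' ≫ ·)
          (dilatationChart_naturality h hJ.isLocallyPrincipal hWU).symm
      _ = _ := (Category.assoc _ _ _).symm.trans
          (congrArg (· ≫ dilatationChart h hJ.isLocallyPrincipal U) (Spec.map_comp _ _).symm)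
  have h2 : symMap (I.quotRes hWU) ((twistedConormal I J).res hWU) (φ.hom a) =
      ψ (affineBlowupRes h hWU a) := congr($(h1).hom a)
  let b' : J.ideal W.aff := ⟨resHom (AffineZariskiSite.le hWU) b.1,
    J.ideal_le_comap_ideal (AffineZariskiSite.aff_mono hWU) b.2⟩
  have hb' : J.ideal W.aff = Ideal.span {b'.1} := by
    have : (J.ideal U.aff).map (resHom (AffineZariskiSite.le hWU)) = Ideal.span {b'.1} := by
      conv_lhs => rw [hb, Ideal.map_span, Set.image_singleton]
    rw [← this, J.map_resHom (AffineZariskiSite.aff_mono hWU)]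
  have hl' : dualRes (isQuasicoherent_idealRestrict I J) hWU l (idealRestrictMk I J W b') = 1 := by
    rw [← res_idealRestrictMk hWU b, dualRes_apply, hl, map_one]
  have hk' : resHom (AffineZariskiSite.le hWU) k.1 ∈ K.ideal W.aff :=
    K.ideal_le_comap_ideal (AffineZariskiSite.aff_mono hWU) k.2
  have hres : resHom (J.outside_le W.aff) b'.1 * (affineBlowupRes h hWU a).1 =
      resHom (J.outside_le W.aff) (resHom (AffineZariskiSite.le hWU) k.1) := by
    change resHom (J.outside_le W.aff) (resHom (AffineZariskiSite.le hWU) b.1) * _ = _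
    rw [← resHom_comm J (AffineZariskiSite.le hWU), ← resHom_comm J (AffineZariskiSite.le hWU), ← ha,
      map_mul]
    rfl
  have h3 := hψ.fraction b' hb' _ hl' ⟨resHom (AffineZariskiSite.le hWU) k.1, hK W.aff hk'⟩ _ hres
  rw [hs _ hk', map_zero, map_zero, add_zero] at h3
  refine (h2.trans h3).trans (Eq.symm ((symMap_ι _ _).trans (congrArg _ ?_)))
  rfl

/-- On functions from X the chart homomorphisms are forced by being over Z, and on fractions k / b
with k ∈ K by hypothesis. Any z ∈ I has the form k + c b, so z / b = k / b + c and everything is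
determined. -/
theorem IsSplitBy.unique (hJ : J.IsEffectiveCartier) (hZ : IsRegularClosedImmersion (inclusion h))
    (hI : I = K ⊔ J)
    {e e' : twistedNormalBundle I hJ ≅ exceptionalDivisor h hJ.isLocallyPrincipal}
    (he : IsSplitBy h hJ hK e) (he' : IsSplitBy h hJ hK e') : e = e' := by
  have hM := isQuasicoherent_twistedConormal I hJ
  have key : e.hom.left ≫ pullback.fst _ _ = e'.hom.left ≫ pullback.fst _ _ := by
    refine vectorBundle_hom_ext hM (S := {U | IsRegularOn I J U}) (fun x => ?_) fun U hU => ?_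
    · obtain ⟨U, hx, hU⟩ := exists_isRegularOn hJ hZ x
      exact ⟨U, hU, hx⟩
    obtain ⟨b, hb, hb0, l, hl⟩ := IsRegularOn.exists_generator hU
    obtain ⟨φ, hφ, hφK⟩ := he U b hb l hl
    obtain ⟨φ', hφ', hφK'⟩ := he' U b hb l hl
    obtain ⟨ψ, hψ, hψB⟩ := exists_chart_hom hM hJ.isLocallyPrincipal (e.hom.left ≫ pullback.fst _ _)
      (comp_dilatationι_of_over hJ e.hom) U
    obtain ⟨ψ', hψ', hψB'⟩ := exists_chart_hom hM hJ.isLocallyPrincipal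
      (e'.hom.left ≫ pullback.fst _ _) (comp_dilatationι_of_over hJ e'.hom) U
    obtain rfl : φ = ψ :=
      specMap_comp_dilatationChart_injective hJ.isLocallyPrincipal (hφ.symm.trans hψ)
    obtain rfl : φ' = ψ' :=
      specMap_comp_dilatationChart_injective hJ.isLocallyPrincipal (hφ'.symm.trans hψ')
    have h0 (a) : φ.hom (toAffineBlowupSubring h U a) = φ'.hom (toAffineBlowupSubring h U a) :=
      (hψB a).trans (hψB' a).symm
    have h1 : φ.hom = φ'.hom := by
      refine affineBlowupSubring_ringHom_ext hb h0 fun z t ht => ?_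
      obtain ⟨k, hk, j, hj, hz⟩ := exists_add_of_eq_sup hI z
      obtain ⟨c, hc⟩ := Ideal.mem_span_singleton'.mp
        (show j ∈ Ideal.span {b.1} by rw [← hb]; exact hj)
      have ht' : resHom (J.outside_le U.aff) b.1 * (t - toAffineBlowupSubring h U c).1 =
          resHom (J.outside_le U.aff) k := by
        change resHom (J.outside_le U.aff) b.1 * (t.1 - resHom (J.outside_le U.aff) c) = _
        rw [mul_sub, ht, ← map_mul, ← map_sub, ← hz, ← hc]
        congr 1
        ring
      have h2 : φ.hom (t - toAffineBlowupSubring h U c) = φ'.hom (t - toAffineBlowupSubring h U c) :=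
        (hφK ⟨k, hk⟩ _ ht').trans (hφK' ⟨k, hk⟩ _ ht').symm
      exact RingHom.apply_eq_of_apply_sub_eq h2 (h0 c)
    have h2 : φ = φ' := CommRingCat.hom_ext h1
    exact hφ.trans (h2 ▸ hφ'.symm)
  have key' : e.hom.left ≫ pullback.snd _ _ = e'.hom.left ≫ pullback.snd _ _ :=
    (Over.w e.hom).trans (Over.w e'.hom).symm
  exact Iso.ext (Over.OverMorphism.ext (pullback.hom_ext key key'))

theorem existsUnique_isSplitBy (hJ : J.IsEffectiveCartier)
    (hZ : IsRegularClosedImmersion (inclusion h))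
    (hp : IsPullback (inclusion hK) (inclusion h) K.subschemeι J.subschemeι)
    (hC : (inclusion hK).ker.IsEffectiveCartier) :
    ∃! e : twistedNormalBundle I hJ ≅ exceptionalDivisor h hJ.isLocallyPrincipal,
      IsSplitBy h hJ hK e := by
  have hI := eq_sup_of_isPullback hp
  have hpr (U) (hU : IsRegularOn I J U) : ∃ b, J.ideal U.aff = Ideal.span {b} := by
    obtain ⟨b, -, -, -, hb, -⟩ := hU
    exact ⟨b, hb⟩
  choose s hs hs₀ using fun U hU => exists_isSplitting_of_transversal h hI hC (hpr U hU)
  obtain ⟨e, he⟩ := exists_iso_of_isSplitting hJ hZ s hs fun U hU V hVU z =>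
    IsSplitting.res_eq_of_transversal hI hVU (hs U hU) (hs₀ U hU) (hs V _) (hs₀ V _) z
  refine ⟨e, isSplitBy_of_isChartHom hJ hZ fun U hU => ?_, fun e' he' => ?_⟩
  · obtain ⟨φ, hφ, h1⟩ := he U hU
    exact ⟨s U hU, φ, hφ, hs₀ U hU, h1⟩
  · exact IsSplitBy.unique hJ hZ hI he' (isSplitBy_of_isChartHom hJ hZ fun U hU => by
      obtain ⟨φ, hφ, h1⟩ := he U hU
      exact ⟨s U hU, φ, hφ, hs₀ U hU, h1⟩)

end ModulePresheaf
end IdealSheafData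
end AlgebraicGeometry.Scheme

/-! ### Morphisms and internal homomorphisms of modules on Z -/

theorem dualTensorHom_map_apply {R R' N N' M M' : Type*} [CommRing R] [CommRing R']
    [AddCommGroup N] [AddCommGroup N'] [AddCommGroup M] [AddCommGroup M'] [Module R N] [Module R' N']
    [Module R M] [Module R' M'] {σ : R →+* R'} {g : N →ₛₗ[σ] N'}
    (d : Module.Dual R N →ₛₗ[σ] Module.Dual R' N') (m : M →ₛₗ[σ] M')
    (hd : ∀ l y, d l (g y) = σ (l y)) (x : Module.Dual R N ⊗[R] M) (y : N) :
    dualTensorHom R' N' M' (TensorProduct.map d m x) (g y) = m (dualTensorHom R N M x y) := by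
  induction x with
  | zero => simp only [map_zero, LinearMap.zero_apply]
  | add a b ha hb => simp only [map_add, LinearMap.add_apply, ha, hb]
  | tmul l z =>
    rw [TensorProduct.map_tmul, dualTensorHom_apply, dualTensorHom_apply, hd, m.map_smulₛₗ]

namespace AlgebraicGeometry.Scheme
variable {X : Scheme.{u}}
namespace IdealSheafData
namespace ModulePresheaf

variable {I J : X.IdealSheafData} {L M N N' : I.ModulePresheaf}

/-- Finite presentation of the sections of a quasi-coherent module is a local property. -/
theorem IsQuasicoherent.finitePresentation (hM : M.IsQuasicoherent) {U : X.AffineZariskiSite}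
    (h : ∀ x ∈ U.aff.1, ∃ V ≤ U, x ∈ V.aff.1 ∧ Module.FinitePresentation (I.quot V) (M.obj V)) :
    Module.FinitePresentation (I.quot U) (M.obj U) := by
  let s : Set Γ(X, U.aff) := {f | Module.FinitePresentation (I.quot (U.basicOpen f))
    (M.obj (U.basicOpen f))}
  have hs : Ideal.span (Ideal.Quotient.mk (I.ideal U.aff) '' s) = ⊤ := span_mk_eq_top fun x hx => by
    obtain ⟨V, hV, hxV, hfp⟩ := h x hx
    obtain ⟨f, hf⟩ := hV
    obtain rfl : U.basicOpen f = V := Subtype.ext hf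
    exact ⟨f, hfp, hxV⟩
  let s' : Set (I.quot U) := Ideal.Quotient.mk (I.ideal U.aff) '' s
  have hr (r : s') : ∃ f ∈ s, Ideal.Quotient.mk (I.ideal U.aff) f = r.1 := r.2
  choose f hf hfr using hr
  let R' (r : s') : Type u := I.quot (U.basicOpen (f r))
  let M' (r : s') : Type u := M.obj (U.basicOpen (f r))
  letI (r : s') : Algebra (I.quot U) (R' r) := (I.quotRes (U.basicOpen_le (f r))).toAlgebra
  letI (r : s') : Module (I.quot U) (M' r) :=
    Module.compHom (M' r) (I.quotRes (U.basicOpen_le (f r)))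
  haveI (r : s') : IsScalarTower (I.quot U) (R' r) (M' r) := ⟨fun a b c => by
    change (I.quotRes (U.basicOpen_le (f r)) a * b) • c =
      I.quotRes (U.basicOpen_le (f r)) a • b • c
    rw [mul_smul]⟩
  haveI (r : s') : IsLocalization.Away r.1 (R' r) := by
    rw [← hfr r]
    exact I.isAwayRingHom_quotRes U (f r)
  let ϕ (r : s') : M.obj U →ₗ[I.quot U] M' r :=
    { toFun := M.res (U.basicOpen_le (f r))
      map_add' := map_add _
      map_smul' := (M.res (U.basicOpen_le (f r))).map_smulₛₗ }
  haveI (r : s') : IsLocalizedModule (Submonoid.powers r.1) (ϕ r) := by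
    rw [← hfr r]
    exact (hM U (f r)).isLocalizedModule (I.isAwayRingHom_quotRes U (f r))
  exact Module.FinitePresentation.of_localizationSpan' s' hs (Rₚ := R') ϕ fun r => hf r

/-! ### Morphisms and internal homomorphisms -/

/-- Morphisms of modules on `Z`. -/
structure Hom (M N : I.ModulePresheaf) where
  /-- the homomorphism over `Z ∩ U` -/
  app : ∀ U, M.obj U →ₗ[I.quot U] N.obj U
  res_app : ∀ {U V : X.AffineZariskiSite} (h : U ≤ V) (x : M.obj V),
    N.res h (app V x) = app U (M.res h x)

/-- The map on compatible families induced by a morphism. -/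
def Hom.sectionsMap (f : Hom M N) (V : I.subscheme.Opens) : M.sections V →+ N.sections V where
  toFun s := ⟨fun U => f.app U.1 (s.1 U), fun U U' h => by rw [f.res_app, s.2 U U' h]⟩
  map_zero' := Subtype.ext (funext fun U => map_zero (f.app U.1))
  map_add' s t := Subtype.ext (funext fun U => map_add (f.app U.1) (s.1 U) (t.1 U))

/-- The morphism of presheaves of abelian groups induced by a morphism of modules. -/
def Hom.toPresheafMap (f : Hom M N) : M.toPresheaf ⟶ N.toPresheaf where
  app V := AddCommGrpCat.ofHom (f.sectionsMap V.unop)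
  naturality _ _ _ := rfl

theorem IsQuasicoherent.existsUnique_hom (hN : N.IsQuasicoherent) (M : I.ModulePresheaf)
    {U V : X.AffineZariskiSite} (h : U ≤ V) (l : N.obj V →ₗ[I.quot V] M.obj V) :
    ∃! l' : N.obj U →ₗ[I.quot U] M.obj U, ∀ x, l' (N.res h x) = M.res h (l x) := by
  obtain ⟨f, hf⟩ := h
  obtain rfl : V.basicOpen f = U := Subtype.ext hf
  exact (hN V f).existsUnique_extend (I.isAwayRingHom_quotRes V f)
    ((M.res (V.basicOpen_le f)).comp l)

/-- The restriction of a homomorphism: the unique homomorphism compatible with it. -/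
noncomputable def homRes (hN : N.IsQuasicoherent) (M : I.ModulePresheaf)
    {U V : X.AffineZariskiSite} (h : U ≤ V) (l : N.obj V →ₗ[I.quot V] M.obj V) :
    N.obj U →ₗ[I.quot U] M.obj U := (hN.existsUnique_hom M h l).choose

theorem homRes_apply (hN : N.IsQuasicoherent) {U V : X.AffineZariskiSite} (h : U ≤ V)
    (l : N.obj V →ₗ[I.quot V] M.obj V) (x : N.obj V) :
    homRes hN M h l (N.res h x) = M.res h (l x) :=
  (hN.existsUnique_hom M h l).choose_spec.1 x

theorem homRes_unique (hN : N.IsQuasicoherent) {U V : X.AffineZariskiSite} (h : U ≤ V)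
    (l : N.obj V →ₗ[I.quot V] M.obj V) (l' : N.obj U →ₗ[I.quot U] M.obj U)
    (hl : ∀ x, l' (N.res h x) = M.res h (l x)) : homRes hN M h l = l' :=
  (hN.existsUnique_hom M h l).unique (homRes_apply hN h l) hl

/-- The module `ℋom(N, M)`. -/
noncomputable def internalHom (hN : N.IsQuasicoherent) (M : I.ModulePresheaf) :
    I.ModulePresheaf where
  obj U := N.obj U →ₗ[I.quot U] M.obj U
  res h :=
    { toFun := homRes hN M h
      map_add' := fun l l' => homRes_unique hN h _ _ fun x => by
        rw [LinearMap.add_apply, LinearMap.add_apply, homRes_apply, homRes_apply, map_add]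
      map_smul' := fun a l => homRes_unique hN h _ _ fun x => by
        rw [LinearMap.smul_apply, LinearMap.smul_apply, homRes_apply, (M.res h).map_smulₛₗ] }
  res_self h l := homRes_unique hN h _ _ fun x => by rw [N.res_self, M.res_self]
  res_res h h' l := (homRes_unique hN _ _ _ fun x => by
    change homRes hN M h (homRes hN M h' l) _ = _
    rw [← N.res_res h h', homRes_apply, homRes_apply, M.res_res]).symm

/-- A homomorphism is glued value by value, from the restrictions of a section to the members of the
covering. Only the sheaf property is claimed: quasi-coherence would call for a finiteness condition
on N, and the argument does not need it. -/
theorem IsZariskiSheaf.internalHom (hN : N.IsQuasicoherent) (hM : M.IsZariskiSheaf) :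
    (internalHom hN M).IsZariskiSheaf := by
  refine ⟨fun {U} l l' h => LinearMap.ext fun x => hM.eq_of_res_eq _ _ fun p hp => ?_,
    fun {U S} hS hU m hm => ?_⟩
  · obtain ⟨V, hV, hpV, e⟩ := h p hp
    refine ⟨V, hV, hpV, ?_⟩
    rw [← homRes_apply hN hV l, ← homRes_apply hN hV l']
    exact DFunLike.congr_fun (show homRes hN M hV l = homRes hN M hV l' from e) (N.res hV x)
  let m₁ : ∀ V ∈ S, N.obj V →ₗ[I.quot V] M.obj V := m
  have hm₁ V (hV : V ∈ S) W (h : W ≤ V) (x : N.obj V) :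
      M.res h (m₁ V hV x) = m₁ W (hS V hV W h) (N.res h x) := by
    rw [← homRes_apply hN h]
    exact DFunLike.congr_fun (show homRes hN M h (m₁ V hV) = m₁ W (hS V hV W h) from hm V hV W h)
      (N.res h x)
  -- Members of S need not lie below U, but a section over U can only be restricted to those that
  -- do.
  let S' : Set X.AffineZariskiSite := {V | V ∈ S ∧ V ≤ U}
  have hS' : ∀ V ∈ S', ∀ W ≤ V, W ∈ S' := fun V hV W h => ⟨hS V hV.1 W h, h.trans hV.2⟩
  have hU' : ∀ x ∈ U.aff.1, ∃ V ≤ U, V ∈ S' ∧ x ∈ V.aff.1 := fun x hx => by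
    obtain ⟨V, hV, hVS, hxV⟩ := hU x hx
    exact ⟨V, hV, ⟨hVS, hV⟩, hxV⟩
  choose y hy using fun x : N.obj U => hM.exists_glue hS' hU'
    (fun V hV => m₁ V hV.1 (N.res hV.2 x)) fun V hV W h => by
      rw [hm₁, N.res_res]
  have hext (a b : M.obj U) (hab : ∀ V (hV : V ∈ S'), M.res hV.2 a = M.res hV.2 b) : a = b :=
    hM.eq_of_res_eq _ _ fun p hp => by
      obtain ⟨V, hV, hVS, hpV⟩ := hU' p hp
      exact ⟨V, hV, hpV, hab V hVS⟩
  refine ⟨({ toFun := y, map_add' := fun a b => ?_, map_smul' := fun c a => ?_ } :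
    N.obj U →ₗ[I.quot U] M.obj U), fun V hV h => ?_⟩
  · refine hext _ _ fun V hV => ?_
    rw [map_add, hy _ V hV, hy _ V hV, hy _ V hV, map_add, map_add]
  · refine hext _ _ fun V hV => ?_
    rw [RingHom.id_apply, (M.res _).map_smulₛₗ, hy _ V hV, hy _ V hV, (N.res _).map_smulₛₗ,
      map_smul]
  · exact homRes_unique hN h _ _ fun x => (hy x V ⟨hV, h⟩ h).symm

/-- Composition with a morphism. -/
noncomputable def internalHomPrecomp (hN : N.IsQuasicoherent) (hN' : N'.IsQuasicoherent)
    (f : Hom N N') (M : I.ModulePresheaf) : Hom (internalHom hN' M) (internalHom hN M) where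
  app U :=
    { toFun := fun l => LinearMap.comp (show N'.obj U →ₗ[I.quot U] M.obj U from l) (f.app U)
      map_add' := fun _ _ => rfl
      map_smul' := fun _ _ => rfl }
  res_app {U V} h l := homRes_unique hN h _ _ fun x => by
    change (show N'.obj U →ₗ[I.quot U] M.obj U from (internalHom hN' M).res h l)
      (f.app U (N.res h x)) = _
    rw [← f.res_app]
    exact homRes_apply hN' h _ _

/-- The morphism `Nᵛ ⊗ M ⟶ ℋom(N, M)`. -/
noncomputable def dualTensor (hN : N.IsQuasicoherent) (M : I.ModulePresheaf) :
    Hom ((N.dual hN).tensor M) (internalHom hN M) where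
  app U := dualTensorHom (I.quot U) (N.obj U) (M.obj U)
  res_app {U V} h x := by
    exact homRes_unique hN h _ _ fun y =>
      dualTensorHom_map_apply ((N.dual hN).res h) (M.res h) (dualRes_apply hN h) x y

/-- Composition of morphisms. -/
def Hom.comp (g : Hom M N) (f : Hom L M) : Hom L N where
  app U := (g.app U).comp (f.app U)
  res_app h x := (g.res_app h _).trans (congrArg _ (f.res_app h x))

/-- The morphism of subquotients induced by inclusions. -/
def subquotientMap {P Q P' Q' : X.IdealSheafData} (hPQ : I * Q ≤ P) (hPQ' : I * Q' ≤ P')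
    (hP : P ≤ P') (hQ : Q ≤ Q') : Hom (subquotient hPQ) (subquotient hPQ') where
  app U :=
    letI := (isTorsionBySet_subquotientObj hPQ U).module
    letI := (isTorsionBySet_subquotientObj hPQ' U).module
    { toFun := Submodule.mapQ ((P.ideal U.aff).submoduleOf (Q.ideal U.aff))
        ((P'.ideal U.aff).submoduleOf (Q'.ideal U.aff)) (Submodule.inclusion (hQ U.aff))
        fun x hx => hP U.aff hx
      map_add' := map_add _
      map_smul' := fun a x => by
        obtain ⟨a, rfl⟩ := Ideal.Quotient.mk_surjective a
        obtain ⟨x, rfl⟩ := Submodule.Quotient.mk_surjective _ x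
        rfl }
  res_app h x := by
    obtain ⟨x, rfl⟩ := Submodule.Quotient.mk_surjective _ x
    rfl

end ModulePresheaf
end IdealSheafData
end AlgebraicGeometry.Scheme

/-! ### The sequence N_{Z/D} ⊗ J_Z → ℋom(I/I², J_Z) → ℋom(J_Z, J_Z) -/

namespace AlgebraicGeometry.Scheme
variable {X : Scheme.{u}}
namespace IdealSheafData
namespace ModulePresheaf

variable {I J : X.IdealSheafData} {h : J ≤ I} {U : X.AffineZariskiSite}

theorem finitePresentation_conormal_of_isRegularOn (hU : IsRegularOn I J U) :
    Module.FinitePresentation (I.quot U) ((conormal I J).obj U) := by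
  obtain ⟨b, x, n, hr, hJ, hI⟩ := hU
  let q : I.ideal U.aff →ₛₗ[Ideal.Quotient.mk (I.ideal U.aff)] (conormal I J).obj U :=
    { toFun := conormalMk I J U, map_add' := fun _ _ => rfl, map_smul' := fun _ _ => rfl }
  have B := hr.basis (q := q) hI conormalMk_surjective
    (fun z => by rw [← hJ]; exact conormalMk_eq_zero_iff z)
    fun i hi => hI ▸ mem_partialIdeal_of_lt b x hi
  have := Module.Free.of_basis B
  have := Module.Finite.of_basis B
  exact Module.finitePresentation_of_projective _ _

/-- Duals localize for finitely presented modules, and the conormal sheaf is locally free of finite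
rank by regularity. -/
theorem isQuasicoherent_twistedNormal (hJ : J.IsEffectiveCartier)
    (hZ : IsRegularClosedImmersion (inclusion h)) : (twistedNormal I J).IsQuasicoherent :=
  ((isQuasicoherent_conormal I J).dual fun U =>
    (isQuasicoherent_conormal I J).finitePresentation fun x hx => by
      obtain ⟨V, hV, hxV, hr⟩ := exists_basicOpen_isRegularOn hJ hZ U hx
      exact ⟨V, hV, hxV, finitePresentation_conormal_of_isRegularOn hr⟩).tensor
    (isQuasicoherent_idealRestrict I J)

/-- The module `I/I²` on `Z = V(I)`. -/
def firstOrder (I : X.IdealSheafData) : I.ModulePresheaf :=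
  subquotient (P := I * I) (Q := I) le_rfl

theorem isQuasicoherent_firstOrder (I : X.IdealSheafData) : (firstOrder I).IsQuasicoherent :=
  isQuasicoherent_subquotient _

/-- The class of a section of `I` in `I/I²`. -/
def firstOrderMk (I : X.IdealSheafData) (U : X.AffineZariskiSite) :
    I.ideal U.aff →ₛₗ[Ideal.Quotient.mk (I.ideal U.aff)] (firstOrder I).obj U where
  toFun := Submodule.Quotient.mk (p := ((I * I).ideal U.aff).submoduleOf (I.ideal U.aff))
  map_add' _ _ := rfl
  map_smul' _ _ := rfl

theorem firstOrderMk_surjective : Function.Surjective (firstOrderMk I U) :=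
  Submodule.Quotient.mk_surjective _

theorem firstOrderMk_eq_zero_iff (x : I.ideal U.aff) : firstOrderMk I U x = 0 ↔
    x.1 ∈ I.ideal U.aff * I.ideal U.aff :=
  Submodule.Quotient.mk_eq_zero _

/-- The projection `I/I² ⟶ C_{Z/D}`. -/
def firstOrderToConormal (I J : X.IdealSheafData) : Hom (firstOrder I) (conormal I J) :=
  subquotientMap _ _ le_sup_left le_rfl

/-- The morphism `J|_Z ⟶ I/I²`. -/
def idealRestrictToFirstOrder (h : J ≤ I) : Hom (idealRestrict I J) (firstOrder I) :=
  subquotientMap _ _ (fun _ => Ideal.mul_mono_right (h _)) h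

theorem idealRestrictToFirstOrder_mk (h : J ≤ I) (x : J.ideal U.aff) :
    (idealRestrictToFirstOrder h).app U (idealRestrictMk I J U x) =
      firstOrderMk I U ⟨x.1, h U.aff x.2⟩ := rfl

/-- The module `ℋom(I/I², J_Z)`. -/
noncomputable def firstOrderHom (I J : X.IdealSheafData) : I.ModulePresheaf :=
  internalHom (isQuasicoherent_firstOrder I) (idealRestrict I J)

/-- The module `ℋom(J_Z, J_Z)`. -/
noncomputable def idealRestrictEnd (I J : X.IdealSheafData) : I.ModulePresheaf :=
  internalHom (isQuasicoherent_idealRestrict I J) (idealRestrict I J)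

theorem isZariskiSheaf_firstOrderHom : (firstOrderHom I J).IsZariskiSheaf :=
  (isQuasicoherent_idealRestrict I J).isZariskiSheaf.internalHom _

theorem isZariskiSheaf_idealRestrictEnd : (idealRestrictEnd I J).IsZariskiSheaf :=
  (isQuasicoherent_idealRestrict I J).isZariskiSheaf.internalHom _

/-- The morphism `N_{Z/D} ⊗ J_Z ⟶ ℋom(I/I², J_Z)`. -/
noncomputable def twistedNormalToHom (I J : X.IdealSheafData) :
    Hom (twistedNormal I J) (firstOrderHom I J) :=
  (internalHomPrecomp (isQuasicoherent_firstOrder I) (isQuasicoherent_conormal I J)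
    (firstOrderToConormal I J) (idealRestrict I J)).comp
      (dualTensor (isQuasicoherent_conormal I J) (idealRestrict I J))

/-- The morphism `ℋom(I/I², J_Z) ⟶ ℋom(J_Z, J_Z)`. -/
noncomputable def firstOrderHomToEnd (h : J ≤ I) : Hom (firstOrderHom I J) (idealRestrictEnd I J) :=
  internalHomPrecomp (isQuasicoherent_idealRestrict I J) (isQuasicoherent_firstOrder I)
    (idealRestrictToFirstOrder h) (idealRestrict I J)

/-- A section of `ℋom(I/I², J_Z)` as a linear map. -/
noncomputable def firstOrderHomEquiv : (firstOrderHom I J).obj U ≃ₗ[I.quot U]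
    ((firstOrder I).obj U →ₗ[I.quot U] (idealRestrict I J).obj U) :=
  LinearEquiv.refl _ _

/-- A section of `ℋom(J_Z, J_Z)` as a linear map. -/
noncomputable def idealRestrictEndEquiv : (idealRestrictEnd I J).obj U ≃ₗ[I.quot U]
    ((idealRestrict I J).obj U →ₗ[I.quot U] (idealRestrict I J).obj U) :=
  LinearEquiv.refl _ _

theorem firstOrderHomEquiv_res {V : X.AffineZariskiSite} (hUV : U ≤ V)
    (t : (firstOrderHom I J).obj V) (x) :
    firstOrderHomEquiv ((firstOrderHom I J).res hUV t) ((firstOrder I).res hUV x) =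
      (idealRestrict I J).res hUV (firstOrderHomEquiv t x) :=
  homRes_apply (isQuasicoherent_firstOrder I) hUV _ x

theorem idealRestrictEndEquiv_symm_one_res {V : X.AffineZariskiSite} (hUV : U ≤ V) :
    (idealRestrictEnd I J).res hUV (idealRestrictEndEquiv.symm LinearMap.id) =
      idealRestrictEndEquiv.symm LinearMap.id :=
  homRes_unique (isQuasicoherent_idealRestrict I J) hUV _ _ fun _ => rfl

theorem idealRestrictEndEquiv_firstOrderHomToEnd (h : J ≤ I) (t : (firstOrderHom I J).obj U) (y) :
    idealRestrictEndEquiv ((firstOrderHomToEnd h).app U t) y =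
      firstOrderHomEquiv t ((idealRestrictToFirstOrder h).app U y) := rfl

theorem firstOrderHomEquiv_twistedNormalToHom
    (d : Module.Dual (I.quot U) ((conormal I J).obj U)) (y : (idealRestrict I J).obj U)
    (x : I.ideal U.aff) :
    firstOrderHomEquiv ((twistedNormalToHom I J).app U
      (d ⊗ₜ y : Module.Dual (I.quot U) ((conormal I J).obj U) ⊗[I.quot U] (idealRestrict I J).obj U))
        (firstOrderMk I U x) = d (conormalMk I J U x) • y :=
  dualTensorHom_apply _ _ _

/-- A homomorphism coming from the conormal sheaf kills the image of J_Z, since J has class zero in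
I/(I² + J). -/
theorem firstOrderHomToEnd_twistedNormalToHom (h : J ≤ I) (x : (twistedNormal I J).obj U) :
    (firstOrderHomToEnd h).app U ((twistedNormalToHom I J).app U x) = 0 := by
  change Module.Dual (I.quot U) ((conormal I J).obj U) ⊗[I.quot U] (idealRestrict I J).obj U at x
  induction x with
  | zero => exact (congrArg _ (map_zero ((twistedNormalToHom I J).app U))).trans (map_zero _)
  | add a b ha hb =>
    exact (congrArg _ (map_add ((twistedNormalToHom I J).app U) a b)).trans ((map_add _ _ _).trans
      ((congrArg₂ (· + ·) ha hb).trans (add_zero _)))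
  | tmul d y =>
    refine idealRestrictEndEquiv.injective (LinearMap.ext fun j => ?_)
    obtain ⟨j, rfl⟩ := idealRestrictMk_surjective j
    rw [idealRestrictEndEquiv_firstOrderHomToEnd, idealRestrictToFirstOrder_mk]
    refine (firstOrderHomEquiv_twistedNormalToHom d y _).trans ?_
    rw [(conormalMk_eq_zero_iff ⟨j.1, h U.aff j.2⟩).mpr (Ideal.mem_sup_right j.2), map_zero, zero_smul]
    rfl

variable {b : J.ideal U.aff} {l : Module.Dual (I.quot U) ((idealRestrict I J).obj U)}

theorem exists_eq_tmul (hb : J.ideal U.aff = Ideal.span {b.1})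
    (x : Module.Dual (I.quot U) ((conormal I J).obj U) ⊗[I.quot U] (idealRestrict I J).obj U) :
    ∃ d, x = d ⊗ₜ idealRestrictMk I J U b := by
  induction x with
  | zero => exact ⟨0, (TensorProduct.zero_tmul _ _).symm⟩
  | add x y hx hy =>
    obtain ⟨d, rfl⟩ := hx
    obtain ⟨d', rfl⟩ := hy
    exact ⟨d + d', (TensorProduct.add_tmul _ _ _).symm⟩
  | tmul d y =>
    obtain ⟨a, rfl⟩ := exists_smul_idealRestrictMk hb y
    exact ⟨a • d, by rw [TensorProduct.smul_tmul]⟩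

/-- Every tensor is of the form d ⊗ [b] and acts by c ↦ d(c) [b]; applying the form dual to [b]
recovers d. -/
theorem twistedNormalToHom_injective (hU : IsRegularOn I J U) :
    Function.Injective ((twistedNormalToHom I J).app U) := by
  obtain ⟨b, hb, -, l, hl⟩ := hU.exists_generator
  rw [injective_iff_map_eq_zero]
  intro x hx
  obtain ⟨d, rfl⟩ := exists_eq_tmul hb x
  obtain rfl : d = 0 := by
    ext c
    obtain ⟨c, rfl⟩ := conormalMk_surjective c
    have h1 := (firstOrderHomEquiv_twistedNormalToHom d (idealRestrictMk I J U b) c).symm.trans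
      (congrArg (fun t => firstOrderHomEquiv t (firstOrderMk I U c)) hx)
    have h2 := congrArg l h1
    rw [map_smul, hl, smul_eq_mul, mul_one] at h2
    refine h2.trans ?_
    change l ((firstOrderHomEquiv (0 : (firstOrderHom I J).obj U)) (firstOrderMk I U c)) = 0
    rw [map_zero, LinearMap.zero_apply, map_zero]
  exact TensorProduct.zero_tmul _ _

/-- A homomorphism vanishing on J factors through the conormal module. Following it by the form l
dual to [b] gives d, and the homomorphism is the image of d ⊗ [b]. -/
theorem exists_twistedNormalToHom_eq (h : J ≤ I) (hU : IsRegularOn I J U)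
    {t : (firstOrderHom I J).obj U} (ht : (firstOrderHomToEnd h).app U t = 0) :
    ∃ x, (twistedNormalToHom I J).app U x = t := by
  obtain ⟨b, hb, -, l, hl⟩ := hU.exists_generator
  have ht' (j : J.ideal U.aff) : firstOrderHomEquiv t (firstOrderMk I U ⟨j.1, h U.aff j.2⟩) = 0 := by
    have := congrArg (fun t => idealRestrictEndEquiv t (idealRestrictMk I J U j)) ht
    exact this
  have hker (x y : I.ideal U.aff) (hxy : conormalMk I J U x = conormalMk I J U y) :
      firstOrderHomEquiv t (firstOrderMk I U x) = firstOrderHomEquiv t (firstOrderMk I U y) := by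
    have h1 : conormalMk I J U (x - y) = 0 := sub_eq_zero.mpr hxy
    rw [conormalMk_eq_zero_iff, Submodule.mem_sup] at h1
    obtain ⟨c, hc, j, hj, e⟩ := h1
    rw [← sub_eq_zero, ← map_sub, ← map_sub]
    have hcI : c ∈ I.ideal U.aff := Ideal.mul_le_right hc
    obtain e' : x - y = ⟨c, hcI⟩ + ⟨j, h U.aff hj⟩ := Subtype.ext e.symm
    rw [e', map_add, map_add, (firstOrderMk_eq_zero_iff ⟨c, hcI⟩).mpr hc, map_zero, zero_add]
    exact ht' ⟨j, hj⟩
  choose r hr using fun c => conormalMk_surjective (I := I) (J := J) (U := U) c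
  let d : Module.Dual (I.quot U) ((conormal I J).obj U) :=
    { toFun c := l (firstOrderHomEquiv t (firstOrderMk I U (r c)))
      map_add' c c' := by
        rw [hker (r (c + c')) (r c + r c'), map_add, map_add, map_add]
        rw [hr]
        exact congrArg₂ (· + ·) (hr c).symm (hr c').symm
      map_smul' a c := by
        obtain ⟨a, rfl⟩ := Ideal.Quotient.mk_surjective a
        rw [hker (r (Ideal.Quotient.mk _ a • c)) (a • r c), (firstOrderMk I U).map_smulₛₗ, map_smul,
          map_smul, RingHom.id_apply]
        rw [hr]
        exact congrArg (Ideal.Quotient.mk (I.ideal U.aff) a • ·) (hr c).symm }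
  refine ⟨(d ⊗ₜ idealRestrictMk I J U b : Module.Dual (I.quot U) ((conormal I J).obj U)
    ⊗[I.quot U] (idealRestrict I J).obj U), firstOrderHomEquiv.injective (LinearMap.ext fun x => ?_)⟩
  obtain ⟨x, rfl⟩ := firstOrderMk_surjective x
  refine (firstOrderHomEquiv_twistedNormalToHom d _ x).trans ?_
  change l (firstOrderHomEquiv t (firstOrderMk I U (r (conormalMk I J U x)))) • _ = _
  rw [hker _ x (hr _)]
  exact (eq_smul_idealRestrictMk hb hl _).symm

/-- A section of `ℋom(I/I², J_Z)` mapping to the identity of `J_Z` is a splitting. -/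
theorem isSplitting_of_firstOrderHomToEnd (h : J ≤ I) {t : (firstOrderHom I J).obj U}
    (ht : (firstOrderHomToEnd h).app U t = idealRestrictEndEquiv.symm LinearMap.id) :
    IsSplitting h U ((firstOrderHomEquiv t).comp (firstOrderMk I U)) := fun j =>
  congrArg (fun t => idealRestrictEndEquiv t (idealRestrictMk I J U j)) ht

/-- A local splitting kills I², because it is linear over functions on X with values in a module on
Z; so it descends to I/I². -/
theorem exists_firstOrderHomToEnd_eq_id (h : J ≤ I) (hU : IsRegularOn I J U) :
    ∃ t, (firstOrderHomToEnd h).app U t = idealRestrictEndEquiv.symm LinearMap.id := by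
  obtain ⟨s, hs⟩ := exists_isSplitting h hU
  have hker (x : I.ideal U.aff) (hx : x.1 ∈ I.ideal U.aff * I.ideal U.aff) : s x = 0 := by
    obtain ⟨x, hxI⟩ := x
    change x ∈ I.ideal U.aff * I.ideal U.aff at hx
    induction hx using Submodule.mul_induction_on' with
    | mem_mul_mem a ha c hc =>
      refine (s.map_smulₛₗ a ⟨c, hc⟩).trans ?_
      rw [Ideal.Quotient.eq_zero_iff_mem.mpr ha, zero_smul]
    | add x hx y hy ex ey =>
      refine (s.map_add ⟨x, Ideal.mul_le_right hx⟩ ⟨y, Ideal.mul_le_right hy⟩).trans ?_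
      rw [ex, ey, add_zero]
  have hker' (x y : I.ideal U.aff) (hxy : firstOrderMk I U x = firstOrderMk I U y) : s x = s y := by
    rw [← sub_eq_zero, ← map_sub]
    refine hker _ ((firstOrderMk_eq_zero_iff _).mp ?_)
    rw [map_sub, hxy, sub_self]
  choose r hr using fun c => firstOrderMk_surjective (I := I) (U := U) c
  let t : (firstOrder I).obj U →ₗ[I.quot U] (idealRestrict I J).obj U :=
    { toFun c := s (r c)
      map_add' c c' := by
        rw [hker' (r (c + c')) (r c + r c'), map_add]
        rw [hr, map_add, hr, hr]
      map_smul' a c := by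
        obtain ⟨a, rfl⟩ := Ideal.Quotient.mk_surjective a
        rw [hker' (r (Ideal.Quotient.mk _ a • c)) (a • r c), s.map_smulₛₗ, RingHom.id_apply]
        rw [hr, (firstOrderMk I U).map_smulₛₗ, hr] }
  refine ⟨firstOrderHomEquiv.symm t, idealRestrictEndEquiv.injective (LinearMap.ext fun j => ?_)⟩
  obtain ⟨j, rfl⟩ := idealRestrictMk_surjective j
  exact (hker' _ ⟨j.1, h U.aff j.2⟩ (hr _)).trans (hs j)

/-- An endomorphism of the free rank-one module J_Z is a scalar, so that scalar times a lift of the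
identity lifts it. -/
theorem exists_firstOrderHomToEnd_eq (h : J ≤ I) (hU : IsRegularOn I J U)
    (q : (idealRestrictEnd I J).obj U) : ∃ t, (firstOrderHomToEnd h).app U t = q := by
  obtain ⟨b, hb, -, l, hl⟩ := hU.exists_generator
  obtain ⟨t, ht⟩ := exists_firstOrderHomToEnd_eq_id h hU
  refine ⟨l (idealRestrictEndEquiv q (idealRestrictMk I J U b)) • t, ?_⟩
  rw [map_smul, ht]
  refine idealRestrictEndEquiv.injective (LinearMap.ext fun y => ?_)
  obtain ⟨a, rfl⟩ := exists_smul_idealRestrictMk hb y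
  rw [map_smul, map_smul, map_smul]
  exact congrArg (a • ·) (eq_smul_idealRestrictMk hb hl _).symm

end ModulePresheaf
end IdealSheafData
end AlgebraicGeometry.Scheme

/-! ### Splittings from the vanishing of H¹ -/

namespace CategoryTheory.Sheaf

variable {C : Type u} [SmallCategory C] {K : GrothendieckTopology C}

/-- Kernels of sheaves are computed objectwise, while surjectivity is only local. -/
theorem shortExact_of_locallySurjective (S : ShortComplex (Sheaf K AddCommGrpCat.{u}))
    (hf : ∀ V, Function.Injective (S.f.hom.app V))
    (hfg : ∀ V x, S.g.hom.app V x = 0 → ∃ y, S.f.hom.app V y = x)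
    (hg : Sheaf.IsLocallySurjective S.g) : S.ShortExact := by
  have hmono : Mono S.f := by
    refine ⟨fun {A} a b hab => ?_⟩
    ext V x
    refine hf V ?_
    exact congr(($hab).hom.app V x)
  have hlim : IsLimit (KernelFork.ofι S.f S.zero) := by
    refine KernelFork.IsLimit.ofι' S.f S.zero fun {A} k hk => ?_
    have hx (V : Cᵒᵖ) (x : A.obj.obj V) : ∃ y, S.f.hom.app V y = k.hom.app V x :=
      hfg V _ congr(($hk).hom.app V x)
    choose y hy using hx
    let l : A ⟶ S.X₁ := ⟨{
      app V := AddCommGrpCat.ofHom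
        { toFun := y V
          map_zero' := hf V (by rw [hy, map_zero, map_zero])
          map_add' a b := hf V (by rw [hy, map_add, map_add, hy, hy]) }
      naturality V W i := by
        ext x
        refine hf W ?_
        have h1 := NatTrans.naturality_apply S.f.hom i (y V x)
        have h2 := NatTrans.naturality_apply k.hom i x
        exact (hy W _).trans (h2.trans ((congrArg _ (hy V x).symm).trans h1.symm)) }⟩
    refine ⟨l, ?_⟩
    ext V x
    exact hy V x
  have hepi : Epi S.g := inferInstance
  exact { exact := S.exact_of_f_is_kernel hlim, mono_f := hmono, epi_g := hepi }

/-- In the long exact sequence the obstruction to lifting a global section lies in H¹ of the kernel.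
-/
theorem exists_app_eq_of_subsingleton_H [HasExt.{u} (Sheaf K AddCommGrpCat.{u})]
    {S : ShortComplex (Sheaf K AddCommGrpCat.{u})} (hS : S.ShortExact)
    (hH : Subsingleton (Sheaf.H S.X₁ 1)) {T : C} (hT : IsTerminal T) (c : S.X₃.obj.obj (op T)) :
    ∃ t : S.X₂.obj.obj (op T), S.g.hom.app (op T) t = c := by
  obtain ⟨x, hx⟩ := Abelian.Ext.covariant_sequence_exact₃ _ hS ((H.equiv₀ S.X₃ hT).symm c)
    (zero_add 1) (Subsingleton.elim _ _)
  refine ⟨H.equiv₀ S.X₂ hT x, ?_⟩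
  rw [H.equiv₀_naturality, H.map_apply, hx, AddEquiv.apply_symm_apply]

end CategoryTheory.Sheaf

namespace AlgebraicGeometry.Scheme
variable {X : Scheme.{u}}
namespace IdealSheafData

/-- Open subsets of Z are induced from X, so traces of basic opens of a given affine open form a
basis of its trace. -/
theorem exists_basicOpen_preimage_le {I : X.IdealSheafData} (U : X.AffineZariskiSite)
    {V : I.subscheme.Opens} {z : I.subscheme} (hzU : I.subschemeι z ∈ U.aff.1) (hz : z ∈ V) :
    ∃ W ≤ U, I.subschemeι z ∈ W.aff.1 ∧ I.subschemeι ⁻¹ᵁ W.aff.1 ≤ V := by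
  obtain ⟨O, hO, e⟩ := I.subschemeι.isClosedEmbedding.isInducing.isOpen_iff.mp V.2
  have e' : ∀ w, I.subschemeι w ∈ O ↔ w ∈ V := Set.ext_iff.mp e
  obtain ⟨f, hf, hzf⟩ := U.isAffineOpen.exists_basicOpen_le (V := ⟨O, hO⟩) ⟨_, (e' z).mpr hz⟩ hzU
  exact ⟨U.basicOpen f, U.basicOpen_le f, hzf, fun w hw => (e' w).mp (hf hw)⟩

theorem exists_isRegularOn_le {I J : X.IdealSheafData} {h : J ≤ I} (hJ : J.IsEffectiveCartier)
    (hZ : IsRegularClosedImmersion (inclusion h)) {V : I.subscheme.Opens} {z : I.subscheme}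
    (hz : z ∈ V) : ∃ U, I.subschemeι z ∈ U.aff.1 ∧ I.subschemeι ⁻¹ᵁ U.aff.1 ≤ V ∧
      IsRegularOn I J U := by
  obtain ⟨U, hzU, hU⟩ := exists_isRegularOn hJ hZ (I.subschemeι z)
  obtain ⟨W, hWU, hzW, hWV⟩ := exists_basicOpen_preimage_le U hzU hz
  exact ⟨W, hzW, hWV, hU.mono hWU⟩

theorem preimage_mono {I : X.IdealSheafData} {U W : X.AffineZariskiSite} (hWU : W ≤ U) :
    I.subschemeι ⁻¹ᵁ W.aff.1 ≤ I.subschemeι ⁻¹ᵁ U.aff.1 :=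
  fun _ h => AffineZariskiSite.le hWU h

namespace ModulePresheaf

variable {I J : X.IdealSheafData} {h : J ≤ I} {M : I.ModulePresheaf}

/-- The affine opens whose trace lies in some V i form a basis for the union. Values taken from the
s i define a family there, which extends by `exists_sections`. -/
theorem IsZariskiSheaf.isSheaf_toPresheaf (hM : M.IsZariskiSheaf) :
    TopCat.Presheaf.IsSheaf (X := I.subscheme) M.toPresheaf := by
  rw [TopCat.Presheaf.isSheaf_iff_isSheafUniqueGluing]
  intro ι V s hs
  have hs' (i j : ι) (U) (hi : I.subschemeι ⁻¹ᵁ U.aff.1 ≤ V i) (hj : I.subschemeι ⁻¹ᵁ U.aff.1 ≤ V j) :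
      (show M.sections (V i) from s i).1 ⟨U, hi⟩ = (show M.sections (V j) from s j).1 ⟨U, hj⟩ :=
    congr((show M.sections (V i ⊓ V j) from $(hs i j)).1 ⟨U, le_inf hi hj⟩)
  let T : Set X.AffineZariskiSite := {U | ∃ i, I.subschemeι ⁻¹ᵁ U.aff.1 ≤ V i}
  have hT : ∀ U ∈ T, ∀ W ≤ U, W ∈ T := fun U ⟨i, hi⟩ W hW =>
    ⟨i, (preimage_mono hW).trans hi⟩
  have hTV : ∀ z ∈ iSup V, ∃ U ∈ T, I.subschemeι z ∈ U.aff.1 := by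
    intro z hz
    obtain ⟨i, hi⟩ := Opens.mem_iSup.mp hz
    obtain ⟨U, hU, hzU, -⟩ := exists_isAffineOpen_mem_and_subset (x := I.subschemeι z) (U := ⊤) trivial
    obtain ⟨W, -, hzW, hWV⟩ := exists_basicOpen_preimage_le (X := X) ⟨U, hU⟩ hzU hi
    exact ⟨W, ⟨i, hWV⟩, hzW⟩
  obtain ⟨t, ht⟩ := exists_sections hM hT hTV
    -- An index is chosen for each U; by compatibility of the s i the value does not depend on it.
    (fun U hU => (show M.sections (V hU.choose) from s hU.choose).1 ⟨U, hU.choose_spec⟩)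
    fun U hU W hWU => by
      have h1 := (preimage_mono hWU).trans hU.choose_spec
      exact ((show M.sections (V hU.choose) from s hU.choose).2 ⟨W, h1⟩ ⟨U, hU.choose_spec⟩
        hWU).trans (hs' _ _ _ _ _)
  refine ⟨t, fun i => Subtype.ext (funext fun U => ?_), fun t' ht' => ?_⟩
  · exact (ht U.1 ⟨i, U.2⟩ (U.2.trans (le_iSup V i))).trans (hs' _ _ _ _ _)
  · refine sections_ext hM fun z hz => ?_
    obtain ⟨U, ⟨i, hi⟩, hzU⟩ := hTV z hz
    refine ⟨U, hi.trans (le_iSup V i), hzU, ?_⟩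
    have h1 : (show M.sections (iSup V) from t').1 ⟨U, hi.trans (le_iSup V i)⟩ =
      (show M.sections (V i) from s i).1 ⟨U, hi⟩ :=
        congr((show M.sections (V i) from $(ht' i)).1 ⟨U, hi⟩)
    exact h1.trans ((hs' i (⟨i, hi⟩ : U ∈ T).choose U hi _).trans (ht U ⟨i, hi⟩ _).symm)

/-- The sheaf of compatible families of sections. -/
def IsZariskiSheaf.sheaf (hM : M.IsZariskiSheaf) : TopCat.Sheaf AddCommGrpCat.{u} I.subscheme :=
  ⟨M.toPresheaf, hM.isSheaf_toPresheaf⟩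

/-- A splitting of `J_Z ⟶ I/I²` identifies the exceptional divisor with `𝕍(C_{Z/D} ⊗ J_Z⁻¹)`. -/
theorem nonempty_iso_of_sections (hJ : J.IsEffectiveCartier)
    (hZ : IsRegularClosedImmersion (inclusion h)) (t : (firstOrderHom I J).sections ⊤)
    (ht : ∀ U, IsRegularOn I J U → (firstOrderHomToEnd h).app U (t.1 ⟨U, le_top⟩) =
      idealRestrictEndEquiv.symm LinearMap.id) :
    Nonempty (exceptionalDivisor h hJ.isLocallyPrincipal ≅ twistedNormalBundle I hJ) := by
  obtain ⟨e, -⟩ := exists_iso_of_isSplitting hJ hZ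
    (fun U _ => (firstOrderHomEquiv (t.1 ⟨U, le_top⟩)).comp (firstOrderMk I U))
    (fun U hU => isSplitting_of_firstOrderHomToEnd h (ht U hU)) fun U hU V hVU z => by
      have h1 := firstOrderHomEquiv_res hVU (t.1 ⟨U, le_top⟩) (firstOrderMk I U z)
      rw [t.2 ⟨V, le_top⟩ ⟨U, le_top⟩ hVU] at h1
      exact h1
  exact ⟨e.symm⟩

theorem firstOrderHomToEnd_comp (h : J ≤ I) :
    (twistedNormalToHom I J).toPresheafMap ≫ (firstOrderHomToEnd h).toPresheafMap = 0 := by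
  ext V s
  exact Subtype.ext (funext fun U => firstOrderHomToEnd_twistedNormalToHom h _)

/-- The complex `N_{Z/D} ⊗ J_Z ⟶ ℋom(I/I², J_Z) ⟶ ℋom(J_Z, J_Z)` of sheaves on `Z`. -/
noncomputable def splittingComplex (hJ : J.IsEffectiveCartier)
    (hZ : IsRegularClosedImmersion (inclusion h)) :
    ShortComplex (TopCat.Sheaf AddCommGrpCat.{u} I.subscheme) where
  X₁ := (isQuasicoherent_twistedNormal hJ hZ).isZariskiSheaf.sheaf
  X₂ := (isZariskiSheaf_firstOrderHom (I := I) (J := J)).sheaf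
  X₃ := (isZariskiSheaf_idealRestrictEnd (I := I) (J := J)).sheaf
  f := ⟨(twistedNormalToHom I J).toPresheafMap⟩
  g := ⟨(firstOrderHomToEnd h).toPresheafMap⟩
  zero := Sheaf.hom_ext (firstOrderHomToEnd_comp h)

theorem twistedNormalToHom_sectionsMap_injective (hJ : J.IsEffectiveCartier)
    (hZ : IsRegularClosedImmersion (inclusion h)) (V : I.subscheme.Opens) :
    Function.Injective ((twistedNormalToHom I J).sectionsMap V) := by
  intro s s' hss
  refine sections_ext (isQuasicoherent_twistedNormal hJ hZ).isZariskiSheaf fun z hz => ?_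
  obtain ⟨U, hzU, hUV, hU⟩ := exists_isRegularOn_le hJ hZ hz
  exact ⟨U, hUV, hzU, twistedNormalToHom_injective hU congr(($hss).1 ⟨U, hUV⟩)⟩

theorem exists_twistedNormalToHom_sectionsMap_eq (hJ : J.IsEffectiveCartier)
    (hZ : IsRegularClosedImmersion (inclusion h)) {V : I.subscheme.Opens}
    {x : (firstOrderHom I J).sections V} (hx : (firstOrderHomToEnd h).sectionsMap V x = 0) :
    ∃ y, (twistedNormalToHom I J).sectionsMap V y = x := by
  let T : Set X.AffineZariskiSite := {U | I.subschemeι ⁻¹ᵁ U.aff.1 ≤ V ∧ IsRegularOn I J U}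
  have hT : ∀ U ∈ T, ∀ W ≤ U, W ∈ T := fun U hU W hW =>
    ⟨(preimage_mono hW).trans hU.1, hU.2.mono hW⟩
  have hTV : ∀ z ∈ V, ∃ U ∈ T, I.subschemeι z ∈ U.aff.1 := fun z hz => by
    obtain ⟨U, hzU, hUV, hU⟩ := exists_isRegularOn_le hJ hZ hz
    exact ⟨U, ⟨hUV, hU⟩, hzU⟩
  choose y hy using fun U (hU : U ∈ T) => exists_twistedNormalToHom_eq h hU.2
    (t := x.1 ⟨U, hU.1⟩) congr(($hx).1 ⟨U, hU.1⟩)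
  obtain ⟨s, hs⟩ := exists_sections (isQuasicoherent_twistedNormal hJ hZ).isZariskiSheaf hT hTV y
    fun U hU W hWU => by
      refine twistedNormalToHom_injective (hU.2.mono hWU) ?_
      rw [← (twistedNormalToHom I J).res_app, hy, hy]
      exact x.2 ⟨W, _⟩ ⟨U, _⟩ hWU
  refine ⟨s, sections_ext isZariskiSheaf_firstOrderHom fun z hz => ?_⟩
  obtain ⟨U, hU, hzU⟩ := hTV z hz
  exact ⟨U, hU.1, hzU, (congrArg ((twistedNormalToHom I J).app U) (hs U hU hU.1)).trans (hy U hU)⟩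

/-- Exactness is checked on opens where Z is regularly embedded. On the left, the local preimages
are unique and hence glue; on the right, only local lifts are needed. -/
theorem shortExact_splittingComplex (hJ : J.IsEffectiveCartier)
    (hZ : IsRegularClosedImmersion (inclusion h)) : (splittingComplex hJ hZ).ShortExact := by
  refine Sheaf.shortExact_of_locallySurjective _
    (fun V => twistedNormalToHom_sectionsMap_injective hJ hZ V.unop)
    (fun V x hx => exists_twistedNormalToHom_sectionsMap_eq hJ hZ hx) ?_
  refine (TopCat.Presheaf.isLocallySurjective_iff _).mpr fun V q z hz => ?_
  change (idealRestrictEnd I J).sections V at q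
  obtain ⟨U, hzU, hUV, hU⟩ := exists_isRegularOn_le hJ hZ hz
  obtain ⟨t, ht⟩ := exists_firstOrderHomToEnd_eq h hU (q.1 ⟨U, hUV⟩)
  obtain ⟨s, hs⟩ := exists_sections (V := I.subschemeι ⁻¹ᵁ U.aff.1)
    (isZariskiSheaf_firstOrderHom (I := I) (J := J))
    (T := {W | W ≤ U}) (fun W hW W' hW' => hW'.trans hW) (fun _ hz => ⟨U, le_refl U, hz⟩)
    (fun W hW => (firstOrderHom I J).res hW t) fun W hW W' hW' => (firstOrderHom I J).res_res _ _ _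
  refine ⟨I.subschemeι ⁻¹ᵁ U.aff.1, hUV, ⟨s, ?_⟩, hzU⟩
  refine sections_ext isZariskiSheaf_idealRestrictEnd fun w hw => ⟨U, le_rfl, hw, ?_⟩
  refine (congrArg ((firstOrderHomToEnd h).app U) (hs U (le_refl U) le_rfl)).trans ?_
  rw [(firstOrderHom I J).res_self, ht]
  rfl

theorem nonempty_iso_of_subsingleton_H (hJ : J.IsEffectiveCartier)
    (hZ : IsRegularClosedImmersion (inclusion h)) (hH : Subsingleton (H (twistedNormal I J) 1)) :
    Nonempty (exceptionalDivisor h hJ.isLocallyPrincipal ≅ twistedNormalBundle I hJ) := by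
  -- The cohomology in the hypothesis is that of the sheafification. The presheaf is a sheaf
  -- already, so the vanishing transfers to the complex.
  have hH' : Subsingleton (Sheaf.H (splittingComplex hJ hZ).X₁ 1) := by
    let e := sheafificationIso (splittingComplex hJ hZ).X₁
    refine Function.Injective.subsingleton (f := Sheaf.H.map e.hom 1)
      (β := H (twistedNormal I J) 1) (Function.LeftInverse.injective (g := Sheaf.H.map e.inv 1)
      fun x => ?_)
    refine (Sheaf.H.map_comp_apply _ _ _).symm.trans ?_
    rw [e.hom_inv_id]
    exact Sheaf.H.map_id_apply x
  -- The identity of J_Z is the global section to be lifted; a lift is a splitting over Z.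
  let c : (idealRestrictEnd I J).sections ⊤ :=
    ⟨fun U => idealRestrictEndEquiv.symm LinearMap.id,
      fun U U' h => idealRestrictEndEquiv_symm_one_res h⟩
  obtain ⟨t, ht⟩ := Sheaf.exists_app_eq_of_subsingleton_H (shortExact_splittingComplex hJ hZ) hH'
    (T := ⊤) isTerminalTop c
  exact nonempty_iso_of_sections hJ hZ t fun U hU =>
    congr((show (idealRestrictEnd I J).sections ⊤ from $ht).1 ⟨U, le_top⟩)

end ModulePresheaf
end IdealSheafData
end AlgebraicGeometry.Scheme

/-! ### Affine Z: splittings from a Čech argument -/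

namespace AlgebraicGeometry.Scheme
variable {X : Scheme.{u}}
namespace IdealSheafData

variable {I J : X.IdealSheafData} {h : J ≤ I} {U : X.AffineZariskiSite}

/-- The restriction of global functions on `Z = V(I)` to `Z ∩ U`. -/
noncomputable def globalRes (I : X.IdealSheafData) (U : X.AffineZariskiSite) :
    Γ(I.subscheme, ⊤) →+* I.quot U :=
  ((I.subschemeObjIso U.aff).hom).hom.comp
    (I.subscheme.presheaf.map (homOfLE le_top : I.subschemeι ⁻¹ᵁ U.aff.1 ⟶ ⊤).op).hom

theorem globalRes_eq_mk_iff {g : Γ(I.subscheme, ⊤)} {f : Γ(X, U.aff)} :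
    globalRes I U g = Ideal.Quotient.mk (I.ideal U.aff) f ↔ I.subschemeι.app U.aff f =
      I.subscheme.presheaf.map (homOfLE le_top : I.subschemeι ⁻¹ᵁ U.aff.1 ⟶ ⊤).op g := by
  rw [I.subschemeι_app U.aff]
  change (I.subschemeObjIso U.aff).hom _ = _ ↔ (I.subschemeObjIso U.aff).inv _ = _
  constructor
  · intro e
    exact (congrArg _ e.symm).trans ((I.subschemeObjIso U.aff).hom_inv_id_apply _)
  · intro e
    exact (congrArg _ e.symm).trans ((I.subschemeObjIso U.aff).inv_hom_id_apply _)

theorem quotRes_globalRes {W : X.AffineZariskiSite} (hW : W ≤ U) (g : Γ(I.subscheme, ⊤)) :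
    I.quotRes hW (globalRes I U g) = globalRes I W g := by
  obtain ⟨f, hf⟩ := Ideal.Quotient.mk_surjective (globalRes I U g)
  rw [← hf, quotRes_mk]
  refine (globalRes_eq_mk_iff.mpr ?_).symm
  have h1 := globalRes_eq_mk_iff.mp hf.symm
  have h2 := NatTrans.naturality_apply I.subschemeι.c
    (homOfLE (AffineZariskiSite.le hW)).op f
  refine h2.trans ?_
  refine (congrArg _ h1).trans ?_
  exact congr($((I.subscheme.presheaf.map_comp _ _).symm) g)

theorem preimage_basicOpen_of_globalRes_eq {g : Γ(I.subscheme, ⊤)} {f : Γ(X, U.aff)}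
    (hf : Ideal.Quotient.mk (I.ideal U.aff) f = globalRes I U g) :
    I.subschemeι ⁻¹ᵁ (U.basicOpen f).aff.1 = I.subschemeι ⁻¹ᵁ U.aff.1 ⊓ I.subscheme.basicOpen g := by
  have h1 := globalRes_eq_mk_iff.mp hf.symm
  refine (Scheme.preimage_basicOpen _ _).trans ?_
  refine (congrArg I.subscheme.basicOpen h1).trans ?_
  exact Scheme.basicOpen_res _ _ _

namespace ModulePresheaf

variable {M N : I.ModulePresheaf}

/-- Compatible families of sections form a module over the global functions on `Z`. -/
noncomputable instance (M : I.ModulePresheaf) (V : I.subscheme.Opens) :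
    Module Γ(I.subscheme, ⊤) (M.sections V) where
  smul a s := ⟨fun U => globalRes I U.1 a • s.1 U, fun U U' h => by
    rw [(M.res h).map_smulₛₗ, s.2 U U' h, quotRes_globalRes]⟩
  one_smul s := Subtype.ext (funext fun U => by
    change globalRes I U.1 1 • s.1 U = _; rw [map_one, one_smul])
  mul_smul a b s := Subtype.ext (funext fun U => by
    change globalRes I U.1 (a * b) • s.1 U = globalRes I U.1 a • globalRes I U.1 b • s.1 U
    rw [map_mul, mul_smul])
  smul_zero a := Subtype.ext (funext fun U => smul_zero (globalRes I U.1 a))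
  smul_add a s t := Subtype.ext (funext fun U => smul_add (globalRes I U.1 a) (s.1 U) (t.1 U))
  add_smul a b s := Subtype.ext (funext fun U => by
    change globalRes I U.1 (a + b) • s.1 U = globalRes I U.1 a • s.1 U + globalRes I U.1 b • s.1 U
    rw [map_add, add_smul])
  zero_smul s := Subtype.ext (funext fun U => by
    change globalRes I U.1 0 • s.1 U = 0; rw [map_zero, zero_smul])

theorem smul_sections_apply {V : I.subscheme.Opens} (a : Γ(I.subscheme, ⊤)) (s : M.sections V) (U) :
    (a • s).1 U = globalRes I U.1 a • s.1 U := rfl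

theorem sectionsRes_smul {V W : I.subscheme.Opens} (hVW : V ≤ W) (a : Γ(I.subscheme, ⊤))
    (s : M.sections W) : M.sectionsRes hVW (a • s) = a • M.sectionsRes hVW s := rfl

theorem exists_sections_preimage (hM : M.IsZariskiSheaf) (U : X.AffineZariskiSite) (m : M.obj U) :
    ∃ s : M.sections (I.subschemeι ⁻¹ᵁ U.aff.1), s.1 ⟨U, le_rfl⟩ = m := by
  obtain ⟨s, hs⟩ := exists_sections (V := I.subschemeι ⁻¹ᵁ U.aff.1) hM
    (T := {W | W ≤ U}) (fun W hW W' hW' => hW'.trans hW) (fun _ hz => ⟨U, le_refl U, hz⟩)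
    (fun W hW => M.res hW m) fun W hW W' hW' => M.res_res _ _ _
  exact ⟨s, (hs U (le_refl U) le_rfl).trans (M.res_self _ _)⟩

theorem sections_preimage_ext (hM : M.IsZariskiSheaf) {U : X.AffineZariskiSite}
    {V : I.subscheme.Opens} (hV : I.subschemeι ⁻¹ᵁ U.aff.1 = V) {s s' : M.sections V}
    (hs : s.1 ⟨U, hV.le⟩ = s'.1 ⟨U, hV.le⟩) : s = s' :=
  sections_ext hM fun _ hz => ⟨U, hV.le, hV.ge hz, hs⟩

/-- A section of a quasi-coherent module over `D(g)` extends after multiplication by a power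
of `g`. -/
theorem IsQuasicoherent.exists_sectionsRes_eq_smul (hM : M.IsQuasicoherent) {V : I.subscheme.Opens}
    (hV : I.subschemeι ⁻¹ᵁ U.aff.1 = V) (g : Γ(I.subscheme, ⊤))
    (y : M.sections (V ⊓ I.subscheme.basicOpen g)) :
    ∃ (n : ℕ) (e : M.sections V), M.sectionsRes inf_le_left e = g ^ n • y := by
  obtain ⟨f, hf⟩ := Ideal.Quotient.mk_surjective (globalRes I U g)
  have hW : I.subschemeι ⁻¹ᵁ (U.basicOpen f).aff.1 = V ⊓ I.subscheme.basicOpen g :=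
    hV ▸ preimage_basicOpen_of_globalRes_eq hf
  obtain ⟨n, x, hx⟩ := (hM U f).1 (y.1 ⟨U.basicOpen f, hW.le⟩)
  subst hV
  obtain ⟨e, he⟩ := exists_sections_preimage hM.isZariskiSheaf U x
  refine ⟨n, e, sections_preimage_ext hM.isZariskiSheaf hW ?_⟩
  refine (e.2 ⟨U.basicOpen f, hW.le.trans inf_le_left⟩ ⟨U, le_rfl⟩ (U.basicOpen_le f)).symm.trans ?_
  rw [he, hx, hf, smul_sections_apply, map_pow, quotRes_globalRes]

/-- A section of a quasi-coherent module vanishing on `D(g)` is killed by a power of `g`. -/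
theorem IsQuasicoherent.exists_pow_smul_eq_zero (hM : M.IsQuasicoherent) {V : I.subscheme.Opens}
    (hV : I.subschemeι ⁻¹ᵁ U.aff.1 = V) (g : Γ(I.subscheme, ⊤)) {y : M.sections V}
    (hy : M.sectionsRes (inf_le_left : V ⊓ I.subscheme.basicOpen g ≤ V) y = 0) :
    ∃ n : ℕ, g ^ n • y = 0 := by
  obtain ⟨f, hf⟩ := Ideal.Quotient.mk_surjective (globalRes I U g)
  have hW : I.subschemeι ⁻¹ᵁ (U.basicOpen f).aff.1 = V ⊓ I.subscheme.basicOpen g :=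
    hV ▸ preimage_basicOpen_of_globalRes_eq hf
  obtain ⟨n, hn⟩ := (hM U f).2 (y.1 ⟨U, hV.le⟩)
    ((y.2 ⟨U.basicOpen f, hW.le.trans inf_le_left⟩ ⟨U, hV.le⟩ (U.basicOpen_le f)).trans
      congr(($hy).1 ⟨U.basicOpen f, hW.le⟩))
  refine ⟨n, sections_preimage_ext hM.isZariskiSheaf hV ?_⟩
  rw [smul_sections_apply, map_pow, ← hf, hn]
  rfl

end ModulePresheaf
end IdealSheafData
end AlgebraicGeometry.Scheme

namespace AlgebraicGeometry.Scheme
variable {X : Scheme.{u}}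
namespace IdealSheafData

variable {I J : X.IdealSheafData} {h : J ≤ I}

theorem exists_preimage_eq_inf_basicOpen {V : I.subscheme.Opens} {U : X.AffineZariskiSite}
    (hV : I.subschemeι ⁻¹ᵁ U.aff.1 = V) (g : Γ(I.subscheme, ⊤)) :
    ∃ W ≤ U, I.subschemeι ⁻¹ᵁ W.aff.1 = V ⊓ I.subscheme.basicOpen g := by
  obtain ⟨f, hf⟩ := Ideal.Quotient.mk_surjective (globalRes I U g)
  exact ⟨U.basicOpen f, U.basicOpen_le f, hV ▸ preimage_basicOpen_of_globalRes_eq hf⟩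

/-- Z may be affine without X being so. The opens found here are at once D(g) for a global function
g on Z, as the partition of unity requires, and traces of affine opens of X, on which
quasi-coherence is formulated. -/
theorem exists_preimage_eq_basicOpen [IsAffine I.subscheme] {z : I.subscheme}
    {U : X.AffineZariskiSite} (hzU : I.subschemeι z ∈ U.aff.1) :
    ∃ (g : Γ(I.subscheme, ⊤)) (W : _) (_ : W ≤ U), z ∈ I.subscheme.basicOpen g ∧
      I.subschemeι ⁻¹ᵁ W.aff.1 = I.subscheme.basicOpen g := by
  obtain ⟨g, hg, hz⟩ := (isAffineOpen_top I.subscheme).exists_basicOpen_le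
    (V := I.subschemeι ⁻¹ᵁ U.aff.1) ⟨z, hzU⟩ trivial
  obtain ⟨W, hWU, hW⟩ := exists_preimage_eq_inf_basicOpen (U := U) rfl g
  exact ⟨g, W, hWU, hz, hW.trans (inf_eq_right.mpr hg)⟩

namespace ModulePresheaf

variable {M : I.ModulePresheaf}

set_option maxHeartbeats 400000 in
/-- Čech 1-cocycles with values in a quasi-coherent module, for a covering by finitely many `D(g)`,
are coboundaries. -/
theorem IsQuasicoherent.exists_sectionsRes_sub_eq (hM : M.IsQuasicoherent) {ι : Type*} [Fintype ι]
    {g : ι → Γ(I.subscheme, ⊤)} (hg : Ideal.span (Set.range g) = ⊤)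
    {U : ι → X.AffineZariskiSite}
    (hU : ∀ i, I.subschemeι ⁻¹ᵁ (U i).aff.1 = I.subscheme.basicOpen (g i))
    (u : ∀ i j, M.sections (I.subscheme.basicOpen (g i) ⊓ I.subscheme.basicOpen (g j)))
    (hu : ∀ i j k, M.sectionsRes (le_inf (inf_le_left.trans inf_le_left) inf_le_right) (u i k) -
      M.sectionsRes (le_inf (inf_le_left.trans inf_le_right) inf_le_right) (u j k) =
        M.sectionsRes (inf_le_left : _ ⊓ I.subscheme.basicOpen (g k) ≤ _) (u i j)) :
    ∃ e : ∀ i, M.sections (I.subscheme.basicOpen (g i)), ∀ i j,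
      M.sectionsRes inf_le_left (e i) - M.sectionsRes inf_le_right (e j) = u i j := by
  -- After multiplication by a power of g k, the section u i k extends from the overlap to D(g i).
  choose n e he using fun i k => hM.exists_sectionsRes_eq_smul (hU i) (g k) (u i k)
  obtain ⟨N, hN⟩ := Finite.exists_le fun p : ι × ι => n p.1 p.2
  obtain ⟨e', he'⟩ : ∃ e' : ∀ i (_ : ι), M.sections (I.subscheme.basicOpen (g i)),
      ∀ i k, M.sectionsRes inf_le_left (e' i k) = g k ^ N • u i k :=
    ⟨fun i k => g k ^ (N - n i k) • e i k, fun i k => by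
      rw [sectionsRes_smul, he, smul_smul, ← pow_add, Nat.sub_add_cancel (hN (i, k))]⟩
  -- The error δ vanishes on D(g k) by the cocycle condition, so a further power of g k kills it.
  let δ i j k : M.sections (I.subscheme.basicOpen (g i) ⊓ I.subscheme.basicOpen (g j)) :=
    M.sectionsRes inf_le_left (e' i k) - M.sectionsRes inf_le_right (e' j k) - g k ^ N • u i j
  have hδ i j k : ∃ m : ℕ, g k ^ m • δ i j k = 0 := by
    obtain ⟨W, -, hW⟩ := exists_preimage_eq_inf_basicOpen (hU i) (g j)
    refine hM.exists_pow_smul_eq_zero hW (g k) ?_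
    have h1 : M.sectionsRes (le_inf (inf_le_left.trans inf_le_left) inf_le_right :
        I.subscheme.basicOpen (g i) ⊓ I.subscheme.basicOpen (g j) ⊓ I.subscheme.basicOpen (g k) ≤ _)
          (M.sectionsRes inf_le_left (e' i k)) = _ := congrArg _ (he' i k)
    have h2 : M.sectionsRes (le_inf (inf_le_left.trans inf_le_right) inf_le_right :
        I.subscheme.basicOpen (g i) ⊓ I.subscheme.basicOpen (g j) ⊓ I.subscheme.basicOpen (g k) ≤ _)
          (M.sectionsRes inf_le_left (e' j k)) = _ := congrArg _ (he' j k)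
    rw [map_sub, map_sub, sectionsRes_smul, ← hu i j k, smul_sub, sub_eq_zero]
    rw [sectionsRes_smul] at h1 h2
    exact congrArg₂ (· - ·) h1 h2
  choose m hm using hδ
  obtain ⟨m', hm'⟩ := Finite.exists_le fun p : ι × ι × ι => m p.1 p.2.1 p.2.2
  have hδ i j k : g k ^ m' • δ i j k = 0 := by
    rw [← Nat.sub_add_cancel (hm' (i, j, k)), pow_add, mul_smul, hm, smul_zero]
  have hspan := Ideal.span_pow_eq_top _ hg (m' + N)
  rw [← Set.range_comp, Ideal.eq_top_iff_one] at hspan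
  obtain ⟨a, ha⟩ := (Submodule.mem_span_range_iff_exists_fun _).mp hspan
  -- The difference of the extensions e' i k and e' j k, times g k ^ m', is g k ^ (m' + N) times u i
  -- j; the partition of unity sums these to u i j.
  refine ⟨fun i => ∑ k, (a k * g k ^ m') • e' i k, fun i j => ?_⟩
  rw [map_sum, map_sum, ← Finset.sum_sub_distrib]
  calc _ = ∑ k, (a k • (g k ^ (m' + N))) • u i j := by
        refine Finset.sum_congr rfl fun k _ => ?_
        have := hδ i j k
        rw [smul_sub, sub_eq_zero, smul_smul, ← pow_add] at this
        rw [sectionsRes_smul, sectionsRes_smul, ← smul_sub, mul_smul, this, smul_smul, smul_eq_mul]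
    _ = u i j := by rw [← Finset.sum_smul]; exact (congrArg (· • u i j) ha).trans (one_smul _ _)

/-- Compatible sections over a covering glue. -/
theorem IsZariskiSheaf.exists_sections_top (hM : M.IsZariskiSheaf) {ι : Type u}
    {D : ι → I.subscheme.Opens} (hD : ∀ z, ∃ i, z ∈ D i) (s : ∀ i, M.sections (D i))
    (hs : ∀ i j, M.sectionsRes (inf_le_left : D i ⊓ D j ≤ D i) (s i) =
      M.sectionsRes inf_le_right (s j)) :
    ∃ t : M.sections ⊤, ∀ i, M.sectionsRes le_top t = s i := by
  let s' : ∀ i, ToType (hM.sheaf.obj.obj (op (D i))) := s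
  obtain ⟨t, ht, -⟩ := TopCat.Sheaf.existsUnique_gluing' hM.sheaf D ⊤ (fun i => homOfLE le_top)
    (fun z _ => Opens.mem_iSup.mpr (hD z)) s' hs
  exact ⟨t, ht⟩

theorem IsZariskiSheaf.exists_sections_top_add (hM : M.IsZariskiSheaf) {N : I.ModulePresheaf}
    (f : Hom N M) {ι : Type u} {D : ι → I.subscheme.Opens} (hD : ∀ z, ∃ i, z ∈ D i)
    (s : ∀ i, M.sections (D i)) (e : ∀ i, N.sections (D i))
    (he : ∀ i j, f.sectionsMap (D i ⊓ D j)
      (N.sectionsRes inf_le_left (e i) - N.sectionsRes inf_le_right (e j)) =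
        M.sectionsRes inf_le_right (s j) - M.sectionsRes inf_le_left (s i)) :
    ∃ t : M.sections ⊤, ∀ i, M.sectionsRes le_top t = s i + f.sectionsMap (D i) (e i) := by
  refine hM.exists_sections_top hD _ fun i j => ?_
  have h1 := he i j
  rw [map_sub, sub_eq_sub_iff_add_eq_add, add_comm] at h1
  exact (map_add (M.sectionsRes inf_le_left) (s i) (f.sectionsMap (D i) (e i))).trans
    (h1.trans (map_add (M.sectionsRes inf_le_right) (s j) (f.sectionsMap (D j) (e j))).symm)

theorem exists_sections_firstOrderHomToEnd_eq_id (h : J ≤ I) {U : X.AffineZariskiSite}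
    (hUreg : IsRegularOn I J U) {V : I.subscheme.Opens} (hV : I.subschemeι ⁻¹ᵁ U.aff.1 = V) :
    ∃ s : (firstOrderHom I J).sections V, ∀ W,
      (firstOrderHomToEnd h).app W.1 (s.1 W) = idealRestrictEndEquiv.symm LinearMap.id := by
  obtain ⟨s₀, hs₀⟩ := exists_firstOrderHomToEnd_eq_id h hUreg
  subst hV
  obtain ⟨s, hs⟩ := exists_sections_preimage isZariskiSheaf_firstOrderHom U s₀
  let c : (idealRestrictEnd I J).sections (I.subschemeι ⁻¹ᵁ U.aff.1) :=
    ⟨fun W => idealRestrictEndEquiv.symm LinearMap.id,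
      fun W W' h => idealRestrictEndEquiv_symm_one_res h⟩
  have h1 : (firstOrderHomToEnd h).sectionsMap _ s = c :=
    sections_preimage_ext isZariskiSheaf_idealRestrictEnd rfl
      ((congrArg ((firstOrderHomToEnd h).app U) hs).trans hs₀)
  exact ⟨s, fun W => congr(($h1).1 W)⟩

/-- Two local splittings differ by a section of N_{Z/D} ⊗ J_Z. The differences over a finite
covering by sets D(g) form a Čech cocycle, hence a coboundary, and correcting by it makes the
splittings agree. -/
theorem nonempty_iso_of_isAffine (hJ : J.IsEffectiveCartier)
    (hZ : IsRegularClosedImmersion (inclusion h)) [IsAffine I.subscheme] :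
    Nonempty (exceptionalDivisor h hJ.isLocallyPrincipal ≅ twistedNormalBundle I hJ) := by
  have hF := isQuasicoherent_twistedNormal hJ hZ
  have hE := isZariskiSheaf_firstOrderHom (I := I) (J := J)
  have hQ := isZariskiSheaf_idealRestrictEnd (I := I) (J := J)
  let S : Set Γ(I.subscheme, ⊤) := {g | ∃ U, IsRegularOn I J U ∧
    I.subschemeι ⁻¹ᵁ U.aff.1 = I.subscheme.basicOpen g}
  have hS : Ideal.span S = ⊤ := by
    rw [← (isAffineOpen_top I.subscheme).self_le_iSup_basicOpen_iff]
    intro z _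
    obtain ⟨U, hzU, hU⟩ := exists_isRegularOn hJ hZ (I.subschemeι z)
    obtain ⟨g, W, hWU, hz, hW⟩ := exists_preimage_eq_basicOpen hzU
    exact Opens.mem_iSup.mpr ⟨⟨g, W, hU.mono hWU, hW⟩, hz⟩
  obtain ⟨t, htS, ht⟩ := (Ideal.span_eq_top_iff_finite S).mp hS
  let D : t → I.subscheme.Opens := fun g => I.subscheme.basicOpen g.1
  have hspan : Ideal.span (Set.range (Subtype.val : t → Γ(I.subscheme, ⊤))) = ⊤ := by
    rw [Subtype.range_coe]; exact ht
  have hD : ∀ z, ∃ i, z ∈ D i := fun z => by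
    have := (isAffineOpen_top I.subscheme).self_le_iSup_basicOpen_iff.mpr ht
      (show z ∈ (⊤ : I.subscheme.Opens) from trivial)
    obtain ⟨i, hi⟩ := Opens.mem_iSup.mp this
    exact ⟨i, hi⟩
  choose U hUreg hU using fun g : t => htS g.2
  choose s hs using fun i => exists_sections_firstOrderHomToEnd_eq_id h (hUreg i) (hU i)
  have hu (i j : t) : ∃ u, (twistedNormalToHom I J).sectionsMap (D i ⊓ D j) u =
      (firstOrderHom I J).sectionsRes inf_le_right (s j) -
        (firstOrderHom I J).sectionsRes inf_le_left (s i) := by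
    refine exists_twistedNormalToHom_sectionsMap_eq hJ hZ (Subtype.ext (funext fun W => ?_))
    refine (map_sub ((firstOrderHomToEnd h).app W.1) _ _).trans ?_
    exact (congrArg₂ (· - ·) (hs j _) (hs i _)).trans (sub_self _)
  choose u hu using hu
  have hu' (i j : t) {V : I.subscheme.Opens} (hV : V ≤ D i ⊓ D j) :
      (twistedNormalToHom I J).sectionsMap V ((twistedNormal I J).sectionsRes hV (u i j)) =
        (firstOrderHom I J).sectionsRes (hV.trans inf_le_right) (s j) -
          (firstOrderHom I J).sectionsRes (hV.trans inf_le_left) (s i) :=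
    congrArg ((firstOrderHom I J).sectionsRes hV) (hu i j)
  obtain ⟨e, he⟩ := hF.exists_sectionsRes_sub_eq hspan hU u fun i j k =>
    twistedNormalToHom_sectionsMap_injective hJ hZ _ <| (map_sub _ _ _).trans <|
      (congrArg₂ (· - ·) (hu' i k _) (hu' j k _)).trans <|
        (sub_sub_sub_cancel_left _ _ _).trans (hu' i j _).symm
  -- As u i j maps to s j - s i and equals e i - e j, the sections s i + e i coincide on overlaps.
  -- The correction dies in ℋom(J_Z, J_Z), so the glued section still lifts the identity.
  obtain ⟨r, hr⟩ := hE.exists_sections_top_add (twistedNormalToHom I J) hD s e fun i j =>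
    (congrArg ((twistedNormalToHom I J).sectionsMap (D i ⊓ D j)) (he i j)).trans (hu i j)
  let c : (idealRestrictEnd I J).sections ⊤ :=
    ⟨fun U => idealRestrictEndEquiv.symm LinearMap.id,
      fun U U' h => idealRestrictEndEquiv_symm_one_res h⟩
  have hrc : (firstOrderHomToEnd h).sectionsMap ⊤ r = c := by
    refine sections_ext hQ fun z _ => ?_
    obtain ⟨i, hi⟩ := hD z
    refine ⟨U i, le_top, (hU i).ge hi, ?_⟩
    have h1 := congr(($(hr i)).1 ⟨U i, (hU i).le⟩)
    refine (congrArg ((firstOrderHomToEnd h).app (U i)) h1).trans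
      ((map_add ((firstOrderHomToEnd h).app (U i)) _ _).trans ?_)
    exact (congrArg₂ (· + ·) (hs i _) (firstOrderHomToEnd_twistedNormalToHom h _)).trans (add_zero _)
  exact nonempty_iso_of_sections hJ hZ r fun U hU => congr(($hrc).1 ⟨U, le_top⟩)

end ModulePresheaf
end IdealSheafData
end AlgebraicGeometry.Scheme

theorem proposition2p7 {X : AlgebraicGeometry.Scheme.{u}} (I J : X.IdealSheafData) (h : J ≤ I)
    (hJ : J.IsEffectiveCartier) (hZ : IsRegularClosedImmersion (inclusion h)) :
    (∀ z : I.subscheme, ∃ V : I.subscheme.Opens, z ∈ V ∧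
      Nonempty (overRestrict (exceptionalDivisor h hJ.isLocallyPrincipal) V ≅
        overRestrict (twistedNormalBundle I hJ) V) ∧
      ∃ n : ℕ, Nonempty (overRestrict (exceptionalDivisor h hJ.isLocallyPrincipal) V ≅
        Over.mk (𝔸(ULift.{u} (Fin n); V.toScheme) ↘ V.toScheme))) ∧
    (Subsingleton (ModulePresheaf.H (ModulePresheaf.twistedNormal I J) 1) →
      Nonempty (exceptionalDivisor h hJ.isLocallyPrincipal ≅ twistedNormalBundle I hJ)) ∧
    (IsAffine I.subscheme →
      Nonempty (exceptionalDivisor h hJ.isLocallyPrincipal ≅ twistedNormalBundle I hJ)) ∧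
    (∀ (K : X.IdealSheafData) (hK : K ≤ I),
      IsPullback (inclusion hK) (inclusion h) K.subschemeι J.subschemeι →
      (inclusion hK).ker.IsEffectiveCartier →
      ∃! e : twistedNormalBundle I hJ ≅ exceptionalDivisor h hJ.isLocallyPrincipal,
        IsSplitBy h hJ hK e) := by
  exact ⟨IdealSheafData.ModulePresheaf.exists_nhds_exceptionalDivisor hJ hZ,
    IdealSheafData.ModulePresheaf.nonempty_iso_of_subsingleton_H hJ hZ,
    fun _ => IdealSheafData.ModulePresheaf.nonempty_iso_of_isAffine hJ hZ,
    fun _ _ hp hC => IdealSheafData.ModulePresheaf.existsUnique_isSplitBy hJ hZ hp hC⟩
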